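/- Let $\mathfrak H$ be the upper half-plane and, for $z\in\mathfrak H$ and rational $r$, write $q^r=e^{2\pi i r z}$. Let $$\eta(z)=q^{1/24}\prod_{n\ge1}(1-q^n),\qquad \Delta=\eta^{24},$$ $$E_2=1-24\sum_{n\ge1}\sigma_1(n)q^n,\qquad E_4=1+240\sum_{n\ge1}\sigma_3(n)q^n,\qquad E_6=1-504\sum_{n\ge1}\sigma_5(n)q^n,$$ and $j=E_4^3/\Delta$. Let $p(n)$ be the number of partitions of $n$, with $p(0)=1$ and $p(x)=0$ if $x$ is not a nonnegative integer, and put $d(x)=(24x-1)p(x)$. Let $\chi_{12}(n)=1$ if $n\equiv\pm1\pmod{12}$, $\chi_{12}(n)=-1$ if $n\equiv\pm5\pmod{12}$, and $\chi_{12}(n)=0$ otherwise. Let $\left(\tfrac{\cdot}{\ell}\right)$ denote the Legendre symbol. Define polynomials $A_m(x)\in\mathbb Z[x]$ by the identity of formal power series in $q$ $$\sum_{m\ge0}A_m(x)q^m=\prod_{n\ge1}(1-q^n)\cdot\frac{E_4^2E_6}{\Delta}\cdot\frac1{j-x}.$$ For a prime $\ell\ge5$ let $s_\ell=(\ell^2-1)/24$,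 let $$C_\ell(x)=\ell\,\chi_{12}(\ell)+A_{s_\ell}(x)=\sum_{n=0}^{s_\ell}c_{n,\ell}\,x^n,$$ and let $$\Xi_\ell(z)=\sum_{n=-s_\ell}^{\infty}\left(d(\ell^2n-s_\ell)+\chi_{12}(\ell)\left(\left(\tfrac{1-24n}{\ell}\right)-1-\ell\right)d(n)+\ell\,d\!\left(\tfrac{n+s_\ell}{\ell^2}\right)\right)q^{n-1/24}.$$ **Theorem.** For every prime $\ell\ge5$ and every $z\in\mathfrak H$ the series $\Xi_\ell(z)$ converges absolutely, and $$\ell\,\Xi_\ell(z)\,\eta(z)\,\Delta(z)^{s_\ell}=-\sum_{n=0}^{s_\ell}c_{n,\ell}\,E_4(z)^{3n-1}\Delta(z)^{s_\ell-n}\bigl(24n\,E_6(z)+E_4(z)E_2(z)\bigr)+\chi_{12}(\ell)\,\ell(1+\ell)\,E_2(z)\,\Delta(z)^{s_\ell},$$ where $E_4^{3n-1}(24nE_6+E_4E_2)$ is read as $24n\,E_4^{3n-1}E_6+E_4^{3n}E_2$, that is, as $E_2$ when $n=0$. -/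

import Mathlib

namespace HeckePartition

open scoped ArithmeticFunction.sigma

noncomputable section

/-- The partition function, extended by zero to all rational arguments
that are not nonnegative integers. -/
def p (x : ℚ) : ℤ :=
  if x.den = 1 ∧ 0 ≤ x then (Fintype.card (Nat.Partition x.num.toNat) : ℤ) else 0

/-- `d(x) = (24 x - 1) p(x)`. -/
def d (x : ℚ) : ℚ := (24 * x - 1) * (p x : ℚ)

/-- The character `χ₁₂`: `1` at `±1 mod 12`, `-1` at `±5 mod 12`, and `0` elsewhere. -/
def chi12 (n : ℕ) : ℤ :=
  if n % 12 = 1 ∨ n % 12 = 11 then 1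
  else if n % 12 = 5 ∨ n % 12 = 7 then -1
  else 0

/-- `s_ℓ = (ℓ² - 1) / 24`; the division is exact when `ℓ` is coprime to `6`. -/
def s (ℓ : ℕ) : ℕ := (ℓ ^ 2 - 1) / 24

/-! ### The polynomials `A_m` and `C_ℓ` -/

/-- The `q`-series `E₄ = 1 + 240 ∑ σ₃(n) qⁿ`. -/
def qE4 : PowerSeries ℤ :=
  PowerSeries.mk fun n ↦ if n = 0 then 1 else 240 * (σ 3 n : ℤ)

/-- The `q`-series `E₆ = 1 - 504 ∑ σ₅(n) qⁿ`. -/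
def qE6 : PowerSeries ℤ :=
  PowerSeries.mk fun n ↦ if n = 0 then 1 else -504 * (σ 5 n : ℤ)

open scoped PowerSeries.WithPiTopology in
/-- The infinite product `E(q) = ∏_{n ≥ 1} (1 - qⁿ)`, a convergent product in `ℤ⟦q⟧`. -/
def qEuler : PowerSeries ℤ :=
  ∏' n : ℕ, (1 - PowerSeries.X ^ (n + 1) : PowerSeries ℤ)

/-- The `q`-series `Δ = q ∏_{n ≥ 1} (1 - qⁿ)²⁴`. -/
def qDelta : PowerSeries ℤ := PowerSeries.X * qEuler ^ 24

/-- Series in `q` with coefficients in `ℤ`, regarded as having coefficients in `ℤ[x]`. -/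
def toPolyCoeff : PowerSeries ℤ →+* PowerSeries (Polynomial ℤ) :=
  PowerSeries.map Polynomial.C

/-- The series `Δ (j - x) = E₄³ - x Δ` over `ℤ[x]`, where `j = E₄³ / Δ`.
Its constant term is `1`. -/
def deltaMulJSub : PowerSeries (Polynomial ℤ) :=
  toPolyCoeff (qE4 ^ 3) - PowerSeries.C (Polynomial.X : Polynomial ℤ) * toPolyCoeff qDelta

/-- The generating function `E(q) · (E₄² E₆ / Δ) · 1 / (j - x) = E(q) E₄² E₆ / (Δ (j - x))`,
a power series in `q` over `ℤ[x]`. -/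
def onoSeries : PowerSeries (Polynomial ℤ) :=
  toPolyCoeff (qEuler * qE4 ^ 2 * qE6) * PowerSeries.invOfUnit deltaMulJSub 1

theorem constantCoeff_deltaMulJSub : PowerSeries.constantCoeff deltaMulJSub = 1 := by
  have h : PowerSeries.constantCoeff qE4 = 1 := by
    rw [← PowerSeries.coeff_zero_eq_constantCoeff_apply, qE4, PowerSeries.coeff_mk, if_pos rfl]
  have hm (f : PowerSeries ℤ) : PowerSeries.constantCoeff (toPolyCoeff f)
      = Polynomial.C (PowerSeries.constantCoeff f) := by
    rw [← PowerSeries.coeff_zero_eq_constantCoeff_apply, toPolyCoeff, PowerSeries.coeff_map,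
      PowerSeries.coeff_zero_eq_constantCoeff_apply]
  simp [deltaMulJSub, hm, h, qDelta]

/-- The inverse in the definition of `onoSeries` is a genuine one. -/
theorem onoSeries_mul_deltaMulJSub :
    onoSeries * deltaMulJSub = toPolyCoeff (qEuler * qE4 ^ 2 * qE6) := by
  have h : deltaMulJSub * PowerSeries.invOfUnit deltaMulJSub 1 = 1 :=
    PowerSeries.mul_invOfUnit _ _ (by simpa using constantCoeff_deltaMulJSub)
  rw [onoSeries, mul_assoc, mul_comm _ deltaMulJSub, h, mul_one]

/-- `A_m(x)`, the coefficient of `q^m` in the generating function. -/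
def A (m : ℕ) : Polynomial ℤ := PowerSeries.coeff m onoSeries

/-- `C_ℓ(x) = ℓ χ₁₂(ℓ) + A_{s_ℓ}(x)`. -/
def C (ℓ : ℕ) : Polynomial ℤ := Polynomial.C ((ℓ : ℤ) * chi12 ℓ) + A (s ℓ)

/-- `c_{n,ℓ}`, the coefficient of `xⁿ` in `C_ℓ(x)`. -/
def c (n ℓ : ℕ) : ℤ := (C ℓ).coeff n

/-! ### The series `Ξ_ℓ` -/

/-- The coefficient of `q^(n - 1/24)` in `Ξ_ℓ`. -/
def xiCoeff (ℓ : ℕ) [Fact ℓ.Prime] (n : ℤ) : ℚ :=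
  d ((ℓ : ℚ) ^ 2 * n - s ℓ)
    + chi12 ℓ * ((legendreSym ℓ (1 - 24 * n) : ℚ) - 1 - ℓ) * d n
    + ℓ * d (((n : ℚ) + s ℓ) / (ℓ : ℚ) ^ 2)

/-- The terms `xiCoeff ℓ n * q^(n - 1/24)` of `Ξ_ℓ(z)` for `n = m - s_ℓ`, `m = 0, 1, 2, …`,
where `q^r = exp(2 π i r z)`. -/
def xiTerm (ℓ : ℕ) [Fact ℓ.Prime] (z : UpperHalfPlane) (m : ℕ) : ℂ :=
  (xiCoeff ℓ ((m : ℤ) - s ℓ) : ℂ) *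
    Complex.exp (2 * Real.pi * Complex.I * (((m : ℂ) - s ℓ) - 1 / 24) * z)

/-- `Ξ_ℓ(z) = ∑_{n ≥ -s_ℓ} xiCoeff ℓ n * q^(n - 1/24)`. -/
def Xi (ℓ : ℕ) [Fact ℓ.Prime] (z : UpperHalfPlane) : ℂ := ∑' m : ℕ, xiTerm ℓ z m

end

end HeckePartition

/-! The function 1/η has weight −1/2 and expansion ∑ p(n) q^(n−1/24). The Hecke operator of index
ℓ², scaled by ℓ³ to clear denominators, sends it to `heckeInv`, whose coefficients are `heckeCoeff`.
The theorem is the derivative of the identity η · `heckeInv` = C_ℓ(j).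

Modularity. `heckeInv` is a sum of translates of 1/η, so the explicit multiplier of η
(`exists_etaRel`, by descent on matrices with nonnegative entries) determines its behaviour under z
↦ −1/z. The translates by units modulo ℓ² are permuted among themselves. Those by nonzero multiples
of ℓ are exchanged with the quadratic twist, and z/ℓ² is exchanged with ℓ²z. The second exchange
involves a Gauss sum, but its sign is never evaluated: the same computation for η itself, whose
twist and translates are known from the pentagonal number theorem, forces the needed relation
(`gauss_relation`). Hence `heckeInv_neg_one_div`, and η · `heckeInv` is invariant of weight 0.

Principal part. Comparing coefficients (`heckeCoeff_of_le`), η · `heckeInv` = q^(−s) ∏(1−qⁿ) +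
ℓχ₁₂(ℓ) + O(q). With t = 1/j = Δ/E₄³, the logarithmic derivative of t is E₆/E₄, so the generating
function of the A_m is ∏(1−qⁿ) · (q t'/t) · 1/(1−xt). Its coefficients are residues that compute an
expansion in powers of 1/t, so A_s(j) agrees with q^(−s) ∏(1−qⁿ) up to O(q) (`X_pow_dvd_sub_A`). The
difference of η · `heckeInv` and C_ℓ(j) is therefore holomorphic of weight 0 and vanishes at the
cusp, so it is zero (`discriminant_pow_mul_heckeInv`).

Differentiation. As d(n) = (24n−1)p(n), the operator 24 q d/dq turns the coefficients of `heckeInv`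
and 1/η into those of ℓΞ_ℓ (`natCast_mul_xiCoeff`). The equations for the derivatives of E₄, Δ and η
give the right-hand side (`deriv_heckeInv`, `deriv_etaInv`). -/

namespace HeckeEta
open Complex hiding eta
open ModularForm

noncomputable section

/-! ### Roots of unity and branches of the square root -/

/-- The primitive 24th root of unity `e(1/24)`. -/
def zeta24 : ℂ := cexp (2 * Real.pi * I / 24)

lemma zeta24_zpow (n : ℤ) : zeta24 ^ n = cexp (2 * Real.pi * I * n / 24) := by
  rw [zeta24, ← Complex.exp_int_mul]; congr 1; ring

lemma zeta24_ne_zero : zeta24 ≠ 0 := Complex.exp_ne_zero _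

lemma zeta24_zpow_twentyFour_mul (n : ℤ) : zeta24 ^ (24 * n) = 1 := by
  rw [zeta24_zpow, Complex.exp_eq_one_iff]
  exact ⟨n, by push_cast; ring⟩

lemma zeta24_zpow_congr {m n : ℤ} (h : (24 : ℤ) ∣ m - n) : zeta24 ^ m = zeta24 ^ n := by
  obtain ⟨k, hk⟩ := h
  obtain rfl : m = n + 24 * k := by lia
  rw [zpow_add₀ zeta24_ne_zero, zeta24_zpow_twentyFour_mul, mul_one]

lemma zeta24_zpow_twelve : zeta24 ^ (12 : ℤ) = -1 := by
  rw [zeta24_zpow, ← Complex.exp_pi_mul_I]; congr 1; push_cast; ring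

lemma zeta24_zpow_six : zeta24 ^ (6 : ℤ) = I := by
  rw [zeta24_zpow, show (2 * Real.pi * I * (6 : ℤ) / 24 : ℂ) = Real.pi / 2 * I by push_cast; ring,
    Complex.exp_mul_I, Complex.cos_pi_div_two, Complex.sin_pi_div_two]
  simp

lemma neg_one_pow_eq_zeta24 (n : ℕ) : (-1 : ℂ) ^ n = zeta24 ^ (12 * (n : ℤ)) := by
  rw [zpow_mul, zeta24_zpow_twelve, zpow_natCast]

lemma sqrt_sq (z : ℂ) : sqrt z ^ 2 = z := by
  simp [sqrt, ← Complex.cpow_nat_mul]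

lemma sqrt_ne_zero {z : ℂ} (hz : z ≠ 0) : sqrt z ≠ 0 := fun h ↦ hz (by rw [← sqrt_sq z, h]; simp)

lemma abs_re_lt_norm {z : ℂ} (hz : 0 < z.im) : |z.re| < ‖z‖ := Complex.abs_re_lt_norm.mpr hz.ne'

lemma sqrt_re_pos {z : ℂ} (hz : 0 < z.im) : 0 < (sqrt z).re := by
  rw [sqrt, Complex.cpow_inv_two_re]
  exact Real.sqrt_pos.mpr (by linarith [abs_lt.mp (abs_re_lt_norm hz)])

lemma sqrt_im_pos {z : ℂ} (hz : 0 < z.im) : 0 < (sqrt z).im := by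
  rw [sqrt, Complex.cpow_inv_two_im_eq_sqrt hz.le]
  exact Real.sqrt_pos.mpr (by linarith [abs_lt.mp (abs_re_lt_norm hz)])

/-- The principal root of a point of the upper half-plane lies in the open first quadrant, so its
negative has negative imaginary part and is excluded. -/
lemma eq_sqrt_of_sq_eq {x z : ℂ} (hz : 0 < z.im) (hx : 0 < x.im) (h : x ^ 2 = z) : x = sqrt z := by
  have h' : x ^ 2 = sqrt z ^ 2 := h.trans (sqrt_sq z).symm
  rcases sq_eq_sq_iff_eq_or_eq_neg.mp h' with h | h
  · exact h
  · have := sqrt_im_pos hz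
    rw [h, Complex.neg_im] at hx
    linarith

/-- Two numbers of the open first quadrant have a product with positive imaginary part, so no sign
enters. This keeps the automorphy factors of η free of branch corrections. -/
lemma sqrt_mul_of_im_pos {w z : ℂ} (hw : 0 < w.im) (hz : 0 < z.im) (hwz : 0 < (w * z).im) :
    sqrt (w * z) = sqrt w * sqrt z := by
  refine (eq_sqrt_of_sq_eq hwz ?_ (by rw [mul_pow, sqrt_sq, sqrt_sq])).symm
  rw [Complex.mul_im]
  have := sqrt_re_pos hw; have := sqrt_re_pos hz
  have := sqrt_im_pos hw; have := sqrt_im_pos hz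
  positivity

lemma sqrt_ofReal_mul {r : ℝ} (hr : 0 < r) {z : ℂ} (hz : 0 < z.im) :
    sqrt (r * z) = (√r : ℝ) * sqrt z := by
  refine (eq_sqrt_of_sq_eq ?_ ?_ ?_).symm
  · rw [Complex.im_ofReal_mul]; positivity
  · have := sqrt_im_pos hz
    rw [Complex.im_ofReal_mul]; have := Real.sqrt_pos.mpr hr; positivity
  · rw [mul_pow, sqrt_sq, ← Complex.ofReal_pow, Real.sq_sqrt hr.le]

lemma sqrt_neg_one_div_mul_sqrt {z : ℂ} (hz : 0 < z.im) : sqrt (-1 / z) * sqrt z = I := by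
  have hz0 : z ≠ 0 := by rintro rfl; simp at hz
  have him : 0 < (-1 / z).im := by
    rw [neg_div, one_div, Complex.neg_im, Complex.inv_im, neg_div, neg_neg]
    exact div_pos hz (Complex.normSq_pos.mpr hz0)
  have h : (sqrt (-1 / z) * sqrt z) ^ 2 = I ^ 2 := by
    rw [mul_pow, sqrt_sq, sqrt_sq, Complex.I_sq, div_mul_cancel₀ _ hz0]
  rcases sq_eq_sq_iff_eq_or_eq_neg.mp h with h | h
  · exact h
  · have h' := congrArg Complex.im h
    rw [Complex.mul_im] at h'
    have := sqrt_re_pos hz; have := sqrt_re_pos him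
    have := sqrt_im_pos hz; have := sqrt_im_pos him
    simp only [Complex.neg_im, Complex.I_im] at h'
    have : 0 < (sqrt (-1 / z)).re * (sqrt z).im + (sqrt (-1 / z)).im * (sqrt z).re := by positivity
    linarith

/-! ### The multiplier system of the Dedekind eta function -/

lemma eta_add_one (z : ℂ) : eta (z + 1) = zeta24 * eta z := by
  have hq : Function.Periodic.qParam 24 (z + 1) = zeta24 * Function.Periodic.qParam 24 z := by
    rw [Function.Periodic.qParam, Function.Periodic.qParam, zeta24, ← Complex.exp_add]
    congr 1; push_cast; ring
  have h (n : ℕ) : eta_q n (z + 1) = eta_q n z := by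
    rw [eta_q_eq_pow, eta_q_eq_pow, mul_add, mul_one, Complex.exp_periodic]
  simp only [eta, hq, h, mul_assoc]

lemma sqrt_I_eq : sqrt I = zeta24 ^ (3 : ℤ) := by
  refine (eq_sqrt_of_sq_eq (by simp) ?_ ?_).symm
  · rw [zeta24_zpow, show (2 * Real.pi * I * (3 : ℤ) / 24 : ℂ) = (Real.pi / 4 : ℝ) * I by
      push_cast; ring, Complex.exp_ofReal_mul_I_im]
    exact Real.sin_pos_of_pos_of_lt_pi (by positivity) (by linarith [Real.pi_pos])
  · rw [← zeta24_zpow_six, ← zpow_natCast, ← zpow_mul]; norm_num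

lemma eta_neg_one_div {z : ℂ} (hz : 0 < z.im) :
    eta (-1 / z) = zeta24 ^ (-3 : ℤ) * sqrt z * eta z := by
  have h := eta_comp_eq_csqrt_I_inv hz
  simp only [Function.comp_apply, Pi.smul_apply, Pi.mul_apply, smul_eq_mul] at h
  rw [h, sqrt_I_eq, zpow_neg, mul_assoc]

/-- The map is a translation, the inversion and a translation again. It is the second generator U,
which together with T reaches every determinant-one matrix with nonnegative entries. -/
lemma eta_div_add_one {z : ℂ} (hz : 0 < z.im) :
    eta (z / (z + 1)) = zeta24 ^ (-2 : ℤ) * sqrt (z + 1) * eta z * zeta24 := by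
  have hz1 : 0 < (z + 1).im := by simpa using hz
  have h0 : z + 1 ≠ 0 := by intro h; rw [h] at hz1; simp at hz1
  have : z / (z + 1) = -1 / (z + 1) + 1 := by field_simp; ring
  rw [this, eta_add_one, eta_neg_one_div hz1, eta_add_one,
    show (-2 : ℤ) = -3 + 1 from rfl, zpow_add₀ zeta24_ne_zero, zpow_one]
  ring

/-- Modulo c + d one has d ≡ −c. The sign collects the symbol of −1 and the sign of quadratic
reciprocity. -/
lemma jacobiSym_add_right_even {c d : ℕ} (hc : Odd c) (hd : Even d) :
    (jacobiSym d (c + d) : ℂ)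
      = (-1) ^ ((c + d) / 2 * (1 + c / 2)) * jacobiSym d c := by
  have hcd : Odd (c + d) := hc.add_even hd
  have h1 : jacobiSym d (c + d) = jacobiSym (-c) (c + d) := by
    apply jacobiSym.mod_left'
    exact Int.ModEq.symm (Int.modEq_iff_dvd.mpr ⟨1, by push_cast; ring⟩)
  have h2 : jacobiSym (c + d : ℕ) c = jacobiSym d c := by
    apply jacobiSym.mod_left'
    simp
  rw [h1, jacobiSym.neg _ hcd, ZMod.χ₄_eq_neg_one_pow (Nat.odd_iff.mp hcd),
    jacobiSym.quadratic_reciprocity hc hcd, h2]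
  push_cast
  rw [mul_add, mul_one, pow_add, mul_comm ((c + d) / 2) (c / 2), mul_assoc]

/-- `EtaRel a b c d ε` states `η((az+b)/(cz+d)) = ε (cz+d)^{1/2} η(z)` on the upper half-plane. -/
def EtaRel (a b c d : ℕ) (ε : ℂ) : Prop :=
  ∀ z : ℂ, 0 < z.im → eta ((a * z + b) / (c * z + d)) = ε * sqrt (c * z + d) * eta z

lemma EtaRel.mul_T {a b c d : ℕ} {ε : ℂ} (h : EtaRel a b c d ε) :
    EtaRel a (a + b) c (c + d) (ε * zeta24) := by
  intro z hz
  have := h (z + 1) (by simpa using hz)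
  rw [eta_add_one] at this
  push_cast
  rw [show (a * z + (a + b) : ℂ) = a * (z + 1) + b by ring,
    show (c * z + (c + d) : ℂ) = c * (z + 1) + d by ring, this]
  ring

lemma EtaRel.mul_U {a b c d : ℕ} {ε : ℂ} (hdet : a * d = b * c + 1) (h : EtaRel a b c d ε) :
    EtaRel (a + b) b (c + d) d (ε * zeta24 ^ (-1 : ℤ)) := by
  intro z hz
  have hz1 : 0 < (z + 1).im := by simpa using hz
  have h0 : z + 1 ≠ 0 := by intro h; rw [h] at hz1; simp at hz1
  have him : 0 < (z / (z + 1)).im := by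
    have : z / (z + 1) = 1 - (z + 1)⁻¹ := by field_simp; ring
    rw [this, Complex.sub_im, Complex.inv_im, Complex.one_im, zero_sub, neg_div, neg_neg]
    exact div_pos hz1 (Complex.normSq_pos.mpr h0)
  have hd : 0 < d := Nat.pos_of_ne_zero (by rintro rfl; lia)
  have hden : (c * (z / (z + 1)) + d) * (z + 1) = ((c + d : ℕ) : ℂ) * z + d := by
    push_cast; field_simp; ring
  have hsq : sqrt (c * (z / (z + 1)) + d) * sqrt (z + 1) = sqrt (((c + d : ℕ) : ℂ) * z + d) := by
    -- Nonnegative entries put both factors in the upper half-plane when c > 0, so the roots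
    -- multiply. When c = 0 the determinant forces d = 1.
    rcases Nat.eq_zero_or_pos c with rfl | hc
    · have : d = 1 := by
        rw [mul_zero, zero_add] at hdet
        exact Nat.eq_one_of_mul_eq_one_left hdet
      subst this
      simp
    · rw [← hden]
      refine (sqrt_mul_of_im_pos ?_ hz1 ?_).symm
      · simpa using mul_pos (Nat.cast_pos.mpr hc) him
      · rw [hden]
        simpa using mul_pos (show (0 : ℝ) < c + d by positivity) hz
  have hnum : (a * (z / (z + 1)) + b) / (c * (z / (z + 1)) + d)
      = ((a + b : ℕ) * z + b) / ((c + d : ℕ) * z + d) := by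
    rw [← hden, show ((a + b : ℕ) * z + b : ℂ) = (a * (z / (z + 1)) + b) * (z + 1) by
      push_cast; field_simp; ring, mul_div_mul_right _ _ h0]
  rw [← hnum, h _ him, eta_div_add_one hz, ← hsq, show (-1 : ℤ) = -2 + 1 from rfl,
    zpow_add₀ zeta24_ne_zero, zpow_one]
  ring

/-! ### Congruences modulo 24 for the multiplier exponents -/

/-- The exponent of `zeta24` in the eta multiplier for odd `c`. -/
def expOddC (a b c d : ℤ) : ℤ := (a + d) * c - b * d * (c ^ 2 - 1) - 3 * c

/-- The exponent of `zeta24` in the eta multiplier for odd `d`. -/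
def expOddD (a b c d : ℤ) : ℤ := (a + d) * c - b * d * (c ^ 2 - 1) + 3 * d - 3 - 3 * c * d

lemma twentyFour_dvd_of_three_of_eight {x : ℤ} (h3 : (3 : ℤ) ∣ x) (h8 : (8 : ℤ) ∣ x) :
    (24 : ℤ) ∣ x := by lia

lemma eight_dvd_sq_sub_one {c : ℤ} (hc : Odd c) : (8 : ℤ) ∣ c ^ 2 - 1 :=
  Int.eight_dvd_sq_sub_one_of_odd hc

lemma three_dvd_iff (x : ℤ) : (3 : ℤ) ∣ x ↔ (x : ZMod 3) = 0 :=
  (ZMod.intCast_zmod_eq_zero_iff_dvd x 3).symm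

lemma two_dvd_iff (x : ℤ) : (2 : ℤ) ∣ x ↔ (x : ZMod 2) = 0 :=
  (ZMod.intCast_zmod_eq_zero_iff_dvd x 2).symm

lemma expOddC_mul_T {a b c d : ℤ} (hdet : a * d = b * c + 1) (hc : Odd c) :
    (24 : ℤ) ∣ expOddC a (a + b) c (c + d) - (expOddC a b c d + 1) := by
  have h : expOddC a (a + b) c (c + d) - (expOddC a b c d + 1)
      = -(c * (c ^ 2 - 1) * (2 * b + a)) := by
    simp only [expOddC]; linear_combination (-(c ^ 2 - 1)) * hdet
  rw [h, dvd_neg]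
  refine twentyFour_dvd_of_three_of_eight ((three_dvd_iff _).mpr ?_)
    (((eight_dvd_sq_sub_one hc).mul_left _).mul_right _)
  push_cast
  generalize (c : ZMod 3) = c'; generalize (2 * b + a : ZMod 3) = x
  revert c' x; decide

lemma expOddD_mul_U {a b c d : ℤ} (hdet : a * d = b * c + 1) (hd : Odd d) :
    (24 : ℤ) ∣ expOddD (a + b) b (c + d) d - (expOddD a b c d - 1) := by
  have h : expOddD (a + b) b (c + d) d - (expOddD a b c d - 1)
      = -((d ^ 2 - 1) * (2 * a * d + b * d)) := by
    simp only [expOddD]; linear_combination (2 * d ^ 2 - 1) * hdet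
  rw [h, dvd_neg]
  refine twentyFour_dvd_of_three_of_eight ((three_dvd_iff _).mpr ?_)
    ((eight_dvd_sq_sub_one hd).mul_right _)
  push_cast
  generalize (a : ZMod 3) = a'; generalize (b : ZMod 3) = b'; generalize (d : ZMod 3) = d'
  revert a' b' d'; decide

/-- Here c = 2k and d = 2l + 1. The term 12(k+l)(1+l) is the sign of `jacobiSym_add_right_even`,
written as a power of `zeta24`. -/
lemma expOddD_mul_T {a b k l : ℤ} (hdet : a * (2 * l + 1) = b * (2 * k) + 1) :
    (24 : ℤ) ∣ expOddD a (a + b) (2 * k) (2 * k + (2 * l + 1)) + 12 * ((k + l) * (1 + l))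
      - (expOddD a b (2 * k) (2 * l + 1) + 1) := by
  obtain ⟨m, rfl⟩ : Odd a := by
    rcases Int.even_or_odd a with ⟨m, rfl⟩ | h
    · exfalso; have : 2 * (m * (2 * l + 1)) = 2 * (b * k) + 1 := by linarith
      lia
    · exact h
  have h : expOddD (2 * m + 1) (2 * m + 1 + b) (2 * k) (2 * k + (2 * l + 1))
        + 12 * ((k + l) * (1 + l)) - (expOddD (2 * m + 1) b (2 * k) (2 * l + 1) + 1)
      = 4 * (k * (1 - 2 * k) * (2 * k * b + 2 * k * m + k + b + m + 2)
        + 3 * ((k + l) * (1 + l))) := by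
    simp only [expOddD]; linear_combination (-((2 * k) ^ 2 - 1)) * hdet
  -- The determinant equation with a = 2m + 1. It is needed only modulo 2, the factor 4 being
  -- already visible; modulo 3 the congruence holds identically.
  have hbk : b * k = 2 * (m * l) + m + l := by linarith
  rw [h]
  refine twentyFour_dvd_of_three_of_eight ((three_dvd_iff _).mpr ?_) ?_
  · push_cast
    generalize (k : ZMod 3) = k'; generalize (l : ZMod 3) = l'; generalize (m : ZMod 3) = m'
    generalize (b : ZMod 3) = b'
    revert k' l' m' b'; decide
  · rw [show (8 : ℤ) = 4 * 2 from rfl]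
    refine mul_dvd_mul_left 4 ((two_dvd_iff _).mpr ?_)
    have hbk' := congrArg (Int.cast : ℤ → ZMod 2) hbk
    push_cast at hbk' ⊢
    generalize (k : ZMod 2) = k' at *; generalize (l : ZMod 2) = l' at *
    generalize (m : ZMod 2) = m' at *; generalize (b : ZMod 2) = b' at *
    revert k' l' m' b'; decide

lemma expOddC_mul_U {a b k l : ℤ} (hdet : a * (2 * k) = b * (2 * l + 1) + 1) :
    (24 : ℤ) ∣ expOddC (a + b) b (2 * l + 1 + 2 * k) (2 * k) + 12 * ((k + l) * (1 + l))
      - (expOddC a b (2 * l + 1) (2 * k) - 1) := by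
  obtain ⟨m, rfl⟩ : Odd b := by
    rcases Int.even_or_odd b with ⟨m, rfl⟩ | h
    · exfalso; have : 2 * (a * k) = 2 * (m * (2 * l + 1)) + 1 := by linarith
      lia
    · exact h
  have h : expOddC (a + (2 * m + 1)) (2 * m + 1) (2 * l + 1 + 2 * k) (2 * k)
        + 12 * ((k + l) * (1 + l)) - (expOddC a (2 * m + 1) (2 * l + 1) (2 * k) - 1)
      = 4 * (k * (2 * k - 1) * (1 - 2 * k * a - 2 * k * m - k - a - m)
        + 3 * ((k + l) * (1 + l))) := by
    simp only [expOddC]; linear_combination (2 * (2 * k) ^ 2 - 1) * hdet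
  have hbk : a * k = 2 * (m * l) + m + l + 1 := by linarith
  rw [h]
  refine twentyFour_dvd_of_three_of_eight ((three_dvd_iff _).mpr ?_) ?_
  · push_cast
    generalize (k : ZMod 3) = k'; generalize (l : ZMod 3) = l'; generalize (m : ZMod 3) = m'
    generalize (a : ZMod 3) = b'
    revert k' l' m' b'; decide
  · rw [show (8 : ℤ) = 4 * 2 from rfl]
    refine mul_dvd_mul_left 4 ((two_dvd_iff _).mpr ?_)
    have hbk' := congrArg (Int.cast : ℤ → ZMod 2) hbk
    push_cast at hbk' ⊢
    generalize (k : ZMod 2) = k' at *; generalize (l : ZMod 2) = l' at *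
    generalize (m : ZMod 2) = m' at *; generalize (a : ZMod 2) = b' at *
    revert k' l' m' b'; decide

/-- The value of the eta multiplier, in terms of Jacobi symbols. -/
def IsEtaMultiplier (a b c d : ℕ) (ε : ℂ) : Prop :=
  (Odd c → ε = jacobiSym d c * zeta24 ^ expOddC a b c d) ∧
    (Odd d → ε = jacobiSym c d * zeta24 ^ expOddD a b c d)

/-- The exponents differ by 3(c−1)(d−1), twelve times the exponent of −1 in quadratic reciprocity.
-/
lemma multiplier_odd_odd (a b : ℕ) {c d : ℕ} (hc : Odd c) (hd : Odd d) :
    (jacobiSym d c * zeta24 ^ expOddC a b c d : ℂ) = jacobiSym c d * zeta24 ^ expOddD a b c d := by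
  rw [jacobiSym.quadratic_reciprocity hd hc]
  push_cast
  rw [neg_one_pow_eq_zeta24, mul_comm (zeta24 ^ _), mul_assoc, ← zpow_add₀ zeta24_ne_zero]
  congr 1
  apply zeta24_zpow_congr
  obtain ⟨k, rfl⟩ := hc
  obtain ⟨l, rfl⟩ := hd
  rw [show (2 * k + 1) / 2 = k by lia, show (2 * l + 1) / 2 = l by lia]
  refine ⟨k * l, ?_⟩
  simp only [expOddC, expOddD]
  push_cast
  ring

lemma IsEtaMultiplier.mul_T {a b c d : ℕ} {ε : ℂ} (hdet : a * d = b * c + 1)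
    (h : IsEtaMultiplier a b c d ε) : IsEtaMultiplier a (a + b) c (c + d) (ε * zeta24) := by
  have hdet' : (a * d : ℤ) = b * c + 1 := by exact_mod_cast hdet
  have hC (hc : Odd c) : ε * zeta24
      = jacobiSym (c + d : ℕ) c * zeta24 ^ expOddC a (a + b : ℕ) c (c + d : ℕ) := by
    rw [h.1 hc, mul_assoc, ← zpow_add_one₀ zeta24_ne_zero]
    congr 1
    · rw [jacobiSym.mod_left' (show ((c + d : ℕ) : ℤ) % c = d % c by simp)]
    · push_cast
      exact (zeta24_zpow_congr (expOddC_mul_T hdet' (by exact_mod_cast hc))).symm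
  refine ⟨hC, fun hcd ↦ ?_⟩
  rcases Nat.even_or_odd c with hc | hc
  · have hd : Odd d := by
      rcases Nat.even_or_odd d with hd | hd
      · exact absurd hcd (Nat.not_odd_iff_even.mpr (hc.add hd))
      · exact hd
    rw [h.2 hd, add_comm c d, jacobiSym_add_right_even hd hc, neg_one_pow_eq_zeta24]
    obtain ⟨k, rfl⟩ := even_iff_two_dvd.mp hc
    obtain ⟨l, rfl⟩ := hd
    have key : zeta24 ^ (12 * (((2 * l + 1 + 2 * k) / 2 * (1 + (2 * l + 1) / 2) : ℕ) : ℤ))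
        * zeta24 ^ expOddD a (a + b : ℕ) (2 * k : ℕ) (2 * l + 1 + 2 * k : ℕ)
        = zeta24 ^ expOddD a b (2 * k : ℕ) (2 * l + 1 : ℕ) * zeta24 := by
      rw [← zpow_add₀ zeta24_ne_zero, ← zpow_add_one₀ zeta24_ne_zero]
      apply zeta24_zpow_congr
      rw [show (2 * l + 1 + 2 * k) / 2 = k + l by lia, show (2 * l + 1) / 2 = l by lia]
      push_cast at hdet' ⊢
      convert expOddD_mul_T hdet' using 1
      ring_nf
    linear_combination (-(jacobiSym (2 * k : ℕ) (2 * l + 1) : ℂ)) * key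
  · rw [hC hc, multiplier_odd_odd _ _ hc hcd]

lemma IsEtaMultiplier.mul_U {a b c d : ℕ} {ε : ℂ} (hdet : a * d = b * c + 1)
    (h : IsEtaMultiplier a b c d ε) :
    IsEtaMultiplier (a + b) b (c + d) d (ε * zeta24 ^ (-1 : ℤ)) := by
  have hdet' : (a * d : ℤ) = b * c + 1 := by exact_mod_cast hdet
  have hD (hd : Odd d) : ε * zeta24 ^ (-1 : ℤ)
      = jacobiSym (c + d : ℕ) d * zeta24 ^ expOddD (a + b : ℕ) b (c + d : ℕ) d := by
    rw [h.2 hd, mul_assoc, ← zpow_add₀ zeta24_ne_zero]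
    congr 1
    · rw [jacobiSym.mod_left' (show ((c + d : ℕ) : ℤ) % d = c % d by simp)]
    · push_cast
      exact (zeta24_zpow_congr (expOddD_mul_U hdet' (by exact_mod_cast hd))).symm
  refine ⟨fun hcd ↦ ?_, hD⟩
  rcases Nat.even_or_odd d with hd | hd
  · have hc : Odd c := by
      rcases Nat.even_or_odd c with hc | hc
      · exact absurd hcd (Nat.not_odd_iff_even.mpr (hc.add hd))
      · exact hc
    rw [h.1 hc, jacobiSym_add_right_even hc hd, neg_one_pow_eq_zeta24]
    obtain ⟨k, rfl⟩ := even_iff_two_dvd.mp hd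
    obtain ⟨l, rfl⟩ := hc
    have key : zeta24 ^ (12 * (((2 * l + 1 + 2 * k) / 2 * (1 + (2 * l + 1) / 2) : ℕ) : ℤ))
        * zeta24 ^ expOddC (a + b : ℕ) b (2 * l + 1 + 2 * k : ℕ) (2 * k : ℕ)
        = zeta24 ^ expOddC a b (2 * l + 1 : ℕ) (2 * k : ℕ) * zeta24 ^ (-1 : ℤ) := by
      rw [← zpow_add₀ zeta24_ne_zero, ← zpow_add₀ zeta24_ne_zero]
      apply zeta24_zpow_congr
      rw [show (2 * l + 1 + 2 * k) / 2 = k + l by lia, show (2 * l + 1) / 2 = l by lia]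
      push_cast at hdet' ⊢
      convert expOddC_mul_U hdet' using 1
      ring_nf
    linear_combination (-(jacobiSym (2 * k : ℕ) (2 * l + 1) : ℂ)) * key
  · rw [hD hd, multiplier_odd_odd _ _ hcd hd]

/-- If a > b and d > c, then ad ≥ (b+1)(c+1), which exceeds bc + 1 unless b = c = 0. If a ≤ b and c
> d, then ad ≤ bc. So one column dominates the other except for the identity. -/
lemma columns_comparable {a b c d : ℕ} (hdet : a * d = b * c + 1) :
    (a ≤ b ∧ c ≤ d) ∨ (b ≤ a ∧ d ≤ c) ∨ (a = 1 ∧ b = 0 ∧ c = 0 ∧ d = 1) := by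
  rcases le_or_gt a b with hab | hab
  · rcases le_or_gt c d with hcd | hcd
    · exact Or.inl ⟨hab, hcd⟩
    · have : a * d ≤ b * c := Nat.mul_le_mul hab hcd.le
      lia
  · rcases le_or_gt d c with hcd | hcd
    · exact Or.inr (Or.inl ⟨hab.le, hcd⟩)
    · have : (b + 1) * (c + 1) ≤ a * d := Nat.mul_le_mul hab hcd
      have h0 : b = 0 ∧ c = 0 := by constructor <;> nlinarith
      obtain ⟨rfl, rfl⟩ := h0
      have : a * d = 1 := by simpa using hdet
      exact Or.inr (Or.inr ⟨Nat.eq_one_of_mul_eq_one_right this, rfl, rfl,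
        Nat.eq_one_of_mul_eq_one_left this⟩)

/-- **The eta multiplier system** on matrices with nonnegative entries. -/
theorem exists_etaRel {a b c d : ℕ} (hdet : a * d = b * c + 1) :
    ∃ ε, EtaRel a b c d ε ∧ IsEtaMultiplier a b c d ε := by
  induction h : a + b + c + d using Nat.strong_induction_on generalizing a b c d with
  | _ n ih =>
    subst h
    have ha : 0 < a := Nat.pos_of_ne_zero (by rintro rfl; lia)
    have hd : 0 < d := Nat.pos_of_ne_zero (by rintro rfl; lia)
    -- Subtracting the smaller column from the larger is division by T or U on the right. The sum of
    -- the entries drops because a and d are positive.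
    rcases columns_comparable hdet with ⟨hab, hcd⟩ | ⟨hab, hcd⟩ | ⟨rfl, rfl, rfl, rfl⟩
    · obtain ⟨b, rfl⟩ := Nat.exists_eq_add_of_le hab
      obtain ⟨d, rfl⟩ := Nat.exists_eq_add_of_le hcd
      have hdet' : a * d = b * c + 1 := by nlinarith
      obtain ⟨ε, h1, h2⟩ := ih _ (by lia) hdet' rfl
      exact ⟨_, h1.mul_T, h2.mul_T hdet'⟩
    · obtain ⟨a, rfl⟩ := Nat.exists_eq_add_of_le' hab
      obtain ⟨c, rfl⟩ := Nat.exists_eq_add_of_le' hcd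
      have hdet' : a * d = b * c + 1 := by nlinarith
      obtain ⟨ε, h1, h2⟩ := ih (a + b + c + d) (by
        rcases Nat.eq_zero_or_pos b with rfl | hb <;> lia) hdet' rfl
      exact ⟨_, h1.mul_U hdet', h2.mul_U hdet'⟩
    · exact ⟨1, fun z _ ↦ by simp, by simp, fun _ ↦ by simp [expOddD]⟩

/-- The eta multiplier when `24` divides `a` and `d`, and `c` is odd. -/
lemma eta_smul_of_dvd {a b c d : ℕ} (hdet : a * d = b * c + 1) (ha : 24 ∣ a) (hd : 24 ∣ d)
    (hc : Odd c) {z : ℂ} (hz : 0 < z.im) :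
    eta ((a * z + b) / (c * z + d))
      = jacobiSym d c * zeta24 ^ (-3 * (c : ℤ)) * sqrt (c * z + d) * eta z := by
  obtain ⟨ε, h1, h2⟩ := exists_etaRel hdet
  rw [h1 z hz, h2.1 hc]
  congr 3
  apply zeta24_zpow_congr
  obtain ⟨a, rfl⟩ := ha
  obtain ⟨d, rfl⟩ := hd
  refine ⟨(a + d) * c - b * d * (c ^ 2 - 1), ?_⟩
  simp only [expOddC]
  push_cast
  ring
end
end HeckeEta

namespace HeckeEta
open Complex hiding eta
open ModularForm

noncomputable section

/-! ### Expansions in e(mz/24) and operators on them -/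

/-- The exponential `e(mz/24)`. -/
def qe (m : ℤ) (z : ℂ) : ℂ := cexp (2 * Real.pi * I * m * z / 24)

lemma qe_add (m : ℤ) (z w : ℂ) : qe m (z + w) = qe m z * qe m w := by
  rw [qe, qe, qe, ← Complex.exp_add]; congr 1; ring

lemma qe_add_left (m n : ℤ) (z : ℂ) : qe (m + n) z = qe m z * qe n z := by
  rw [qe, qe, qe, ← Complex.exp_add]; congr 1; push_cast; ring

lemma qe_mul_left (m n : ℤ) (z : ℂ) : qe (m * n) z = qe n (m * z) := by
  rw [qe, qe]; congr 1; push_cast; ring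

lemma qe_zero_left (z : ℂ) : qe 0 z = 1 := by simp [qe]

lemma norm_qe (m : ℤ) (z : ℂ) : ‖qe m z‖ = Real.exp (-(2 * Real.pi * m * z.im / 24)) := by
  rw [qe, Complex.norm_exp]
  congr 1
  have : (2 * Real.pi * I * m * z / 24 : ℂ) = ((2 * Real.pi * m / 24 : ℝ) : ℂ) * (I * z) := by
    push_cast; ring
  rw [this, Complex.re_ofReal_mul, Complex.I_mul_re]
  ring

/-- The factor 24 in the translation cancels the denominator 24 of the exponents, so a translate
acts on the m-th term by an additive character modulo N. -/
lemma qe_eq_stdAddChar {N : ℕ} [NeZero N] (m : ℤ) (b : ZMod N) :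
    qe m (24 * (b.val : ℂ) / N) = ZMod.stdAddChar ((m : ZMod N) * b) := by
  have : ((m : ZMod N) * b : ZMod N) = ((m * b.val : ℤ) : ZMod N) := by simp
  rw [this, ZMod.stdAddChar_coe, qe]
  congr 1
  push_cast
  ring

lemma im_add_natCast (z : ℂ) (n : ℕ) : (z + 24 * n).im = z.im := by simp

lemma im_natCast_mul_pos {N : ℕ} [NeZero N] {z : ℂ} (hz : 0 < z.im) : 0 < (N * z).im := by
  have hN : (0 : ℝ) < N := Nat.cast_pos.mpr (NeZero.pos N)
  rw [← Complex.ofReal_natCast, Complex.im_ofReal_mul]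
  positivity

lemma im_div_natCast_pos {N : ℕ} [NeZero N] {z : ℂ} (hz : 0 < z.im) : 0 < (z / N).im := by
  rw [Complex.div_natCast_im]
  exact div_pos hz (Nat.cast_pos.mpr (NeZero.pos N))

lemma im_shift_pos {N : ℕ} [NeZero N] {z : ℂ} (hz : 0 < z.im) (n : ℕ) :
    0 < ((z + 24 * n) / N).im :=
  im_div_natCast_pos (by rwa [im_add_natCast])

/-- `F` has the absolutely convergent expansion `F(z) = ∑ a(m) e(mz/24)` on the upper half-plane. -/
def HasExp (a : ℤ → ℂ) (F : ℂ → ℂ) : Prop :=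
  ∀ z : ℂ, 0 < z.im → HasSum (fun m : ℤ ↦ a m * qe m z) (F z)

namespace HasExp

variable {a b : ℤ → ℂ} {F G : ℂ → ℂ}

lemma add (hF : HasExp a F) (hG : HasExp b G) :
    HasExp (fun m ↦ a m + b m) (fun z ↦ F z + G z) := fun z hz ↦ by
  simpa only [add_mul] using (hF z hz).add (hG z hz)

lemma const_mul (c : ℂ) (hF : HasExp a F) : HasExp (fun m ↦ c * a m) (fun z ↦ c * F z) :=
  fun z hz ↦ by simpa only [mul_assoc] using (hF z hz).mul_left c

/-- Averaging over translates extracts the coefficients divisible by `N`. -/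
lemma sum_shift {N : ℕ} [NeZero N] (hF : HasExp a F) :
    HasExp (fun m ↦ N * a (N * m)) (fun z ↦ ∑ b : ZMod N, F ((z + 24 * b.val) / N)) := by
  intro z hz
  have h1 : HasSum (fun m : ℤ ↦ ∑ b : ZMod N, a m * qe m ((z + 24 * b.val) / N))
      (∑ b : ZMod N, F ((z + 24 * b.val) / N)) := by
    refine hasSum_sum fun b _ ↦ hF _ (im_shift_pos hz _)
  have h2 (m : ℤ) : ∑ b : ZMod N, a m * qe m ((z + 24 * b.val) / N)
      = if (m : ZMod N) = 0 then N * a m * qe m (z / N) else 0 := by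
    simp_rw [add_div, qe_add, qe_eq_stdAddChar, ← Finset.mul_sum, mul_comm (m : ZMod N),
      AddChar.sum_mulShift (m : ZMod N) (ZMod.isPrimitive_stdAddChar N), ZMod.card]
    split_ifs <;> push_cast <;> ring
  simp_rw [h2] at h1
  have hinj : Function.Injective (fun m : ℤ ↦ (N : ℤ) * m) :=
    mul_right_injective₀ (Int.natCast_ne_zero.mpr (NeZero.ne N))
  rw [← hinj.hasSum_iff] at h1
  · convert h1 using 2 with m
    have hNC : (N : ℂ) ≠ 0 := Nat.cast_ne_zero.mpr (NeZero.ne N)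
    simp [qe_mul_left, mul_div_cancel₀ _ hNC]
  · intro m hm
    rw [if_neg]
    intro h
    obtain ⟨k, rfl⟩ := (ZMod.intCast_zmod_eq_zero_iff_dvd m N).mp h
    exact hm ⟨k, rfl⟩

/-- Scaling the variable by `N`. -/
lemma comp_mul {N : ℕ} [NeZero N] (hF : HasExp a F) :
    HasExp (fun m ↦ if (N : ℤ) ∣ m then a (m / N) else 0) (fun z ↦ F (N * z)) := by
  intro z hz
  have hN0 : (N : ℤ) ≠ 0 := Int.natCast_ne_zero.mpr (NeZero.ne N)
  have hinj : Function.Injective (fun m : ℤ ↦ (N : ℤ) * m) := mul_right_injective₀ hN0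
  rw [← hinj.hasSum_iff]
  · convert hF (N * z) (im_natCast_mul_pos hz) using 2 with m
    simp [qe_mul_left, Int.mul_ediv_cancel_left _ hN0]
  · intro m hm
    refine (congrArg (· * _) (if_neg ?_)).trans (zero_mul _)
    rintro ⟨k, rfl⟩
    exact hm ⟨k, rfl⟩

end HasExp

/-! ### Quadratic Gauss sums and twists -/

/-- The quadratic character modulo `ℓ`, with complex values. -/
def quadChar (ℓ : ℕ) [Fact ℓ.Prime] : MulChar (ZMod ℓ) ℂ :=
  (quadraticChar (ZMod ℓ)).ringHomComp (Int.castRingHom ℂ)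

/-- The quadratic Gauss sum modulo `ℓ`. -/
def quadGauss (ℓ : ℕ) [Fact ℓ.Prime] : ℂ := gaussSum (quadChar ℓ) ZMod.stdAddChar

variable {ℓ : ℕ} [Fact ℓ.Prime]

lemma quadChar_intCast (m : ℤ) : quadChar ℓ m = legendreSym ℓ m := rfl

lemma quadChar_ne_one (hℓ : ℓ ≠ 2) : quadChar ℓ ≠ 1 := by
  intro h
  refine quadraticChar_ne_one (F := ZMod ℓ) (by rwa [ZMod.ringChar_zmod_n]) ?_
  ext a
  have h' := congrArg (fun χ : MulChar (ZMod ℓ) ℂ ↦ χ a) h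
  simpa [quadChar] using h'

lemma quadChar_isQuadratic : (quadChar ℓ).IsQuadratic :=
  (quadraticChar_isQuadratic (ZMod ℓ)).comp _

lemma sum_quadChar_mul_stdAddChar (hℓ : ℓ ≠ 2) (m : ZMod ℓ) :
    ∑ b : ZMod ℓ, quadChar ℓ b * ZMod.stdAddChar (m * b) = quadGauss ℓ * quadChar ℓ m := by
  by_cases hm : m = 0
  · subst hm
    simp [MulChar.sum_eq_zero_of_ne_one (quadChar_ne_one hℓ),
      MulChar.map_nonunit (quadChar ℓ) not_isUnit_zero]
  · have hu : IsUnit m := isUnit_iff_ne_zero.mpr hm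
    have h := gaussSum_mulShift (quadChar ℓ) ZMod.stdAddChar hu.unit
    rw [IsUnit.unit_spec] at h
    have hsq : quadChar ℓ m * quadChar ℓ m = 1 := by
      rw [← pow_two, ← MulChar.pow_apply' _ two_ne_zero, quadChar_isQuadratic.sq_eq_one,
        MulChar.one_apply hu]
    rw [quadGauss, ← h, mul_comm, ← mul_assoc, hsq, one_mul]
    rfl

lemma quadGauss_sq (hℓ : ℓ ≠ 2) : quadGauss ℓ ^ 2 = quadChar ℓ (-1) * ℓ := by
  have h := gaussSum_sq (quadChar_ne_one hℓ) quadChar_isQuadratic (ZMod.isPrimitive_stdAddChar ℓ)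
  rwa [ZMod.card] at h

/-- The Gauss sum expresses a twist of coefficients as a combination of translates, to which the
transformation law of η applies. -/
lemma HasExp.twist (hℓ : ℓ ≠ 2) {a : ℤ → ℂ} {F : ℂ → ℂ} (hF : HasExp a F) :
    HasExp (fun m ↦ quadGauss ℓ * (quadChar ℓ m * a m))
      (fun z ↦ ∑ b : ZMod ℓ, quadChar ℓ b * F (z + 24 * b.val / ℓ)) := by
  intro z hz
  have h1 : HasSum (fun m : ℤ ↦ ∑ b : ZMod ℓ, quadChar ℓ b * (a m * qe m (z + 24 * b.val / ℓ)))
      (∑ b : ZMod ℓ, quadChar ℓ b * F (z + 24 * b.val / ℓ)) := by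
    refine hasSum_sum fun b _ ↦ (hF _ ?_).mul_left _
    rw [Complex.add_im, Complex.div_natCast_im, ← Nat.cast_ofNat (n := 24), ← Nat.cast_mul,
      Complex.natCast_im, zero_div, add_zero]
    exact hz
  convert h1 using 2 with m
  simp_rw [qe_add, qe_eq_stdAddChar]
  rw [← mul_assoc, ← sum_quadChar_mul_stdAddChar hℓ, Finset.sum_mul, Finset.sum_mul]
  exact Finset.sum_congr rfl fun b _ ↦ by ring
end
end HeckeEta

namespace HeckeEta
open Complex hiding eta
open ModularForm

noncomputable section

lemma hasSum_of_eq {ι : Type*} {f g : ι → ℂ} {s : ℂ} (h : HasSum g s) (e : ∀ i, f i = g i) :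
    HasSum f s := (funext e : f = g) ▸ h

/-! ### Termwise differentiation -/

lemma differentiable_qe (m : ℤ) : Differentiable ℂ (qe m) := by
  unfold qe; fun_prop

lemma deriv_qe (m : ℤ) (z : ℂ) : deriv (qe m) z = 2 * Real.pi * I * m / 24 * qe m z := by
  have h : HasDerivAt (fun z : ℂ ↦ 2 * Real.pi * I * m * z / 24) (2 * Real.pi * I * m / 24) z := by
    simpa using ((hasDerivAt_id z).const_mul (2 * Real.pi * I * m : ℂ)).div_const 24
  have := h.cexp.deriv
  rw [mul_comm]
  exact this

/-- The norm depends only on the height and is monotone in it. The bottom edge of the strip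
dominates for m ≥ 0 and the top edge for m < 0; adding both avoids the case distinction. -/
lemma norm_qe_le_add {y₀ y₁ : ℝ} {w : ℂ} (h₀ : y₀ < w.im) (h₁ : w.im < y₁) (m : ℤ) :
    ‖qe m w‖ ≤ ‖qe m (y₀ * I)‖ + ‖qe m (y₁ * I)‖ := by
  rcases le_or_gt 0 m with hm | hm
  · refine le_add_of_le_of_nonneg ?_ (norm_nonneg _)
    rw [norm_qe, norm_qe, Real.exp_le_exp, neg_le_neg_iff]
    have : (0 : ℝ) ≤ m := Int.cast_nonneg hm
    simp only [Complex.mul_im, Complex.ofReal_re, Complex.I_im, mul_one, Complex.ofReal_im,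
      Complex.I_re, mul_zero, add_zero]
    gcongr
  · refine le_add_of_nonneg_of_le (norm_nonneg _) ?_
    rw [norm_qe, norm_qe, Real.exp_le_exp, neg_le_neg_iff]
    have hm' : (m : ℝ) ≤ 0 := Int.cast_nonpos.mpr hm.le
    simp only [Complex.mul_im, Complex.ofReal_re, Complex.I_im, mul_one, Complex.ofReal_im,
      Complex.I_re, mul_zero, add_zero]
    have h2 : 2 * Real.pi * m ≤ 0 := mul_nonpos_of_nonneg_of_nonpos (by positivity) hm'
    exact div_le_div_of_nonneg_right (mul_le_mul_of_nonpos_left h₁.le h2) (by norm_num)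

namespace HasExp

variable {a : ℤ → ℂ} {F : ℂ → ℂ}

lemma eventuallyEq_tsum (hF : HasExp a F) {z : ℂ} (hz : 0 < z.im) :
    F =ᶠ[nhds z] fun w ↦ ∑' m, a m * qe m w := by
  filter_upwards [(isOpen_lt continuous_const Complex.continuous_im).mem_nhds hz] with w hw
  exact (hF w hw).tsum_eq.symm

/-- A summable majorant near z, obtained from absolute convergence at half and at twice the height.
It feeds the Weierstrass theorems on holomorphy and termwise derivatives. -/
lemma strip_bound (hF : HasExp a F) {z : ℂ} (hz : 0 < z.im) :
    ∃ U : Set ℂ, ∃ u : ℤ → ℝ, IsOpen U ∧ z ∈ U ∧ Summable u ∧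
      ∀ m, ∀ w ∈ U, ‖a m * qe m w‖ ≤ u m := by
  refine ⟨{w | z.im / 2 < w.im ∧ w.im < 2 * z.im},
    fun m ↦ ‖a m * qe m ((z.im / 2 : ℝ) * I)‖ + ‖a m * qe m ((2 * z.im : ℝ) * I)‖,
    (isOpen_lt continuous_const Complex.continuous_im).inter
      (isOpen_lt Complex.continuous_im continuous_const), ⟨by linarith, by linarith⟩, ?_, ?_⟩
  · have h (y : ℝ) (hy : 0 < y) : 0 < (y * I : ℂ).im := by simpa using hy
    exact (hF _ (h _ (by positivity))).summable.norm.add (hF _ (h _ (by positivity))).summable.norm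
  · intro m w hw
    beta_reduce
    rw [norm_mul, norm_mul, norm_mul, ← mul_add]
    exact mul_le_mul_of_nonneg_left (norm_qe_le_add hw.1 hw.2 m) (norm_nonneg _)

lemma differentiableAt (hF : HasExp a F) {z : ℂ} (hz : 0 < z.im) : DifferentiableAt ℂ F z := by
  obtain ⟨U, u, hU, hzU, hu, hle⟩ := hF.strip_bound hz
  refine (hF.eventuallyEq_tsum hz).differentiableAt_iff.mpr ?_
  exact (differentiableOn_tsum_of_summable_norm hu
    (fun m ↦ ((differentiable_qe m).const_mul _).differentiableOn) hU hle).differentiableAt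
    (hU.mem_nhds hzU)

/-- Termwise differentiation. -/
lemma deriv (hF : HasExp a F) :
    HasExp (fun m ↦ m / 24 * a m) (fun z ↦ (2 * Real.pi * I)⁻¹ * deriv F z) := by
  intro z hz
  obtain ⟨U, u, hU, hzU, hu, hle⟩ := hF.strip_bound hz
  have h := (hasSum_deriv_of_summable_norm hu
    (fun m ↦ ((differentiable_qe m).const_mul _).differentiableOn) hU hle hzU).mul_left
    (2 * Real.pi * I)⁻¹
  beta_reduce
  rw [(hF.eventuallyEq_tsum hz).deriv_eq]
  refine hasSum_of_eq h fun m ↦ ?_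
  rw [deriv_const_mul _ (differentiable_qe m _), deriv_qe]
  field_simp [Complex.two_pi_I_ne_zero]

end HasExp

/-! ### The pentagonal number theorem for `η` -/

/-- Apply 1 + t ≤ eᵗ and sum a geometric series. The bound is uniform in k and n, which controls the
remainders in Euler's recursion. -/
lemma prod_one_sub_norm_le {x : ℂ} (hx : ‖x‖ < 1) (k n : ℕ) :
    ‖∏ i ∈ Finset.range n, (1 - x ^ (k + i + 1))‖ ≤ Real.exp (1 - ‖x‖)⁻¹ := by
  calc ‖∏ i ∈ Finset.range n, (1 - x ^ (k + i + 1))‖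
      = ∏ i ∈ Finset.range n, ‖1 - x ^ (k + i + 1)‖ := norm_prod _ _
    _ ≤ ∏ i ∈ Finset.range n, Real.exp (‖x‖ ^ i) := by
        refine Finset.prod_le_prod (fun _ _ ↦ norm_nonneg _) fun i _ ↦ ?_
        calc ‖1 - x ^ (k + i + 1)‖ ≤ ‖(1 : ℂ)‖ + ‖x ^ (k + i + 1)‖ := norm_sub_le _ _
          _ ≤ ‖x‖ ^ i + 1 := by
            rw [norm_one, norm_pow, add_comm]
            gcongr 1
            exact pow_le_pow_of_le_one (norm_nonneg _) hx.le (by lia)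
          _ ≤ _ := Real.add_one_le_exp _
    _ = Real.exp (∑ i ∈ Finset.range n, ‖x‖ ^ i) := (Real.exp_sum _ _).symm
    _ ≤ _ := by
        rw [Real.exp_le_exp, ← tsum_geometric_of_lt_one (norm_nonneg _) hx]
        exact (summable_geometric_of_lt_one (norm_nonneg _) hx).sum_le_tsum _
          (fun _ _ ↦ by positivity)

lemma norm_pentagonal_aux_le {x : ℂ} (hx : ‖x‖ < 1) (k n : ℕ) :
    ‖x ^ ((k + 1) * n) * ∏ i ∈ Finset.range (n + 1), (1 - x ^ (k + i + 1))‖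
      ≤ ‖x‖ ^ n * Real.exp (1 - ‖x‖)⁻¹ := by
  rw [norm_mul, norm_pow]
  refine mul_le_mul ?_ (prod_one_sub_norm_le hx k _) (norm_nonneg _) (by positivity)
  exact pow_le_pow_of_le_one (norm_nonneg _) hx.le (by nlinarith)

lemma natAbs_le_pentagonal (k : ℤ) : k.natAbs ≤ pentagonal k := by
  zify
  have h := two_mul_natCast_pentagonal k
  rcases abs_cases k with ⟨h1, h2⟩ | ⟨h1, h2⟩ <;> rw [h1] <;> nlinarith

lemma summable_pentagonal {x : ℂ} (hx : ‖x‖ < 1) :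
    Summable fun k : ℤ ↦ (Int.negOnePow k : ℂ) * x ^ pentagonal k := by
  have h : Summable fun k : ℤ ↦ ‖x‖ ^ k.natAbs := by
    refine Summable.of_nat_of_neg ?_ ?_ <;>
      simpa using summable_geometric_of_lt_one (norm_nonneg _) hx
  refine h.of_norm_bounded fun k ↦ ?_
  rw [norm_mul, norm_pow]
  have : ‖((Int.negOnePow k : ℤ) : ℂ)‖ = 1 := by
    rcases Int.even_or_odd k with hk | hk
    · simp [Int.negOnePow_even k hk]
    · simp [Int.negOnePow_odd k hk]
  rw [this, one_mul]
  exact pow_le_pow_of_le_one (norm_nonneg _) hx.le (natAbs_le_pentagonal k)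

/-- Euler's pentagonal number theorem on the unit disc. -/
lemma hasSum_pentagonal {x : ℂ} (hx : ‖x‖ < 1) :
    HasSum (fun k : ℤ ↦ (Int.negOnePow k : ℂ) * x ^ pentagonal k) (∏' n : ℕ, (1 - x ^ (n + 1))) := by
  have hS := (summable_pentagonal hx).hasSum
  have h1 := hS
  -- The series over ℤ, reflected by k ↦ −k, is folded onto ℕ by pairing k with −k − 1, which is the
  -- form of the sum in `Pentagonal.tprod_one_sub_pow`.
  rw [← neg_injective.hasSum_iff (fun x hx ↦ by absurd hx; use -x; simp)] at h1
  have h2 : HasSum (fun k : ℕ ↦ (-1 : ℂ) ^ k * (x ^ pentagonal (-k) - x ^ pentagonal (k + 1)))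
      (∑' k : ℤ, (Int.negOnePow k : ℂ) * x ^ pentagonal k) := by
    convert h1.nat_add_neg_add_one using 2 with k
    simp_rw [Function.comp_apply, neg_neg, Int.negOnePow_add]
    simp
    ring
  have hbd (k : ℕ) : ‖∑' n : ℕ, x ^ ((k + 1) * n) * ∏ i ∈ Finset.range (n + 1),
      (1 - x ^ (k + i + 1))‖ ≤ (1 - ‖x‖)⁻¹ * Real.exp (1 - ‖x‖)⁻¹ :=
    tsum_of_norm_bounded ((hasSum_geometric_of_lt_one (norm_nonneg _) hx).mul_right _)
      (norm_pentagonal_aux_le hx k)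
  rw [Pentagonal.tprod_one_sub_pow (x := x), h2.tsum_eq]
  · exact hS
  · exact tendsto_pow_atTop_nhds_zero_of_norm_lt_one hx
  · exact fun k ↦ Summable.of_norm_bounded
      ((summable_geometric_of_lt_one (norm_nonneg _) hx).mul_right _) (norm_pentagonal_aux_le hx k)
  · intro k
    simp_rw [sub_eq_add_neg]
    refine multipliable_one_add_of_summable ?_
    simp_rw [norm_neg, norm_pow]
    exact (summable_nat_add_iff (k + 1)).mpr (summable_geometric_of_lt_one (norm_nonneg _) hx)
  · exact h2.summable
  · refine squeeze_zero_norm (a := fun k ↦ ‖x‖ ^ k * ((1 - ‖x‖)⁻¹ * Real.exp (1 - ‖x‖)⁻¹)) ?_ ?_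
    · intro k
      rw [norm_mul, norm_mul, norm_pow, norm_pow, norm_neg, norm_one, one_pow, one_mul]
      refine mul_le_mul ?_ (hbd k) (norm_nonneg _) (by positivity)
      refine pow_le_pow_of_le_one (norm_nonneg _) hx.le ?_
      rw [Nat.le_div_iff_mul_le two_pos]
      nlinarith
    · simpa using (tendsto_pow_atTop_nhds_zero_of_lt_one (norm_nonneg _) hx).mul_const _

lemma norm_exp_lt_one {z : ℂ} (hz : 0 < z.im) : ‖cexp (2 * Real.pi * I * z)‖ < 1 :=
  UpperHalfPlane.norm_exp_two_pi_I_lt_one ⟨z, hz⟩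

lemma qe_natCast_mul (n : ℕ) (z : ℂ) : qe (24 * n) z = cexp (2 * Real.pi * I * z) ^ n := by
  rw [qe, ← Complex.exp_nat_mul]; congr 1; push_cast; ring

lemma eta_eq_qe_mul (z : ℂ) :
    eta z = qe 1 z * ∏' n : ℕ, (1 - cexp (2 * Real.pi * I * z) ^ (n + 1)) := by
  simp_rw [eta, eta_q_eq_pow, qe, Function.Periodic.qParam]
  push_cast
  simp

/-- `η(z) = ∑ (-1)ᵏ e((6k-1)² z / 24)`. -/
lemma hasSum_eta {z : ℂ} (hz : 0 < z.im) :
    HasSum (fun k : ℤ ↦ (Int.negOnePow k : ℂ) * qe ((6 * k - 1) ^ 2) z) (eta z) := by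
  rw [eta_eq_qe_mul]
  refine hasSum_of_eq ((hasSum_pentagonal (norm_exp_lt_one hz)).mul_left (qe 1 z)) fun k ↦ ?_
  rw [← qe_natCast_mul, mul_left_comm, ← qe_add_left]
  congr 2
  -- This is 1 + 24 · k(3k−1)/2 = (6k−1)².
  linear_combination (-12) * two_mul_natCast_pentagonal k
end
end HeckeEta

namespace HeckeEta
open Complex hiding eta
open ModularForm

noncomputable section

/-! ### `η` as an eigenfunction -/

/-- Choosing the sign so that ±ℓ ≡ 1 mod 6 makes multiplication by it preserve the numbers 6k − 1
indexing the series of η. The parity of t then records χ₁₂. -/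
lemma exists_six_mul_add_one {ℓ : ℕ} (h2 : ¬ 2 ∣ ℓ) (h3 : ¬ 3 ∣ ℓ) :
    ∃ t : ℤ, ((ℓ : ℤ) = 6 * t + 1 ∨ (ℓ : ℤ) = -(6 * t + 1)) ∧
      HeckePartition.chi12 ℓ = Int.negOnePow t := by
  have h : ℓ % 12 = 1 ∨ ℓ % 12 = 5 ∨ ℓ % 12 = 7 ∨ ℓ % 12 = 11 := by lia
  rcases h with h | h | h | h
  · refine ⟨2 * (ℓ / 12), by lia, ?_⟩
    rw [Int.negOnePow_even _ ⟨ℓ / 12, by ring⟩]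
    simp [HeckePartition.chi12, h]
  · refine ⟨2 * (-(ℓ / 12) - 1) + 1, by lia, ?_⟩
    rw [Int.negOnePow_odd _ ⟨_, rfl⟩]
    simp [HeckePartition.chi12, h]
  · refine ⟨2 * (ℓ / 12) + 1, by lia, ?_⟩
    rw [Int.negOnePow_odd _ ⟨_, rfl⟩]
    simp [HeckePartition.chi12, h]
  · refine ⟨2 * (-(ℓ / 12) - 1), by lia, ?_⟩
    rw [Int.negOnePow_even _ ⟨-(ℓ / 12) - 1, by ring⟩]
    simp [HeckePartition.chi12, h]

lemma qe_sq_mul (a b : ℤ) (z : ℂ) : qe ((a * b) ^ 2) z = qe (b ^ 2) ((a : ℂ) ^ 2 * z) := by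
  rw [mul_pow, qe_mul_left]; push_cast; rfl

/-- The part of the series for `η` supported on multiples of `ℓ`. -/
lemma hasSum_eta_of_dvd {ℓ : ℕ} (h2 : ¬ 2 ∣ ℓ) (h3 : ¬ 3 ∣ ℓ) {z : ℂ} (hz : 0 < z.im) :
    HasSum (fun k : ℤ ↦ if (ℓ : ℤ) ∣ 6 * k - 1
        then (Int.negOnePow k : ℂ) * qe ((6 * k - 1) ^ 2) z else 0)
      (HeckePartition.chi12 ℓ * eta ((ℓ : ℂ) ^ 2 * z)) := by
  obtain ⟨t, ht, hχ⟩ := exists_six_mul_add_one h2 h3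
  have hℓ0 : ℓ ≠ 0 := by rintro rfl; simp at h2
  have : NeZero ℓ := ⟨hℓ0⟩
  have he0 : 6 * t + 1 ≠ 0 := by lia
  have hsq : ((6 * t + 1 : ℤ) : ℂ) ^ 2 = (ℓ : ℂ) ^ 2 := by
    have : (6 * t + 1 : ℤ) ^ 2 = (ℓ : ℤ) ^ 2 := by rw [sq_eq_sq_iff_eq_or_eq_neg]; lia
    exact_mod_cast this
  have hdvd (x : ℤ) : (ℓ : ℤ) ∣ x ↔ 6 * t + 1 ∣ x := by
    rcases ht with h | h <;> rw [h]
    rw [neg_dvd]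
  have hinj : Function.Injective (fun j : ℤ ↦ (6 * t + 1) * j - t) := fun i j h ↦
    mul_left_cancel₀ he0 (sub_left_injective h)
  rw [← hinj.hasSum_iff]
  · have hz' : 0 < ((ℓ : ℂ) ^ 2 * z).im := by
      rw [pow_two, mul_assoc]; exact im_natCast_mul_pos (im_natCast_mul_pos hz)
    refine hasSum_of_eq ((hasSum_eta hz').mul_left (HeckePartition.chi12 ℓ : ℂ)) fun j ↦ ?_
    have h6 : 6 * ((6 * t + 1) * j - t) - 1 = (6 * t + 1) * (6 * j - 1) := by ring
    rw [Function.comp_apply, h6, if_pos ((hdvd _).mpr (dvd_mul_right _ _)), qe_sq_mul, hsq, hχ,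
      ← mul_assoc]
    congr 1
    rw [show (6 * t + 1) * j - t = (j - t) + 2 * (3 * t * j) by ring, Int.negOnePow_add,
      Int.negOnePow_even (2 * (3 * t * j)) ⟨3 * t * j, by ring⟩, Int.negOnePow_sub]
    push_cast
    ring
  · intro k hk
    rw [if_neg]
    rw [hdvd]
    rintro ⟨x, hx⟩
    -- From 6k − 1 = (6t+1)x, the preimage of k under j ↦ (6t+1)j − t is j = k − tx.
    exact hk ⟨k - t * x, by linear_combination t * hx⟩

lemma chi12_mul_self {ℓ : ℕ} (h2 : ¬ 2 ∣ ℓ) (h3 : ¬ 3 ∣ ℓ) :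
    (HeckePartition.chi12 ℓ : ℂ) * HeckePartition.chi12 ℓ = 1 := by
  obtain ⟨t, -, hχ⟩ := exists_six_mul_add_one h2 h3
  rw [hχ, ← Int.cast_mul, ← Units.val_mul, ← Int.negOnePow_add, Int.negOnePow_even _ ⟨t, rfl⟩]
  simp

variable {ℓ : ℕ} [Fact ℓ.Prime]

/-- All exponents of η are squares, so the twist acts as 1 on those prime to ℓ and removes the
others. -/
lemma sum_quadChar_mul_eta (h2 : ¬ 2 ∣ ℓ) (h3 : ¬ 3 ∣ ℓ) {z : ℂ} (hz : 0 < z.im) :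
    ∑ b : ZMod ℓ, quadChar ℓ b * eta (z + 24 * b.val / ℓ)
      = quadGauss ℓ * (eta z - HeckePartition.chi12 ℓ * eta ((ℓ : ℂ) ^ 2 * z)) := by
  have hℓ : ℓ ≠ 2 := by rintro rfl; simp at h2
  have h1 : HasSum (fun k : ℤ ↦ ∑ b : ZMod ℓ, quadChar ℓ b *
      ((Int.negOnePow k : ℂ) * qe ((6 * k - 1) ^ 2) (z + 24 * b.val / ℓ)))
      (∑ b : ZMod ℓ, quadChar ℓ b * eta (z + 24 * b.val / ℓ)) := by
    refine hasSum_sum fun b _ ↦ (hasSum_eta ?_).mul_left _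
    rw [Complex.add_im, Complex.div_natCast_im, ← Nat.cast_ofNat (n := 24), ← Nat.cast_mul,
      Complex.natCast_im, zero_div, add_zero]
    exact hz
  refine h1.unique (hasSum_of_eq
    (((hasSum_eta hz).sub (hasSum_eta_of_dvd h2 h3 hz)).mul_left (quadGauss ℓ)) fun k ↦ ?_)
  have h := sum_quadChar_mul_stdAddChar hℓ (((6 * k - 1) ^ 2 : ℤ) : ZMod ℓ)
  simp_rw [qe_add, qe_eq_stdAddChar]
  calc _ = (Int.negOnePow k : ℂ) * qe ((6 * k - 1) ^ 2) z * ∑ b : ZMod ℓ,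
        quadChar ℓ b * ZMod.stdAddChar ((((6 * k - 1) ^ 2 : ℤ) : ZMod ℓ) * b) := by
        rw [Finset.mul_sum]; exact Finset.sum_congr rfl fun b _ ↦ by ring
    _ = _ := by
        rw [h, Int.cast_pow, map_pow]
        split_ifs with hd
        · rw [(ZMod.intCast_zmod_eq_zero_iff_dvd _ ℓ).mpr hd,
            MulChar.map_nonunit _ not_isUnit_zero]
          ring
        · have hu : IsUnit ((6 * k - 1 : ℤ) : ZMod ℓ) :=
            isUnit_iff_ne_zero.mpr (by rwa [Ne, ZMod.intCast_zmod_eq_zero_iff_dvd])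
          rw [← MulChar.pow_apply' _ two_ne_zero, quadChar_isQuadratic.sq_eq_one,
            MulChar.one_apply hu]
          ring

/-- The average keeps the exponents (6k−1)² divisible by ℓ. As ℓ is prime these are the ones with ℓ
∣ 6k − 1, already summed in `hasSum_eta_of_dvd`. -/
lemma sum_eta_shift (h2 : ¬ 2 ∣ ℓ) (h3 : ¬ 3 ∣ ℓ) {z : ℂ} (hz : 0 < z.im) :
    ∑ b : ZMod ℓ, eta ((z + 24 * b.val) / ℓ) = ℓ * HeckePartition.chi12 ℓ * eta (ℓ * z) := by
  have hp : Prime (ℓ : ℤ) := Nat.prime_iff_prime_int.mp Fact.out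
  have h1 : HasSum (fun k : ℤ ↦ ∑ b : ZMod ℓ,
      ((Int.negOnePow k : ℂ) * qe ((6 * k - 1) ^ 2) ((z + 24 * b.val) / ℓ)))
      (∑ b : ZMod ℓ, eta ((z + 24 * b.val) / ℓ)) :=
    hasSum_sum fun b _ ↦ hasSum_eta (im_shift_pos hz _)
  refine h1.unique (hasSum_of_eq (f := _) (g := fun k : ℤ ↦ (ℓ : ℂ) * if (ℓ : ℤ) ∣ 6 * k - 1
        then (Int.negOnePow k : ℂ) * qe ((6 * k - 1) ^ 2) (z / ℓ) else 0) ?_ fun k ↦ ?_)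
  · have h := (hasSum_eta_of_dvd h2 h3 (im_div_natCast_pos (N := ℓ) hz)).mul_left (ℓ : ℂ)
    rwa [← mul_assoc, show (ℓ : ℂ) ^ 2 * (z / ℓ) = ℓ * z by
      have : (ℓ : ℂ) ≠ 0 := Nat.cast_ne_zero.mpr (NeZero.ne ℓ)
      field_simp] at h
  · simp_rw [add_div, qe_add, qe_eq_stdAddChar, ← Finset.mul_sum, mul_comm (_ : ZMod ℓ),
      AddChar.sum_mulShift _ (ZMod.isPrimitive_stdAddChar ℓ), ZMod.card,
      ZMod.intCast_zmod_eq_zero_iff_dvd, hp.dvd_pow_iff_dvd two_ne_zero]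
    split_ifs <;> push_cast <;> ring
end
end HeckeEta

namespace HeckeEta
open Complex hiding eta
open ModularForm

noncomputable section

/-! ### The inversion `z ↦ -1/z` and the translates of `η` -/

lemma im_neg_one_div_pos {z : ℂ} (hz : 0 < z.im) : 0 < (-1 / z).im := by
  have hz0 : z ≠ 0 := by rintro rfl; simp at hz
  rw [neg_div, one_div, Complex.neg_im, Complex.inv_im, neg_div, neg_neg]
  exact div_pos hz (Complex.normSq_pos.mpr hz0)

lemma eta_add_intCast (z : ℂ) (n : ℤ) : eta (z + 24 * n) = eta z := by
  have h (n : ℕ) (z : ℂ) : eta (z + n) = zeta24 ^ n * eta z := by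
    induction n with
    | zero => simp
    | succ n ih => rw [Nat.cast_succ, ← add_assoc, eta_add_one, ih, pow_succ']; ring
  have h24 : Function.Periodic eta (24 : ℂ) := fun z ↦ by
    have := h 24 z
    rw [← zpow_natCast, show ((24 : ℕ) : ℤ) = 24 * 1 by norm_num, zeta24_zpow_twentyFour_mul,
      one_mul] at this
    exact_mod_cast this
  rw [mul_comm]
  exact h24.int_mul n z

/-- The matrix with rows (24B, x) and (N, 24D), where D ≡ −B' mod N, carries (z − 24D)/N to (−1/z +
24B)/N, and its automorphy factor there is exactly z. Its diagonal is divisible by 24, so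
`eta_smul_of_dvd` applies. -/
lemma eta_shift_neg_one_div {N : ℕ} [NeZero N] (hN : Odd N) (hN1 : 1 < N) {B B' : ZMod N}
    (hB : 576 * B * B' = -1) {z : ℂ} (hz : 0 < z.im) :
    eta ((-1 / z + 24 * B.val) / N) = jacobiSym (24 * (-B').val : ℕ) N *
      zeta24 ^ (-3 * (N : ℤ)) * sqrt z * eta ((z + 24 * B'.val) / N) := by
  have hN0 : (N : ℂ) ≠ 0 := Nat.cast_ne_zero.mpr (NeZero.ne N)
  have hz0 : z ≠ 0 := by rintro rfl; simp at hz
  -- A nonnegative representative is taken because the multiplier formula covers nonnegative entries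
  -- only; the passage back to B' is a translation by a multiple of 24.
  set D := (-B').val with hD
  have hcast : ((24 * B.val * (24 * D) : ℕ) : ZMod N) = (1 : ℕ) := by
    push_cast
    rw [hD, ZMod.natCast_zmod_val, ZMod.natCast_zmod_val]
    linear_combination -hB
  have hmod := (ZMod.natCast_eq_natCast_iff _ _ _).mp hcast
  obtain ⟨x, hx⟩ : ∃ x, 24 * B.val * (24 * D) = x * N + 1 := by
    rcases Nat.eq_zero_or_pos (24 * B.val * (24 * D)) with h0 | hpos
    · rw [h0] at hmod
      exact absurd (Nat.dvd_one.mp ((Nat.modEq_zero_iff_dvd).mp hmod.symm)) hN1.ne'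
    · obtain ⟨x, hx⟩ := (Nat.modEq_iff_dvd' hpos).mp hmod.symm
      exact ⟨x, by rw [mul_comm x]; omega⟩
  obtain ⟨k, hk⟩ : ∃ k : ℤ, (B'.val : ℤ) + D = N * k := by
    have : ((B'.val + D : ℤ) : ZMod N) = 0 := by
      push_cast
      rw [hD, ZMod.natCast_zmod_val, ZMod.natCast_zmod_val, add_neg_cancel]
    exact (ZMod.intCast_zmod_eq_zero_iff_dvd _ N).mp this
  have hk' : (B'.val : ℂ) + D = N * k := by exact_mod_cast hk
  have hw : 0 < ((z - 24 * D) / N).im := im_div_natCast_pos (by simpa using hz)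
  have h := eta_smul_of_dvd (a := 24 * B.val) (b := x) (c := N) (d := 24 * D) hx
    (dvd_mul_right _ _) (dvd_mul_right _ _) hN hw
  have e1 : (N : ℂ) * ((z - 24 * D) / N) + (24 * D : ℕ) = z := by
    push_cast; field_simp; ring
  have hx' : (24 * B.val * (24 * D) : ℂ) = x * N + 1 := by exact_mod_cast hx
  have e2 : (((24 * B.val : ℕ) : ℂ) * ((z - 24 * D) / N) + x) / z
      = (-1 / z + 24 * B.val) / N := by
    push_cast; field_simp; linear_combination -hx'
  have e3 : (z + 24 * B'.val) / N = (z - 24 * D) / N + 24 * k := by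
    field_simp; linear_combination 24 * hk'
  rw [e1, e2] at h
  rw [h, e3, eta_add_intCast]

/-! ### Translates by units and by multiples of ℓ -/

/-- The reciprocal of `η`. -/
def etaInv (z : ℂ) : ℂ := (eta z)⁻¹

/-- A bijection of the units modulo `N` pairing `B` with the solution of `576 B B' = -1`. -/
def invPair {N : ℕ} (h : IsUnit (576 : ZMod N)) : (ZMod N)ˣ ≃ (ZMod N)ˣ :=
  (Equiv.inv _).trans (Equiv.mulLeft (-h.unit⁻¹))

lemma mul_invPair {N : ℕ} (h : IsUnit (576 : ZMod N)) (B : (ZMod N)ˣ) :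
    576 * (B : ZMod N) * (invPair h B : ZMod N) = -1 := by
  have : h.unit * B * invPair h B = -1 := by
    simp [invPair, mul_comm, mul_assoc]
  simpa using congrArg Units.val this

lemma sum_eq_units_add {R M : Type*} [CommRing R] [Fintype R] [DecidableEq R]
    [AddCommMonoid M] (g : R → M) [DecidablePred (IsUnit : R → Prop)] :
    ∑ b, g b = ∑ u : Rˣ, g u + ∑ b with ¬ IsUnit b, g b := by
  rw [← Finset.sum_filter_add_sum_filter_not Finset.univ IsUnit]
  congr 1
  have := Finset.sum_map Finset.univ ⟨Units.val, Units.val_injective⟩ g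
  simp only [Function.Embedding.coeFn_mk] at this
  rw [← this]
  refine Finset.sum_congr ?_ fun _ _ ↦ rfl
  ext b
  simp only [Finset.mem_filter, Finset.mem_univ, true_and, Finset.mem_map,
    Function.Embedding.coeFn_mk]
  rfl

lemma ZMod_sum_eq_units_add {ℓ : ℕ} [Fact ℓ.Prime] {M : Type*} [AddCommMonoid M]
    (g : ZMod ℓ → M) : ∑ b, g b = ∑ u : (ZMod ℓ)ˣ, g u + g 0 := by
  classical
  rw [sum_eq_units_add, show Finset.univ.filter (fun b : ZMod ℓ ↦ ¬ IsUnit b) = {0} by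
    ext b; simp [isUnit_iff_ne_zero], Finset.sum_singleton]

/-- The inversion treats the two classes differently: unit translates are permuted, while numerators
divisible by ℓ reduce to denominator ℓ and meet the twist. -/
lemma ZMod_sum_sq_eq_units_add {ℓ : ℕ} [Fact ℓ.Prime] {M : Type*} [AddCommMonoid M] (g : ℕ → M) :
    ∑ B : ZMod (ℓ ^ 2), g B.val
      = ∑ B : (ZMod (ℓ ^ 2))ˣ, g (B : ZMod (ℓ ^ 2)).val + ∑ b : ZMod ℓ, g (ℓ * b.val) := by
  classical
  have hp : ℓ.Prime := Fact.out
  have hval (b : ZMod ℓ) : ((ℓ * b.val : ℕ) : ZMod (ℓ ^ 2)).val = ℓ * b.val :=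
    ZMod.val_cast_of_lt (by rw [pow_two]; exact Nat.mul_lt_mul_of_pos_left b.val_lt hp.pos)
  have hinj : Function.Injective (fun b : ZMod ℓ ↦ ((ℓ * b.val : ℕ) : ZMod (ℓ ^ 2))) := by
    intro b b' h
    have := congrArg ZMod.val h
    simp only [hval] at this
    exact ZMod.val_injective ℓ (Nat.eq_of_mul_eq_mul_left hp.pos this)
  rw [sum_eq_units_add]
  congr 1
  have : ∑ b : ZMod ℓ, g (ℓ * b.val)
      = ∑ B ∈ Finset.univ.map ⟨_, hinj⟩, g B.val := by
    rw [Finset.sum_map]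
    exact Finset.sum_congr rfl fun b _ ↦ by rw [Function.Embedding.coeFn_mk, hval]
  rw [this]
  refine Finset.sum_congr ?_ fun _ _ ↦ rfl
  ext B
  have hu : IsUnit B ↔ ¬ ℓ ∣ B.val := by
    rw [← ZMod.natCast_zmod_val B, ZMod.isUnit_iff_coprime, Nat.coprime_pow_right_iff two_pos,
      Nat.coprime_comm, hp.coprime_iff_not_dvd, ZMod.natCast_zmod_val]
  simp only [Finset.mem_filter, Finset.mem_univ, true_and, hu, not_not, Finset.mem_map,
    Function.Embedding.coeFn_mk]
  constructor
  · rintro ⟨k, hk⟩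
    have hkl : k < ℓ := by
      have := B.val_lt
      rw [hk, pow_two] at this
      exact Nat.lt_of_mul_lt_mul_left this
    refine ⟨(k : ZMod ℓ), ?_⟩
    rw [ZMod.val_cast_of_lt hkl, ← hk, ZMod.natCast_zmod_val]
  · rintro ⟨b, rfl⟩
    rw [hval]
    exact dvd_mul_right _ _

variable {ℓ : ℕ} [Fact ℓ.Prime]

lemma isUnit_576 {n : ℕ} (h2 : ¬ 2 ∣ ℓ) (h3 : ¬ 3 ∣ ℓ) : IsUnit (576 : ZMod (ℓ ^ n)) := by
  have hp : ℓ.Prime := Fact.out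
  have h : Nat.Coprime (2 ^ 6 * 3 ^ 2) (ℓ ^ n) := by
    refine Nat.Coprime.pow_right _ (Nat.Coprime.mul_left (Nat.Coprime.pow_left _ ?_)
      (Nat.Coprime.pow_left _ ?_))
    · exact (Nat.Prime.coprime_iff_not_dvd Nat.prime_two).mpr h2
    · exact (Nat.Prime.coprime_iff_not_dvd Nat.prime_three).mpr h3
  have := (ZMod.isUnit_iff_coprime _ _).mpr h
  norm_num at this
  exact this

lemma isUnit_576' (h2 : ¬ 2 ∣ ℓ) (h3 : ¬ 3 ∣ ℓ) : IsUnit (576 : ZMod ℓ) := by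
  have := isUnit_576 (n := 1) h2 h3
  rwa [pow_one] at this

/-- The modulus is a square, so the Jacobi symbol is 1, and ℓ² ≡ 1 mod 8 makes the root of unity
independent of ℓ. The factor is thus the one of η itself. -/
lemma eta_unit_shift (h2 : ¬ 2 ∣ ℓ) (h3 : ¬ 3 ∣ ℓ) (B : (ZMod (ℓ ^ 2))ˣ) {z : ℂ}
    (hz : 0 < z.im) :
    eta ((-1 / z + 24 * (B : ZMod (ℓ ^ 2)).val) / (ℓ ^ 2 : ℕ)) = zeta24 ^ (-3 : ℤ) * sqrt z *
      eta ((z + 24 * (invPair (isUnit_576 h2 h3) B : ZMod (ℓ ^ 2)).val) / (ℓ ^ 2 : ℕ)) := by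
  have hp : ℓ.Prime := Fact.out
  have hodd : Odd ℓ := by rw [← Nat.not_even_iff_odd, even_iff_two_dvd]; exact h2
  rw [eta_shift_neg_one_div hodd.pow (Nat.one_lt_pow two_ne_zero hp.one_lt)
    (mul_invPair (isUnit_576 h2 h3) B) hz]
  set B' := invPair (isUnit_576 h2 h3) B
  have hJ : jacobiSym (24 * (-(B' : ZMod (ℓ ^ 2))).val : ℕ) (ℓ ^ 2) = 1 := by
    rw [jacobiSym.pow_right]
    refine jacobiSym.sq_one ?_
    have h24 : IsUnit (24 : ZMod (ℓ ^ 2)) := by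
      refine isUnit_of_mul_isUnit_left (y := 24) ?_
      have := isUnit_576 (n := 2) h2 h3
      norm_num
      exact this
    have hu : IsUnit ((24 * (-(B' : ZMod (ℓ ^ 2))).val : ℕ) : ZMod (ℓ ^ 2)) := by
      push_cast
      rw [ZMod.natCast_zmod_val]
      exact h24.mul B'.isUnit.neg
    rw [Int.gcd_natCast_natCast]
    exact Nat.Coprime.coprime_dvd_right (dvd_pow_self ℓ two_ne_zero)
      ((ZMod.isUnit_iff_coprime _ _).mp hu)
  have hζ : zeta24 ^ (-3 * ((ℓ ^ 2 : ℕ) : ℤ)) = zeta24 ^ (-3 : ℤ) := by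
    refine zeta24_zpow_congr ?_
    obtain ⟨k, hk⟩ := eight_dvd_sq_sub_one (c := ℓ) (by exact_mod_cast hodd)
    exact ⟨-k, by push_cast; linear_combination -3 * hk⟩
  rw [hJ, hζ, Int.cast_one, one_mul]

lemma sqrt_natCast_mul {N : ℕ} [NeZero N] {z : ℂ} (hz : 0 < z.im) :
    sqrt (N * z) = (√(N : ℝ) : ℝ) * sqrt z := by
  have := sqrt_ofReal_mul (r := N) (Nat.cast_pos.mpr (NeZero.pos N)) hz
  exact_mod_cast this

/-- This is `eta_shift_neg_one_div` at ℓz with modulus ℓ. The Legendre symbol survives, and the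
translate of (ℓz)/ℓ has become one of z, as in the twist. -/
lemma eta_prime_shift (h2 : ¬ 2 ∣ ℓ) (h3 : ¬ 3 ∣ ℓ) (b : (ZMod ℓ)ˣ) {z : ℂ}
    (hz : 0 < z.im) :
    eta ((-1 / z / ℓ + 24 * (b : ZMod ℓ).val) / ℓ)
      = zeta24 ^ (-3 * (ℓ : ℤ)) * (√(ℓ : ℝ) : ℝ) * quadChar ℓ (-24) * sqrt z *
      (quadChar ℓ (invPair (isUnit_576' h2 h3) b : ZMod ℓ) *
      eta (z + 24 * (invPair (isUnit_576' h2 h3) b : ZMod ℓ).val / ℓ)) := by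
  have hp : ℓ.Prime := Fact.out
  have hodd : Odd ℓ := by rw [← Nat.not_even_iff_odd, even_iff_two_dvd]; exact h2
  have hℓ0 : (ℓ : ℂ) ≠ 0 := Nat.cast_ne_zero.mpr (NeZero.ne ℓ)
  have h := eta_shift_neg_one_div hodd hp.one_lt
    (mul_invPair (isUnit_576' h2 h3) b) (im_natCast_mul_pos (N := ℓ) hz)
  set b' := invPair (isUnit_576' h2 h3) b
  have hJ : (jacobiSym (24 * (-(b' : ZMod ℓ)).val : ℕ) ℓ : ℂ)
      = quadChar ℓ (-24) * quadChar ℓ (b' : ZMod ℓ) := by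
    rw [← jacobiSym.legendreSym.to_jacobiSym, ← quadChar_intCast, ← map_mul]
    congr 1
    push_cast
    rw [ZMod.natCast_zmod_val]
    ring
  have e1 : -1 / z / (ℓ : ℂ) = -1 / (ℓ * z) := by rw [div_div, mul_comm]
  have e2 : (ℓ * z + 24 * (b' : ZMod ℓ).val) / ℓ = z + 24 * (b' : ZMod ℓ).val / ℓ := by
    field_simp
  rw [e1, h, hJ, e2, sqrt_natCast_mul hz]
  ring

/-- The part of the translates of `F` of denominator `ℓ²` with numerators exactly divisible
by `ℓ`. -/
def primeShifts (ℓ : ℕ) [Fact ℓ.Prime] (F : ℂ → ℂ) (z : ℂ) : ℂ :=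
  ∑ b : (ZMod ℓ)ˣ, F ((z / ℓ + 24 * (b : ZMod ℓ).val) / ℓ)

/-- The twist of `F` by the quadratic character. -/
def quadTwist (ℓ : ℕ) [Fact ℓ.Prime] (F : ℂ → ℂ) (z : ℂ) : ℂ :=
  ∑ b : ZMod ℓ, quadChar ℓ b * F (z + 24 * b.val / ℓ)

lemma quadTwist_eq (F : ℂ → ℂ) (z : ℂ) : quadTwist ℓ F z
    = ∑ b : (ZMod ℓ)ˣ, quadChar ℓ (b : ZMod ℓ) * F (z + 24 * (b : ZMod ℓ).val / ℓ) := by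
  rw [quadTwist, ZMod_sum_eq_units_add, MulChar.map_nonunit _ not_isUnit_zero, zero_mul, add_zero]

lemma primeShifts_eta (h2 : ¬ 2 ∣ ℓ) (h3 : ¬ 3 ∣ ℓ) {z : ℂ} (hz : 0 < z.im) :
    primeShifts ℓ eta (-1 / z) = zeta24 ^ (-3 * (ℓ : ℤ)) * (√(ℓ : ℝ) : ℝ) * quadChar ℓ (-24) *
      sqrt z * quadTwist ℓ eta z := by
  rw [primeShifts, quadTwist_eq, ← Equiv.sum_comp (invPair (isUnit_576' h2 h3)) fun b : (ZMod ℓ)ˣ ↦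
    quadChar ℓ (b : ZMod ℓ) * eta (z + 24 * (b : ZMod ℓ).val / ℓ), Finset.mul_sum]
  exact Finset.sum_congr rfl fun b _ ↦ eta_prime_shift h2 h3 b hz

lemma quadChar_inv (x : ZMod ℓ) : (quadChar ℓ x)⁻¹ = quadChar ℓ x := by
  rcases quadChar_isQuadratic x with h | h | h <;> rw [h] <;> norm_num

/-- The Legendre symbols are ±1 on units and equal their inverses, so passing from η to 1/η only
inverts the common constant. -/
lemma primeShifts_etaInv (h2 : ¬ 2 ∣ ℓ) (h3 : ¬ 3 ∣ ℓ) {z : ℂ} (hz : 0 < z.im) :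
    primeShifts ℓ etaInv (-1 / z)
      = (zeta24 ^ (-3 * (ℓ : ℤ)) * (√(ℓ : ℝ) : ℝ) * quadChar ℓ (-24) *
      sqrt z)⁻¹ * quadTwist ℓ etaInv z := by
  rw [primeShifts, quadTwist_eq, ← Equiv.sum_comp (invPair (isUnit_576' h2 h3)) fun b : (ZMod ℓ)ˣ ↦
    quadChar ℓ (b : ZMod ℓ) * etaInv (z + 24 * (b : ZMod ℓ).val / ℓ), Finset.mul_sum]
  refine Finset.sum_congr rfl fun b _ ↦ ?_
  rw [etaInv, eta_prime_shift h2 h3 b hz, mul_inv, mul_inv (quadChar ℓ _), quadChar_inv, etaInv]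

lemma quadChar_mul_self_of_ne_zero {x : ZMod ℓ} (hx : x ≠ 0) :
    quadChar ℓ x * quadChar ℓ x = 1 := by
  rw [← pow_two, ← MulChar.pow_apply' _ two_ne_zero, quadChar_isQuadratic.sq_eq_one,
    MulChar.one_apply (isUnit_iff_ne_zero.mpr hx)]

lemma neg_twentyFour_ne_zero (h2 : ¬ 2 ∣ ℓ) (h3 : ¬ 3 ∣ ℓ) : (-24 : ZMod ℓ) ≠ 0 := by
  have hu := (isUnit_576' h2 h3).ne_zero
  intro h
  exact hu (by linear_combination -24 * h)

/-- Since I/ℓ = −1/(ℓI), equality would give a constant of modulus √ℓ equal to ±1. This provides a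
point at which `gauss_relation` can be read off by cancellation. -/
lemma eta_ne_chi12_mul_eta (h2 : ¬ 2 ∣ ℓ) (h3 : ¬ 3 ∣ ℓ) :
    eta (I / ℓ) - HeckePartition.chi12 ℓ * eta ((ℓ : ℂ) ^ 2 * (I / ℓ)) ≠ 0 := by
  have hp : ℓ.Prime := Fact.out
  have hℓ0 : (ℓ : ℂ) ≠ 0 := Nat.cast_ne_zero.mpr (NeZero.ne ℓ)
  have him : 0 < (ℓ * I).im := im_natCast_mul_pos (by simp)
  intro h
  have e1 : (ℓ : ℂ) ^ 2 * (I / ℓ) = ℓ * I := by field_simp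
  have e2 : I / ℓ = -1 / (ℓ * I) := by
    field_simp
    linear_combination Complex.I_sq
  rw [e1, e2, eta_neg_one_div him, sub_eq_zero] at h
  have h' : zeta24 ^ (-3 : ℤ) * sqrt (ℓ * I) = HeckePartition.chi12 ℓ :=
    mul_right_cancel₀ (eta_ne_zero him) h
  have h4 := congrArg (fun x ↦ x ^ 2) h'
  simp only [mul_pow, sqrt_sq] at h4
  rw [pow_two (HeckePartition.chi12 ℓ : ℂ), chi12_mul_self h2 h3, ← zpow_natCast, ← zpow_mul,
    show (-3 : ℤ) * (2 : ℕ) = -(6 : ℤ) by norm_num, zpow_neg, zeta24_zpow_six] at h4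
  have h5 : (ℓ : ℂ) = 1 := by
    rw [← h4]; field_simp
  exact hp.one_lt.ne' (by exact_mod_cast h5)

/-- The relation between the constants of the inversion, read off from `η`. -/
lemma gauss_relation (h2 : ¬ 2 ∣ ℓ) (h3 : ¬ 3 ∣ ℓ) :
    zeta24 ^ (-3 * (ℓ : ℤ)) * (√(ℓ : ℝ) : ℝ) * quadChar ℓ (-24) * quadGauss ℓ
      = ℓ * HeckePartition.chi12 ℓ * zeta24 ^ (-3 : ℤ) := by
  have hℓ0 : (ℓ : ℂ) ≠ 0 := Nat.cast_ne_zero.mpr (NeZero.ne ℓ)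
  set z : ℂ := I / ℓ with hz_def
  have hz : 0 < z.im := im_div_natCast_pos (by simp)
  have hz0 : z ≠ 0 := by intro h; rw [h] at hz; simp at hz
  have h1 := primeShifts_eta h2 h3 hz
  rw [quadTwist, sum_quadChar_mul_eta h2 h3 hz] at h1
  have hz' := im_neg_one_div_pos hz
  -- The identity for the ℓ-translates of η is inverted: its nonzero translates become the twist and
  -- its zero translate becomes η(ℓ²z). With the known twist of η, both sides are multiples of η(z)
  -- − χ₁₂(ℓ)η(ℓ²z).
  have h4 := sum_eta_shift h2 h3 (im_div_natCast_pos (N := ℓ) hz')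
  rw [ZMod_sum_eq_units_add, ← primeShifts, h1, ZMod.val_zero,
    show (ℓ : ℂ) * (-1 / z / ℓ) = -1 / z by field_simp, eta_neg_one_div hz,
    show (-1 / z / ℓ + 24 * ((0 : ℕ) : ℂ)) / ℓ = -1 / (ℓ * (ℓ * z)) by push_cast; field_simp; ring,
    eta_neg_one_div (im_natCast_mul_pos (im_natCast_mul_pos hz)),
    sqrt_natCast_mul (im_natCast_mul_pos hz), sqrt_natCast_mul hz] at h4
  have hsq : ((√(ℓ : ℝ) : ℝ) : ℂ) * (√(ℓ : ℝ) : ℝ) = ℓ := by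
    rw [← Complex.ofReal_mul, Real.mul_self_sqrt (Nat.cast_nonneg _), Complex.ofReal_natCast]
  have hχ := chi12_mul_self h2 h3
  have hne := mul_ne_zero (sqrt_ne_zero hz0) (eta_ne_chi12_mul_eta h2 h3)
  refine mul_right_cancel₀ hne ?_
  rw [← hz_def]
  have e3 : (ℓ : ℂ) * (ℓ * z) = ℓ ^ 2 * z := by ring
  rw [e3] at h4
  linear_combination h4 - zeta24 ^ (-3 : ℤ) * sqrt z * eta ((ℓ : ℂ) ^ 2 * z) * hsq
    + ℓ * zeta24 ^ (-3 : ℤ) * sqrt z * eta ((ℓ : ℂ) ^ 2 * z) * hχ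

/-! ### The Hecke image of 1/η under the inversion -/

/-- The image of `1 / η` under the Hecke operator of index `ℓ²`, up to normalization. -/
def heckeInv (ℓ : ℕ) [Fact ℓ.Prime] (z : ℂ) : ℂ :=
  ℓ * ∑ B : ZMod (ℓ ^ 2), etaInv ((z + 24 * B.val) / (ℓ ^ 2 : ℕ))
    + HeckePartition.chi12 ℓ * quadGauss ℓ * quadTwist ℓ etaInv z + etaInv ((ℓ ^ 2 : ℕ) * z)

lemma heckeInv_eq (z : ℂ) : heckeInv ℓ z
    = ℓ * ∑ B : (ZMod (ℓ ^ 2))ˣ, etaInv ((z + 24 * (B : ZMod (ℓ ^ 2)).val) / (ℓ ^ 2 : ℕ))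
      + (ℓ * primeShifts ℓ etaInv z + HeckePartition.chi12 ℓ * quadGauss ℓ * quadTwist ℓ etaInv z)
      + (ℓ * etaInv (z / (ℓ ^ 2 : ℕ)) + etaInv ((ℓ ^ 2 : ℕ) * z)) := by
  have hℓ0 : (ℓ : ℂ) ≠ 0 := Nat.cast_ne_zero.mpr (NeZero.ne ℓ)
  rw [heckeInv, ZMod_sum_sq_eq_units_add (fun n ↦ etaInv ((z + 24 * n) / (ℓ ^ 2 : ℕ))),
    ZMod_sum_eq_units_add, primeShifts]
  have (n : ℕ) : (z + 24 * (ℓ * n : ℕ)) / (ℓ ^ 2 : ℕ) = (z / ℓ + 24 * n) / ℓ := by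
    push_cast; field_simp
  simp only [this, ZMod.val_zero]
  rw [show (z / ℓ + 24 * (0 : ℕ)) / ℓ = z / (ℓ ^ 2 : ℕ) by push_cast; field_simp; ring]
  ring

/-- By `gauss_relation`, ℓ divided by the constant of `primeShifts_etaInv` is exactly the
coefficient of the twist in `heckeInv`, up to the automorphy factor of 1/η. The two parts are
therefore interchanged. -/
lemma primeShifts_etaInv_eq (h2 : ¬ 2 ∣ ℓ) (h3 : ¬ 3 ∣ ℓ) {z : ℂ} (hz : 0 < z.im) :
    ℓ * primeShifts ℓ etaInv (-1 / z) = (zeta24 ^ (-3 : ℤ) * sqrt z)⁻¹ *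
      (HeckePartition.chi12 ℓ * quadGauss ℓ * quadTwist ℓ etaInv z) := by
  have hℓ0 : (ℓ : ℂ) ≠ 0 := Nat.cast_ne_zero.mpr (NeZero.ne ℓ)
  have hz0 : z ≠ 0 := by rintro rfl; simp at hz
  have hr : ((√(ℓ : ℝ) : ℝ) : ℂ) ≠ 0 := by
    rw [Complex.ofReal_ne_zero]
    exact (Real.sqrt_pos.mpr (Nat.cast_pos.mpr (NeZero.pos ℓ))).ne'
  have hx := quadChar_mul_self_of_ne_zero (neg_twentyFour_ne_zero h2 h3)
  have hx0 : quadChar ℓ (-24) ≠ 0 := left_ne_zero_of_mul_eq_one hx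
  have hχ := chi12_mul_self h2 h3
  have hg := gauss_relation h2 h3
  have hs := sqrt_ne_zero hz0
  have hζ := zpow_ne_zero (-3) zeta24_ne_zero
  have hζ' := zpow_ne_zero (-3 * (ℓ : ℤ)) zeta24_ne_zero
  rw [primeShifts_etaInv h2 h3 hz]
  generalize quadTwist ℓ etaInv z = T
  generalize zeta24 ^ (-3 * (ℓ : ℤ)) = u at *
  generalize zeta24 ^ (-3 : ℤ) = v at *
  generalize quadChar ℓ (-24) = x at *
  field_simp
  linear_combination -T * HeckePartition.chi12 ℓ * hg - T * ℓ * v * hχ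

/-- Invariance of the Hecke image under the inversion. -/
lemma heckeInv_neg_one_div (h2 : ¬ 2 ∣ ℓ) (h3 : ¬ 3 ∣ ℓ) {z : ℂ} (hz : 0 < z.im) :
    heckeInv ℓ (-1 / z) = (zeta24 ^ (-3 : ℤ) * sqrt z)⁻¹ * heckeInv ℓ z := by
  have hℓ0 : (ℓ : ℂ) ≠ 0 := Nat.cast_ne_zero.mpr (NeZero.ne ℓ)
  have hz0 : z ≠ 0 := by rintro rfl; simp at hz
  have hz' := im_neg_one_div_pos hz
  have hsq : ((√((ℓ ^ 2 : ℕ) : ℝ) : ℝ) : ℂ) = ℓ := by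
    push_cast
    rw [Real.sqrt_sq (Nat.cast_nonneg _), Complex.ofReal_natCast]
  have hU : ∑ B : (ZMod (ℓ ^ 2))ˣ,
        etaInv ((-1 / z + 24 * (B : ZMod (ℓ ^ 2)).val) / (ℓ ^ 2 : ℕ))
      = (zeta24 ^ (-3 : ℤ) * sqrt z)⁻¹ * ∑ B : (ZMod (ℓ ^ 2))ˣ,
        etaInv ((z + 24 * (B : ZMod (ℓ ^ 2)).val) / (ℓ ^ 2 : ℕ)) := by
    rw [← Equiv.sum_comp (invPair (isUnit_576 h2 h3)) fun B : (ZMod (ℓ ^ 2))ˣ ↦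
      etaInv ((z + 24 * (B : ZMod (ℓ ^ 2)).val) / (ℓ ^ 2 : ℕ)), Finset.mul_sum]
    refine Finset.sum_congr rfl fun B _ ↦ ?_
    rw [etaInv, eta_unit_shift h2 h3 B hz, mul_inv, etaInv]
  have h4 := primeShifts_etaInv_eq h2 h3 hz
  -- The same relation at −1/z gives the reverse exchange; `hI` and `hζ` check that the two
  -- automorphy factors multiply to 1.
  have h5 := primeShifts_etaInv_eq h2 h3 hz'
  rw [show -1 / (-1 / z) = z by field_simp] at h5
  have hI := sqrt_neg_one_div_mul_sqrt hz
  have hζ : zeta24 ^ (-3 : ℤ) * zeta24 ^ (-3 : ℤ) * I = 1 := by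
    rw [← zeta24_zpow_six, ← zpow_add₀ zeta24_ne_zero, ← zpow_add₀ zeta24_ne_zero]; norm_num
  have h6 : etaInv (-1 / z / (ℓ ^ 2 : ℕ))
      = (zeta24 ^ (-3 : ℤ) * sqrt z)⁻¹ * ((ℓ : ℂ)⁻¹ * etaInv ((ℓ ^ 2 : ℕ) * z)) := by
    rw [show -1 / z / (ℓ ^ 2 : ℕ) = -1 / ((ℓ ^ 2 : ℕ) * z) by rw [div_div, mul_comm], etaInv,
      eta_neg_one_div (im_natCast_mul_pos hz), sqrt_natCast_mul hz, hsq, etaInv]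
    simp only [mul_inv]
    ring
  have h7 : etaInv ((ℓ ^ 2 : ℕ) * (-1 / z))
      = (zeta24 ^ (-3 : ℤ) * sqrt z)⁻¹ * (ℓ * etaInv (z / (ℓ ^ 2 : ℕ))) := by
    have hs : sqrt z = ℓ * sqrt (z / (ℓ ^ 2 : ℕ)) := by
      rw [← hsq, ← sqrt_natCast_mul (im_div_natCast_pos hz), mul_div_cancel₀]
      exact Nat.cast_ne_zero.mpr (NeZero.ne _)
    have h0 : sqrt (z / (ℓ ^ 2 : ℕ)) ≠ 0 := fun h ↦ sqrt_ne_zero hz0 (by rw [hs, h, mul_zero])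
    rw [show ((ℓ ^ 2 : ℕ) : ℂ) * (-1 / z) = -1 / (z / (ℓ ^ 2 : ℕ)) by
      push_cast; field_simp, etaInv, eta_neg_one_div (im_div_natCast_pos hz), etaInv, hs]
    simp only [mul_inv]
    field_simp
  rw [heckeInv_eq, heckeInv_eq, hU, h6, h7, h4, h5]
  have hs := sqrt_ne_zero hz0
  have hs' : sqrt (-1 / z) ≠ 0 := left_ne_zero_of_mul (hI.trans_ne I_ne_zero)
  generalize quadTwist ℓ etaInv (-1 / z) = T
  generalize quadTwist ℓ etaInv z = T'
  have key : T = (zeta24 ^ (-3 : ℤ) * sqrt z)⁻¹ * ((zeta24 ^ (-3 : ℤ) * sqrt (-1 / z))⁻¹ * T) := by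
    rw [← mul_assoc, ← mul_inv, show zeta24 ^ (-3 : ℤ) * sqrt z * (zeta24 ^ (-3 : ℤ) *
      sqrt (-1 / z)) = 1 by
        linear_combination hζ + zeta24 ^ (-3 : ℤ) * zeta24 ^ (-3 : ℤ) * hI]
    simp
  have hc : (ℓ : ℂ) * (ℓ : ℂ)⁻¹ = 1 := mul_inv_cancel₀ hℓ0
  linear_combination HeckePartition.chi12 ℓ * quadGauss ℓ * key
    + (zeta24 ^ (-3 : ℤ) * sqrt z)⁻¹ * etaInv ((ℓ ^ 2 : ℕ) * z) * hc
end
end HeckeEta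

namespace HeckeEta
open Complex hiding eta
open ModularForm

noncomputable section

/-! ### Power series expansions at the cusp -/

open UpperHalfPlane (atImInfty IsBoundedAtImInfty ofComplex)
open UpperHalfPlane hiding I
open scoped Derivative Manifold Topology
open Filter

/-- `F` has the absolutely convergent expansion `∑ Pₙ qⁿ` on the upper half-plane. -/
def HasQExp (P : PowerSeries ℂ) (F : ℍ → ℂ) : Prop :=
  ∀ τ : ℍ, HasSum (fun n ↦ P.coeff n * cexp (2 * Real.pi * I * τ) ^ n) (F τ)

lemma tendsto_exp_atImInfty :
    Tendsto (fun τ : ℍ ↦ cexp (2 * Real.pi * I * τ)) atImInfty (𝓝 0) := by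
  simpa [Function.Periodic.qParam] using qParam_tendsto_atImInfty one_pos

namespace HasQExp

variable {P Q : PowerSeries ℂ} {F G : ℍ → ℂ}

lemma congr (hF : HasQExp P F) (h : ∀ τ, G τ = F τ) : HasQExp P G := (funext h : G = F) ▸ hF

lemma C_mul (c : ℂ) (hF : HasQExp P F) : HasQExp (PowerSeries.C c * P) (fun τ ↦ c * F τ) :=
  fun τ ↦ by simpa only [PowerSeries.coeff_C_mul, mul_assoc] using (hF τ).mul_left c

lemma sub (hF : HasQExp P F) (hG : HasQExp Q G) : HasQExp (P - Q) (fun τ ↦ F τ - G τ) :=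
  fun τ ↦ by simpa only [map_sub, sub_mul] using (hF τ).sub (hG τ)

lemma const (c : ℂ) : HasQExp (PowerSeries.C c) (fun _ ↦ c) := fun τ ↦ by
  have h := hasSum_single (f := fun n ↦ (PowerSeries.C c).coeff n *
    cexp (2 * Real.pi * I * τ) ^ n) 0 fun n hn ↦ by simp [PowerSeries.coeff_C, hn]
  simpa using h

lemma one : HasQExp 1 (fun _ ↦ 1) := by simpa using const 1

lemma X : HasQExp PowerSeries.X (fun τ : ℍ ↦ cexp (2 * Real.pi * I * τ)) := fun τ ↦ by
  have h := hasSum_single (f := fun n ↦ (PowerSeries.X : PowerSeries ℂ).coeff n *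
    cexp (2 * Real.pi * I * τ) ^ n) 1 fun n hn ↦ by simp [PowerSeries.coeff_X, hn]
  simpa using h

lemma mul (hF : HasQExp P F) (hG : HasQExp Q G) : HasQExp (P * Q) (fun τ ↦ F τ * G τ) := fun τ ↦ by
  have h1 := (hF τ).summable.norm
  have h2 := (hG τ).summable.norm
  have h := (summable_norm_sum_mul_antidiagonal_of_summable_norm h1 h2).of_norm.hasSum
  rw [← tsum_mul_tsum_eq_tsum_sum_antidiagonal_of_summable_norm h1 h2, (hF τ).tsum_eq,
    (hG τ).tsum_eq] at h
  refine hasSum_of_eq h fun n ↦ ?_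
  rw [PowerSeries.coeff_mul, Finset.sum_mul]
  refine Finset.sum_congr rfl fun x hx ↦ ?_
  rw [← Finset.HasAntidiagonal.mem_antidiagonal.mp hx, pow_add]
  ring

lemma pow (hF : HasQExp P F) (n : ℕ) : HasQExp (P ^ n) (fun τ ↦ F τ ^ n) := by
  induction n with
  | zero => simpa using one
  | succ n ih => simpa only [pow_succ] using ih.mul hF

lemma sum {ι : Type*} {s : Finset ι} {P : ι → PowerSeries ℂ} {F : ι → ℍ → ℂ}
    (h : ∀ i ∈ s, HasQExp (P i) (F i)) : HasQExp (∑ i ∈ s, P i) (fun τ ↦ ∑ i ∈ s, F i τ) := by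
  intro τ
  simpa only [map_sum, Finset.sum_mul] using hasSum_sum fun i hi ↦ h i hi τ

lemma isBoundedAtImInfty (hF : HasQExp P F) : IsBoundedAtImInfty F :=
  isBoundedAtImInfty_of_hasSum_qExpansion (c := fun n ↦ P.coeff n) one_pos fun τ ↦ by
    simpa [Function.Periodic.qParam] using hF τ

lemma of_X_mul (hF : HasQExp (PowerSeries.X * P) F) :
    HasQExp P (fun τ : ℍ ↦ (cexp (2 * Real.pi * I * τ))⁻¹ * F τ) := fun τ ↦ by
  have h := hF τ
  rw [← hasSum_nat_add_iff' 1] at h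
  refine hasSum_of_eq (by simpa using h.mul_left (cexp (2 * Real.pi * I * τ))⁻¹) fun n ↦ ?_
  rw [pow_succ]
  have := Complex.exp_ne_zero (2 * Real.pi * I * τ)
  field_simp

lemma of_X_pow_mul {k : ℕ} (hF : HasQExp (PowerSeries.X ^ k * P) F) :
    HasQExp P (fun τ : ℍ ↦ (cexp (2 * Real.pi * I * τ) ^ k)⁻¹ * F τ) := by
  induction k generalizing F with
  | zero => simpa using hF
  | succ k ih =>
    rw [pow_succ', mul_assoc] at hF
    refine (ih hF.of_X_mul).congr fun τ ↦ ?_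
    rw [pow_succ, mul_inv, mul_assoc]

/-- Factor out q: the quotient again has an expansion, hence is bounded at the cusp, while q tends
to 0 there. -/
lemma tendsto_of_coeff_zero (hF : HasQExp P F) (h0 : P.coeff 0 = 0) :
    Tendsto F atImInfty (𝓝 0) := by
  obtain ⟨Q, rfl⟩ := PowerSeries.X_dvd_iff.mpr
    ((PowerSeries.coeff_zero_eq_constantCoeff_apply P).symm.trans h0)
  have h1 := ((Asymptotics.isLittleO_one_iff ℝ).mpr tendsto_exp_atImInfty).mul_isBigO
    (hF.of_X_mul.isBoundedAtImInfty : _ =O[atImInfty] (1 : ℍ → ℝ))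
  rw [← Asymptotics.isLittleO_one_iff ℝ]
  refine (h1.congr (fun τ ↦ ?_) fun τ ↦ ?_)
  · exact mul_inv_cancel_left₀ (Complex.exp_ne_zero _) _
  · simp

lemma tendsto (hF : HasQExp P F) : Tendsto F atImInfty (𝓝 (P.coeff 0)) := by
  have h := (hF.sub (const (P.coeff 0))).tendsto_of_coeff_zero (by simp)
  simpa using h.add_const (P.coeff 0)

/-- The limit at the cusp kills the constant term; dividing by q moves the next coefficient into its
place. -/
lemma coeff_eq_zero {n : ℕ} (h : HasQExp P (fun _ ↦ 0)) : P.coeff n = 0 := by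
  induction n generalizing P with
  | zero => exact tendsto_nhds_unique h.tendsto tendsto_const_nhds
  | succ n ih =>
    obtain ⟨Q, rfl⟩ := PowerSeries.X_dvd_iff.mpr
      ((PowerSeries.coeff_zero_eq_constantCoeff_apply P).symm.trans
        (tendsto_nhds_unique h.tendsto tendsto_const_nhds))
    rw [mul_comm, PowerSeries.coeff_succ_mul_X]
    exact ih (by simpa using h.of_X_mul)

lemma unique (hP : HasQExp P F) (hQ : HasQExp Q F) : P = Q := by
  have h : HasQExp (P - Q) (fun _ ↦ 0) := by simpa using hP.sub hQ
  ext n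
  exact sub_eq_zero.mp ((map_sub _ _ _).symm.trans h.coeff_eq_zero)

end HasQExp

/-- The family of coefficients of `e(rz/24) ∑ Pₙ qⁿ`. -/
def shiftCoeff (r : ℤ) (P : PowerSeries ℂ) : ℤ → ℂ :=
  Function.extend (fun n : ℕ ↦ 24 * (n : ℤ) + r) (fun n ↦ P.coeff n) 0

lemma shift_injective (r : ℤ) : Function.Injective (fun n : ℕ ↦ 24 * (n : ℤ) + r) :=
  fun m n h ↦ by simpa using h

lemma shiftCoeff_apply (r : ℤ) (P : PowerSeries ℂ) (n : ℕ) :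
    shiftCoeff r P (24 * n + r) = P.coeff n := (shift_injective r).extend_apply _ _ n

lemma HasQExp.hasExp {P : PowerSeries ℂ} {F : ℍ → ℂ} {G : ℂ → ℂ} (hF : HasQExp P F) (r : ℤ)
    (hG : ∀ τ : ℍ, G τ = qe r τ * F τ) : HasExp (shiftCoeff r P) G := by
  intro z hz
  rw [← (shift_injective r).hasSum_iff]
  · rw [show G z = _ from hG ⟨z, hz⟩]
    refine hasSum_of_eq ((hF ⟨z, hz⟩).mul_left (qe r z)) fun n ↦ ?_
    rw [Function.comp_apply, shiftCoeff_apply, qe_add_left, qe_natCast_mul]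
    ring
  · intro m hm
    rw [shiftCoeff, Function.extend_apply' _ _ _ hm, Pi.zero_apply, zero_mul]

lemma HasExp.hasQExp {a : ℤ → ℂ} {F : ℂ → ℂ} (hF : HasExp a F) (r : ℤ)
    (ha : ∀ m, a m ≠ 0 → ∃ n : ℕ, m = 24 * n + r) :
    HasQExp (PowerSeries.mk fun n ↦ a (24 * n + r)) (fun τ ↦ qe (-r) τ * F τ) := by
  intro τ
  have h := (hF τ τ.im_pos).mul_left (qe (-r) τ)
  rw [← (shift_injective r).hasSum_iff] at h
  · refine hasSum_of_eq h fun n ↦ ?_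
    rw [PowerSeries.coeff_mk, Function.comp_apply, mul_left_comm, ← qe_add_left, neg_add_cancel_comm_assoc,
      qe_natCast_mul]
  · intro m hm
    by_cases h0 : a m = 0
    · rw [h0]; ring
    · obtain ⟨n, rfl⟩ := ha m h0
      exact absurd ⟨n, rfl⟩ hm

namespace HasQExp

variable {P : PowerSeries ℂ} {F : ℍ → ℂ}

lemma hasExp_ofComplex (hF : HasQExp P F) : HasExp (shiftCoeff 0 P) (F ∘ ofComplex) :=
  hF.hasExp 0 fun τ ↦ by simp [qe_zero_left]

lemma mdifferentiable (hF : HasQExp P F) : MDiff F :=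
  UpperHalfPlane.mdifferentiable_iff.mpr fun _ hz ↦
    (hF.hasExp_ofComplex.differentiableAt hz).differentiableWithinAt

lemma deriv (hF : HasQExp P F) : HasQExp (PowerSeries.X * PowerSeries.derivative ℂ P) (D F) := by
  have h := hF.hasExp_ofComplex.deriv.hasQExp 0 fun m hm ↦ by
    by_contra hcon
    refine hm ?_
    rw [shiftCoeff, Function.extend_apply', Pi.zero_apply, mul_zero]
    rintro ⟨n, rfl⟩
    exact hcon ⟨n, rfl⟩
  have hP : PowerSeries.mk (fun n : ℕ ↦ ((24 * n + 0 : ℤ) : ℂ) / 24 * shiftCoeff 0 P (24 * n + 0))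
      = PowerSeries.X * PowerSeries.derivative ℂ P := by
    ext n
    rw [PowerSeries.coeff_mk, shiftCoeff_apply, mul_comm PowerSeries.X]
    cases n with
    | zero => simp
    | succ n =>
      rw [PowerSeries.coeff_succ_mul_X, PowerSeries.coeff_derivative]
      push_cast
      ring
  rw [hP] at h
  exact h.congr fun τ ↦ by simp [qe_zero_left, Derivative.normalizedDerivOfComplex]

lemma periodic (hF : HasQExp P F) (τ : ℍ) : F ((1 : ℝ) +ᵥ τ) = F τ := by
  refine (hF _).unique (hasSum_of_eq (hF τ) fun n ↦ ?_)
  congr 2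
  rw [UpperHalfPlane.coe_vadd, mul_add, Complex.exp_add]
  simp

end HasQExp
end
end HeckeEta

namespace HeckeEta
open Complex hiding eta
open ModularForm

noncomputable section

open UpperHalfPlane (atImInfty IsBoundedAtImInfty ofComplex)
open UpperHalfPlane hiding I
open scoped Derivative Manifold Topology MatrixGroups
open Filter

/-! ### The expansions of the modular forms and of the partition generating function -/

/-- The reciprocal is periodic, holomorphic and bounded at the cusp, so it has some expansion on the
whole upper half-plane. Uniqueness of expansions identifies it with the formal inverse. -/
lemma HasQExp.inv {P Q : PowerSeries ℂ} {F : ℍ → ℂ} (hF : HasQExp P F) (hPQ : P * Q = 1)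
    (h0 : ∀ τ, F τ ≠ 0) : HasQExp Q (fun τ ↦ (F τ)⁻¹) := by
  have hP0 : P.coeff 0 ≠ 0 := by
    have := congrArg PowerSeries.constantCoeff hPQ
    rw [map_mul, map_one] at this
    rw [PowerSeries.coeff_zero_eq_constantCoeff_apply]
    exact left_ne_zero_of_mul_eq_one this
  have hper : Function.Periodic ((fun τ ↦ (F τ)⁻¹) ∘ ofComplex) ((1 : ℝ) : ℂ) := by
    intro w
    rcases lt_or_ge 0 (im w) with hw | hw
    · have hw' : 0 < im (w + (1 : ℝ)) := by simp [hw]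
      simp only [Function.comp_apply, ofComplex_apply_of_im_pos hw', ofComplex_apply_of_im_pos hw]
      rw [← hF.periodic ⟨w, hw⟩]
      congr 2
      ext
      simp [add_comm]
    -- Outside the upper half-plane `ofComplex` takes a fixed default value, so periodicity is
    -- trivial there.
    · have hw' : im (w + (1 : ℝ)) ≤ 0 := by simpa using hw
      simp only [Function.comp_apply, ofComplex_apply_of_im_nonpos hw',
        ofComplex_apply_of_im_nonpos hw]
  have hdiff : MDiff (fun τ ↦ (F τ)⁻¹) := by
    have := UpperHalfPlane.mdifferentiable_iff.mp hF.mdifferentiable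
    exact UpperHalfPlane.mdifferentiable_iff.mpr (this.inv fun z _ ↦ h0 _)
  have hbdd : IsBoundedAtImInfty (fun τ ↦ (F τ)⁻¹) := (hF.tendsto.inv₀ hP0).isBigO_one ℝ
  have hR : HasQExp (qExpansion 1 (fun τ ↦ (F τ)⁻¹)) (fun τ ↦ (F τ)⁻¹) := fun τ ↦ by
    simpa [Function.Periodic.qParam] using hasSum_qExpansion one_pos hper hdiff hbdd τ
  have hPR : P * qExpansion 1 (fun τ ↦ (F τ)⁻¹) = 1 :=
    ((hF.mul hR).congr fun τ ↦ (mul_inv_cancel₀ (h0 τ)).symm).unique HasQExp.one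
  have hRQ : qExpansion 1 (fun τ ↦ (F τ)⁻¹) = Q := by
    calc _ = (P * Q) * qExpansion 1 (fun τ ↦ (F τ)⁻¹) := by rw [hPQ, one_mul]
      _ = Q * (P * qExpansion 1 (fun τ ↦ (F τ)⁻¹)) := by ring
      _ = Q := by rw [hPR, mul_one]
  rwa [hRQ] at hR

/-- Extension of scalars from `ℤ⟦q⟧` to `ℂ⟦q⟧`. -/
def complexify : PowerSeries ℤ →+* PowerSeries ℂ := PowerSeries.map (Int.castRingHom ℂ)

lemma coeff_complexify (P : PowerSeries ℤ) (n : ℕ) : (complexify P).coeff n = (P.coeff n : ℂ) :=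
  PowerSeries.coeff_map _ _ _

lemma hasQExp_of_modularForm {k : ℤ} (f : ModularForm 𝒮ℒ k) : HasQExp (qExpansion 1 f) f :=
  fun τ ↦ by
    simpa [Function.Periodic.qParam] using
      ModularForm.hasSum_qExpansion (f := f) one_pos one_mem_strictPeriods_SL τ

lemma hasQExp_E₄ : HasQExp (complexify HeckePartition.qE4) E₄ := by
  convert hasQExp_of_modularForm E₄
  ext n
  rw [coeff_complexify, HeckePartition.qE4, PowerSeries.coeff_mk,
    EisensteinSeries.E_qExpansion_coeff _ ⟨2, rfl⟩, show bernoulli 4 = -1 / 30 by decide +kernel]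
  split_ifs <;> norm_num

lemma hasQExp_E₆ : HasQExp (complexify HeckePartition.qE6) E₆ := by
  convert hasQExp_of_modularForm E₆
  ext n
  rw [coeff_complexify, HeckePartition.qE6, PowerSeries.coeff_mk,
    EisensteinSeries.E_qExpansion_coeff _ ⟨3, rfl⟩, show bernoulli 6 = 1 / 42 by decide +kernel]
  split_ifs <;> norm_num

/-- The `q`-series of `E₂`. -/
def qE2 : PowerSeries ℂ :=
  PowerSeries.mk fun m ↦ if m = 0 then 1 else -24 * (ArithmeticFunction.sigma 1 m : ℂ)

lemma hasQExp_E2 : HasQExp qE2 EisensteinSeries.E2 := fun τ ↦ by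
  simpa [qE2] using EisensteinSeries.hasSum_qExpansion_E2 (z := τ)

/-- The product `∏ (1 - qⁿ)` as a function on the upper half-plane. -/
def eulerProd (τ : ℍ) : ℂ := ∏' n : ℕ, (1 - cexp (2 * Real.pi * I * τ) ^ (n + 1))

lemma eta_eq_qe_mul_eulerProd (τ : ℍ) : eta τ = qe 1 τ * eulerProd τ := eta_eq_qe_mul τ

lemma eulerProd_ne_zero (τ : ℍ) : eulerProd τ ≠ 0 := by
  have h := eta_ne_zero τ.im_pos
  rw [eta_eq_qe_mul_eulerProd] at h
  exact right_ne_zero_of_mul h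

lemma qEuler_eq : HeckePartition.qEuler = PowerSeries.pentagonalSeries ℤ :=
  PowerSeries.WithPiTopology.tprod_one_sub_X_pow ℤ

lemma hasQExp_eulerProd : HasQExp (complexify HeckePartition.qEuler) eulerProd := by
  intro τ
  have h := hasSum_pentagonal (norm_exp_lt_one τ.im_pos)
  rw [← pentagonal_injective.hasSum_iff]
  · refine hasSum_of_eq h fun k ↦ ?_
    rw [Function.comp_apply, coeff_complexify, qEuler_eq,
      PowerSeries.coeff_pentagonalSeries_pentagonal]
    rfl
  · intro n hn
    rw [coeff_complexify, qEuler_eq, PowerSeries.coeff_pentagonalSeries_eq_zero ℤ hn,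
      Int.cast_zero, zero_mul]

lemma complexify_qDelta : complexify HeckePartition.qDelta
    = PowerSeries.X * complexify HeckePartition.qEuler ^ 24 := by
  rw [HeckePartition.qDelta, map_mul, map_pow, complexify, PowerSeries.map_X]

lemma discriminant_eq_exp_mul (τ : ℍ) :
    discriminant τ = cexp (2 * Real.pi * I * τ) * eulerProd τ ^ 24 := by
  rw [discriminant, eta_eq_qe_mul_eulerProd, mul_pow, qe, ← Complex.exp_nat_mul]
  congr 2
  push_cast
  ring

lemma hasQExp_discriminant : HasQExp (complexify HeckePartition.qDelta) discriminant := by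
  rw [complexify_qDelta]
  exact (HasQExp.X.mul (hasQExp_eulerProd.pow 24)).congr discriminant_eq_exp_mul

section PartitionSeries

open scoped PowerSeries.WithPiTopology

/-- The unrestricted partition series is a product of geometric series, each cancelling one factor
of the Euler product. -/
lemma qEuler_mul_partition : HeckePartition.qEuler *
    PowerSeries.mk (fun n ↦ (Fintype.card (Nat.Partition n) : ℤ)) = 1 := by
  have h1 : HasProd (fun n ↦ (1 - PowerSeries.X ^ (n + 1) : PowerSeries ℤ))
      HeckePartition.qEuler := by
    rw [qEuler_eq]
    exact PowerSeries.WithPiTopology.hasProd_one_sub_X_pow ℤ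
  have h2 := Nat.Partition.hasProd_powerSeriesMk_card_restricted ℤ (fun _ ↦ True)
  have h := h1.mul h2
  have e (n : ℕ) : (1 - PowerSeries.X ^ (n + 1) : PowerSeries ℤ) *
      (if True then ∑' j : ℕ, PowerSeries.X ^ ((n + 1) * j) else 1) = 1 := by
    rw [if_pos trivial]
    simp_rw [pow_mul]
    exact PowerSeries.WithPiTopology.one_sub_mul_tsum_pow_of_constantCoeff_eq_zero (by simp)
  simp only [e] at h
  have h3 := h.unique hasProd_one
  simpa [Nat.Partition.restricted] using h3

end PartitionSeries

lemma hasQExp_inv_eulerProd : HasQExp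
    (complexify (PowerSeries.mk fun n ↦ (Fintype.card (Nat.Partition n) : ℤ)))
    (fun τ ↦ (eulerProd τ)⁻¹) :=
  hasQExp_eulerProd.inv (by rw [← map_mul, qEuler_mul_partition, map_one]) eulerProd_ne_zero

/-! ### Modular forms from expansions -/

lemma HasQExp.slash_T {P : PowerSeries ℂ} {F : ℍ → ℂ} (hF : HasQExp P F) (k : ℤ) :
    F ∣[k] ModularGroup.T = F := by
  ext z
  have h : denom ModularGroup.T z = 1 := by
    rw [ModularGroup.denom_apply]
    simp [ModularGroup.coe_T]
  rw [SL_slash_apply, modular_T_smul, hF.periodic, h, one_zpow, mul_one]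

/-- A function with an expansion at the cusp which is invariant under the inversion is a modular
form of level one. -/
def HasQExp.toModularForm {P : PowerSeries ℂ} {F : ℍ → ℂ} {k : ℤ} (hF : HasQExp P F)
    (hS : F ∣[k] ModularGroup.S = F) : ModularForm 𝒮ℒ k where
  toFun := F
  slash_action_eq' A hA := by
    obtain ⟨A, rfl⟩ := hA
    exact SlashInvariantForm.slash_action_generators_SL2Z hS (hF.slash_T k) A
  holo' := hF.mdifferentiable
  bdd_at_cusps' hc := by
    rw [Subgroup.IsArithmetic.isCusp_iff_isCusp_SL2Z] at hc
    rw [OnePoint.isBoundedAt_iff_forall_SL2Z hc]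
    intro γ _
    rw [SlashInvariantForm.slash_action_generators_SL2Z hS (hF.slash_T k)]
    exact hF.isBoundedAtImInfty

/-- Level-one forms of weight 0 are constant, and the constant is the limit at the cusp. This is
where analytic input turns a congruence of expansions into an identity. -/
lemma HasQExp.eq_const {P : PowerSeries ℂ} {F : ℍ → ℂ} (hF : HasQExp P F)
    (hS : F ∣[(0 : ℤ)] ModularGroup.S = F) (τ : ℍ) : F τ = P.coeff 0 := by
  obtain ⟨c, hc⟩ := ModularFormClass.levelOne_weight_zero_const (hF.toModularForm hS)
  have hc' : F = Function.const _ c := hc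
  have h := hF.tendsto
  rw [hc'] at h ⊢
  exact tendsto_nhds_unique tendsto_const_nhds h

/-! ### Derivatives of `E₄`, `Δ` and `η` -/

lemma E₄_slash (γ : SL(2, ℤ)) : (E₄ : ℍ → ℂ) ∣[(4 : ℤ)] γ = E₄ :=
  SlashInvariantFormClass.slash_action_eq E₄ _ ⟨γ, rfl⟩

lemma hasQExp_serreDerivative_E₄ : HasQExp
    (PowerSeries.X * PowerSeries.derivative ℂ (complexify HeckePartition.qE4)
      - PowerSeries.C (4 * 12⁻¹) * (qE2 * complexify HeckePartition.qE4))
    (Derivative.serreDerivative 4 E₄) :=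
  (hasQExp_E₄.deriv.sub ((hasQExp_E2.mul hasQExp_E₄).C_mul (4 * 12⁻¹))).congr fun τ ↦ by
    rw [Derivative.serreDerivative_apply]; ring

/-- Ramanujan's differential equation for `E₄`. -/
lemma deriv_E₄ (τ : ℍ) :
    D E₄ τ = (EisensteinSeries.E2 τ * E₄ τ - E₆ τ) / 3 := by
  have hS : Derivative.serreDerivative 4 E₄ ∣[(6 : ℤ)] ModularGroup.S
      = Derivative.serreDerivative 4 E₄ :=
    Derivative.serreDerivative_slash_invariant (k := 4) hasQExp_E₄.mdifferentiable (E₄_slash _)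
  obtain ⟨c, hc⟩ := (finrank_eq_one_iff_of_nonzero' (E₆ : ModularForm 𝒮ℒ 6)
    (by intro h; exact EisensteinSeries.E_ne_zero (by norm_num : 3 ≤ 6) ⟨3, rfl⟩ h)).mp
    (Module.rank_eq_one_iff_finrank_eq_one.mp levelOne_weight_six_rank_one)
    (hasQExp_serreDerivative_E₄.toModularForm hS)
  have hc' (τ : ℍ) : Derivative.serreDerivative 4 E₄ τ = c * E₆ τ :=
    (DFunLike.congr_fun hc τ).symm
  have h1 := hasQExp_serreDerivative_E₄.tendsto
  have h2 := (hasQExp_E₆.C_mul c).tendsto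
  -- Weight 6 is one-dimensional, so the Serre derivative is cE₆; the constant terms give c = −4/12.
  have h3 := tendsto_nhds_unique (h1.congr hc') h2
  have hE4 : (complexify HeckePartition.qE4).coeff 0 = 1 := by
    simp [coeff_complexify, HeckePartition.qE4]
  have hE6 : (complexify HeckePartition.qE6).coeff 0 = 1 := by
    simp [coeff_complexify, HeckePartition.qE6]
  have hE2 : qE2.coeff 0 = 1 := by simp [qE2]
  rw [PowerSeries.coeff_C_mul, hE6, map_sub, PowerSeries.coeff_C_mul, PowerSeries.coeff_mul,
    Finset.Nat.antidiagonal_zero, Finset.sum_singleton, PowerSeries.coeff_mul,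
    Finset.Nat.antidiagonal_zero, Finset.sum_singleton, hE4, hE2, PowerSeries.coeff_zero_X] at h3
  have h4 := hc' τ
  rw [Derivative.serreDerivative_apply] at h4
  linear_combination h4 - E₆ τ * h3

lemma hasDerivAt_eta (τ : ℍ) :
    HasDerivAt eta (Real.pi * I / 12 * EisensteinSeries.E2 τ * eta τ) τ := by
  have h := (differentiableAt_eta_of_mem_upperHalfPlaneSet τ.im_pos).hasDerivAt
  have h2 := logDeriv_eta_eq_E2 τ
  rw [logDeriv_apply, div_eq_iff (eta_ne_zero τ.im_pos)] at h2
  rwa [h2] at h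

lemma hasDerivAt_discriminant (τ : ℍ) : HasDerivAt (discriminant ∘ ofComplex)
    (2 * Real.pi * I * (EisensteinSeries.E2 τ * discriminant τ)) τ := by
  have h := (hasDerivAt_eta τ).pow 24
  have e : discriminant ∘ ofComplex =ᶠ[𝓝 (τ : ℂ)] eta ^ 24 := by
    filter_upwards [isOpen_upperHalfPlaneSet.mem_nhds τ.im_pos] with z hz
    simp [discriminant, ofComplex_apply_of_im_pos hz]
  refine (h.congr_of_eventuallyEq e).congr_deriv ?_
  rw [discriminant]
  push_cast
  ring

lemma deriv_discriminant (τ : ℍ) : D discriminant τ = EisensteinSeries.E2 τ * discriminant τ := by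
  rw [Derivative.normalizedDerivOfComplex, (hasDerivAt_discriminant τ).deriv,
    inv_mul_cancel_left₀ Complex.two_pi_I_ne_zero]

lemma hasDerivAt_E₄ (τ : ℍ) : HasDerivAt (E₄ ∘ ofComplex)
    (2 * Real.pi * I * ((EisensteinSeries.E2 τ * E₄ τ - E₆ τ) / 3)) τ := by
  have h := (UpperHalfPlane.mdifferentiableAt_iff.mp (hasQExp_E₄.mdifferentiable τ)).hasDerivAt
  rw [← deriv_E₄, Derivative.normalizedDerivOfComplex, mul_inv_cancel_left₀]
  · exact h
  · exact Complex.two_pi_I_ne_zero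

/-- The formal version of the differential equation for `Δ`. -/
lemma X_mul_derivative_qDelta : PowerSeries.X * PowerSeries.derivative ℂ
    (complexify HeckePartition.qDelta) = qE2 * complexify HeckePartition.qDelta :=
  hasQExp_discriminant.deriv.unique
    ((hasQExp_E2.mul hasQExp_discriminant).congr deriv_discriminant)

/-- The formal version of the differential equation for `E₄`. -/
lemma X_mul_derivative_qE4 : PowerSeries.C 3 * (PowerSeries.X * PowerSeries.derivative ℂ
    (complexify HeckePartition.qE4))
      = qE2 * complexify HeckePartition.qE4 - complexify HeckePartition.qE6 :=
  (hasQExp_E₄.deriv.C_mul 3).unique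
    (((hasQExp_E2.mul hasQExp_E₄).sub hasQExp_E₆).congr fun τ ↦ by rw [deriv_E₄]; ring)
end
end HeckeEta

namespace HeckeEta
open Complex hiding eta
open ModularForm

noncomputable section

/-! ### Principal parts in terms of a local parameter -/

section LocalParameter

open PowerSeries in
-- With t = Xw, the hypothesis says φ = X t'/t. The coefficient is then the residue of t' t^(−i−1),
-- an exact derivative for i ≠ 0 in characteristic zero.
lemma coeff_mul_pow_eq_zero {K : Type*} [Field K] [CharZero K] {w v φ : PowerSeries K}
    (hv : w * v = 1) (hφ : φ * w = w + X * derivative K w) {i : ℕ} (hi : i ≠ 0) :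
    (φ * v ^ i).coeff i = 0 := by
  have hv' : derivative K v = -v ^ 2 * derivative K w := by
    have h := congrArg (derivative K) hv
    rw [Derivation.leibniz, smul_eq_mul, smul_eq_mul, PowerSeries.derivative_one] at h
    linear_combination v * h - derivative K v * hv
  obtain ⟨j, rfl⟩ := Nat.exists_eq_succ_of_ne_zero hi
  have h1 : ((j + 1 : ℕ) : PowerSeries K) * (φ * v ^ (j + 1))
      = ((j + 1 : ℕ) : PowerSeries K) * v ^ (j + 1) - derivative K (v ^ (j + 1)) * X := by
    rw [derivative_pow, hv', Nat.add_sub_cancel]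
    linear_combination ((j + 1 : ℕ) : PowerSeries K) * v ^ (j + 1) * (v * hφ - (φ - 1) * hv)
  have h2 := congrArg (coeff (j + 1)) h1
  rw [map_sub, coeff_succ_mul_X, coeff_derivative, ← map_natCast (PowerSeries.C (R := K)),
    coeff_C_mul, coeff_C_mul] at h2
  have hj : ((j + 1 : ℕ) : K) ≠ 0 := Nat.cast_ne_zero.mpr hi
  refine (mul_eq_zero.mp (h2.trans ?_)).resolve_left hj
  push_cast
  ring

open PowerSeries in
/-- The principal part of `F / qˢ` in terms of the local parameter `X * w`. -/
theorem X_pow_dvd_sub_principal_part {K : Type*} [Field K] [CharZero K] {w v φ : PowerSeries K}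
    (F : PowerSeries K) (s : ℕ) (hv : w * v = 1) (hφ : φ * w = w + X * derivative K w) :
    X ^ (s + 1) ∣ w ^ s * F - ∑ k ∈ Finset.range (s + 1),
      C (((X * w) ^ k * (F * φ)).coeff s) * (X * w) ^ (s - k) := by
  set R := w ^ s * F - ∑ k ∈ Finset.range (s + 1),
      C (((X * w) ^ k * (F * φ)).coeff s) * (X * w) ^ (s - k) with hR
  have hw0 : w.constantCoeff * v.constantCoeff = 1 := by rw [← map_mul, hv, map_one]
  have hφ0 : φ.constantCoeff = 1 := by
    have h := congrArg constantCoeff hφ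
    rw [map_mul, map_add, map_mul, constantCoeff_X, zero_mul, add_zero] at h
    exact mul_right_cancel₀ (left_ne_zero_of_mul_eq_one hw0) (h.trans (one_mul _).symm)
  have hwv (n : ℕ) : w ^ n * v ^ n = 1 := by rw [← mul_pow, hv, one_pow]
  -- Pairing with t^(−n) dt/t: by the vanishing of residues only the index k = s − n contributes
  -- from the sum, and its coefficient was defined to match the contribution of F.
  have key (n : ℕ) (hn : n ≤ s) : (φ * v ^ n * R).coeff n = 0 := by
    have h1 : (φ * v ^ n * (w ^ s * F)).coeff n = ((X * w) ^ (s - n) * (F * φ)).coeff s := by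
      have : φ * v ^ n * (w ^ s * F) = w ^ (s - n) * (F * φ) := by
        conv_lhs => rw [← Nat.sub_add_cancel hn, pow_add]
        linear_combination φ * F * w ^ (s - n) * hwv n
      rw [this, mul_pow, mul_assoc, mul_comm (X ^ _)]
      conv_rhs => rw [← Nat.add_sub_cancel' hn, Nat.add_sub_cancel_left, coeff_mul_X_pow]
    have h2 (k : ℕ) (hk : k ∈ Finset.range (s + 1)) :
        (φ * v ^ n * (C (((X * w) ^ k * (F * φ)).coeff s) * (X * w) ^ (s - k))).coeff n
          = if k = s - n then ((X * w) ^ k * (F * φ)).coeff s else 0 := by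
      have hks : k ≤ s := Finset.mem_range_succ_iff.mp hk
      generalize ((X * w) ^ k * (F * φ)).coeff s = c
      rw [mul_left_comm, coeff_C_mul, mul_pow,
        show φ * v ^ n * (X ^ (s - k) * w ^ (s - k)) = φ * v ^ n * w ^ (s - k) * X ^ (s - k) by
          ring]
      rcases lt_trichotomy n (s - k) with h | h | h
      · rw [if_neg (by lia), coeff_mul_X_pow', if_neg (by lia), mul_zero]
      · rw [if_pos (by lia), coeff_mul_X_pow', if_pos h.ge, ← h, Nat.sub_self, mul_assoc,
          mul_comm (v ^ n), hwv, mul_one, coeff_zero_eq_constantCoeff_apply, hφ0, mul_one]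
      · have : φ * v ^ n * w ^ (s - k) = φ * v ^ (n - (s - k)) := by
          conv_lhs => rw [← Nat.sub_add_cancel h.le, pow_add]
          linear_combination φ * v ^ (n - (s - k)) * hwv (s - k)
        rw [if_neg (by lia), coeff_mul_X_pow', if_pos h.le, this,
          coeff_mul_pow_eq_zero hv hφ (by lia), mul_zero]
    rw [hR, mul_sub, Finset.mul_sum, map_sub, map_sum, h1, Finset.sum_congr rfl h2,
      Finset.sum_ite_eq' , if_pos (Finset.mem_range_succ_iff.mpr (Nat.sub_le s n)), sub_self]
  -- The vanishing pairings form a triangular system with nonzero diagonal, since φ and v have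
  -- nonzero constant terms.
  have step (n : ℕ) (hn : n ≤ s + 1) : X ^ n ∣ R := by
    induction n with
    | zero => simp
    | succ n ih =>
      obtain ⟨Q, hQ⟩ := ih (by lia)
      have h := key n (by lia)
      rw [hQ, mul_left_comm, mul_comm, coeff_mul_X_pow', if_pos le_rfl, Nat.sub_self,
        coeff_zero_eq_constantCoeff_apply, map_mul, map_mul, map_pow, hφ0, one_mul] at h
      have hQ0 := (mul_eq_zero.mp h).resolve_left
        (pow_ne_zero _ (right_ne_zero_of_mul_eq_one hw0))
      obtain ⟨Q', rfl⟩ := X_dvd_iff.mpr hQ0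
      exact ⟨Q', by rw [hQ, pow_succ, mul_assoc]⟩
  exact step _ le_rfl

end LocalParameter

/-! ### The polynomials `A_m` as principal parts -/

/-- The series of `k`-th coefficients of a series with polynomial coefficients. -/
def coeffSeries (k : ℕ) : PowerSeries (Polynomial ℤ) →+ PowerSeries ℤ where
  toFun P := PowerSeries.mk fun m ↦ (P.coeff m).coeff k
  map_zero' := by ext; simp
  map_add' P Q := by ext; simp

lemma coeff_coeffSeries (k m : ℕ) (P : PowerSeries (Polynomial ℤ)) :
    (coeffSeries k P).coeff m = (P.coeff m).coeff k := by
  change (PowerSeries.mk fun m ↦ (P.coeff m).coeff k).coeff m = _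
  rw [PowerSeries.coeff_mk]

lemma coeffSeries_mul (k : ℕ) (P : PowerSeries (Polynomial ℤ)) (Q : PowerSeries ℤ) :
    coeffSeries k (P * HeckePartition.toPolyCoeff Q) = coeffSeries k P * Q := by
  ext m
  simp [coeff_coeffSeries, PowerSeries.coeff_mul, HeckePartition.toPolyCoeff]

lemma coeffSeries_toPolyCoeff (k : ℕ) (Q : PowerSeries ℤ) :
    coeffSeries k (HeckePartition.toPolyCoeff Q) = if k = 0 then Q else 0 := by
  ext m
  rw [coeff_coeffSeries, HeckePartition.toPolyCoeff, PowerSeries.coeff_map, Polynomial.coeff_C]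
  split_ifs <;> simp

lemma coeffSeries_C_X_mul (k : ℕ) (P : PowerSeries (Polynomial ℤ)) :
    coeffSeries k (PowerSeries.C (Polynomial.X : Polynomial ℤ) * P)
      = if k = 0 then 0 else coeffSeries (k - 1) P := by
  ext m
  rw [coeff_coeffSeries, PowerSeries.coeff_C_mul]
  cases k with
  | zero => simp
  | succ k => simp [coeff_coeffSeries]

/-- Comparing coefficients of xᵏ in the product with E₄³ − xΔ shows that they form a geometric
progression with ratio Δ/E₄³. -/
lemma coeffSeries_onoSeries (k : ℕ) :
    coeffSeries k HeckePartition.onoSeries * HeckePartition.qE4 ^ 3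
      = if k = 0 then HeckePartition.qEuler * HeckePartition.qE4 ^ 2 * HeckePartition.qE6
        else coeffSeries (k - 1) HeckePartition.onoSeries * HeckePartition.qDelta := by
  have h := congrArg (coeffSeries k) HeckePartition.onoSeries_mul_deltaMulJSub
  rw [HeckePartition.deltaMulJSub, mul_sub, map_sub, coeffSeries_mul, mul_left_comm,
    coeffSeries_C_X_mul, coeffSeries_toPolyCoeff] at h
  rw [sub_eq_iff_eq_add.mp h]
  split_ifs
  · rw [add_zero]
  · rw [coeffSeries_mul, zero_add]

lemma constantCoeff_qE4 : (complexify HeckePartition.qE4).constantCoeff = 1 := by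
  rw [← PowerSeries.coeff_zero_eq_constantCoeff_apply]
  simp [coeff_complexify, HeckePartition.qE4]

lemma constantCoeff_qEuler : (complexify HeckePartition.qEuler).constantCoeff = 1 := by
  have h := congrArg PowerSeries.constantCoeff (congrArg complexify qEuler_mul_partition)
  rw [map_mul, map_one, map_mul, map_one,
    ← PowerSeries.coeff_zero_eq_constantCoeff_apply (complexify (PowerSeries.mk _)),
    coeff_complexify, PowerSeries.coeff_mk] at h
  simpa using h

/-- The defining property of the polynomial `A_s`: it gives the principal part of
`∏ (1 - qⁿ) / qˢ` as a polynomial in `j`. -/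
theorem X_pow_dvd_sub_A (s : ℕ) :
    PowerSeries.X ^ (s + 1) ∣
      (complexify HeckePartition.qEuler ^ 24) ^ s * complexify HeckePartition.qEuler
      - ∑ k ∈ Finset.range (s + 1), PowerSeries.C (((HeckePartition.A s).coeff k : ℤ) : ℂ) *
        (complexify HeckePartition.qE4 ^ (3 * k) * complexify HeckePartition.qDelta ^ (s - k)) := by
  set E := complexify HeckePartition.qEuler
  set Q := complexify HeckePartition.qE4
  set T := complexify HeckePartition.qE6
  have hΔ : complexify HeckePartition.qDelta = PowerSeries.X * E ^ 24 := complexify_qDelta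
  set e := Q⁻¹
  have he : Q * e = 1 := PowerSeries.mul_inv_cancel _ (by rw [constantCoeff_qE4]; exact one_ne_zero)
  have hE : E * E⁻¹ = 1 :=
    PowerSeries.mul_inv_cancel _ (by rw [constantCoeff_qEuler]; exact one_ne_zero)
  have hθΔ : E ^ 24 + PowerSeries.X * PowerSeries.derivative ℂ (E ^ 24) = qE2 * E ^ 24 := by
    have h := X_mul_derivative_qDelta
    rw [hΔ, Derivation.leibniz, PowerSeries.derivative_X] at h
    simp only [smul_eq_mul, mul_one] at h
    refine mul_left_cancel₀ (PowerSeries.X_ne_zero (R := ℂ)) ?_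
    linear_combination h
  have hθQ : 3 * (PowerSeries.X * PowerSeries.derivative ℂ Q) = qE2 * Q - T := by
    have h := X_mul_derivative_qE4
    rwa [map_ofNat] at h
  have he' : PowerSeries.derivative ℂ e = -e ^ 2 * PowerSeries.derivative ℂ Q :=
    PowerSeries.derivative_inv' _
  -- The local parameter is t = 1/j = Δ/E₄³. Its logarithmic derivative is E₂ − (E₂ − E₆/E₄) =
  -- E₆/E₄, which explains the factor E₄²E₆ in the generating function.
  have hφ : T * e * (E ^ 24 * e ^ 3) = E ^ 24 * e ^ 3
      + PowerSeries.X * PowerSeries.derivative ℂ (E ^ 24 * e ^ 3) := by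
    rw [Derivation.leibniz, PowerSeries.derivative_pow e, he', smul_eq_mul, smul_eq_mul]
    push_cast
    linear_combination -e ^ 3 * hθΔ + E ^ 24 * e ^ 4 * hθQ + qE2 * E ^ 24 * e ^ 3 * he
  have hv : E ^ 24 * e ^ 3 * (E⁻¹ ^ 24 * Q ^ 3) = 1 := by
    calc _ = (E * E⁻¹) ^ 24 * (Q * e) ^ 3 := by ring
      _ = 1 := by rw [hE, he]; ring
  have he3 : Q ^ 3 * e ^ 3 = 1 := by rw [← mul_pow, he, one_pow]
  have he2 : Q ^ 2 * e ^ 2 = 1 := by rw [← mul_pow, he, one_pow]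
  have hB (k : ℕ) : complexify (coeffSeries k HeckePartition.onoSeries)
      = (PowerSeries.X * (E ^ 24 * e ^ 3)) ^ k * (E * (T * e)) := by
    induction k with
    | zero =>
      have h := congrArg complexify (coeffSeries_onoSeries 0)
      rw [if_pos rfl] at h
      simp only [map_mul, map_pow] at h
      rw [pow_zero, one_mul]
      linear_combination e ^ 3 * h
        - complexify (coeffSeries 0 HeckePartition.onoSeries) * he3 + E * T * e * he2
    | succ k ih =>
      have h := congrArg complexify (coeffSeries_onoSeries (k + 1))
      rw [if_neg (Nat.succ_ne_zero k), Nat.add_sub_cancel] at h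
      simp only [map_mul, map_pow] at h
      rw [ih, hΔ] at h
      rw [pow_succ]
      linear_combination e ^ 3 * h
        - complexify (coeffSeries (k + 1) HeckePartition.onoSeries) * he3
  obtain ⟨U, hU⟩ := X_pow_dvd_sub_principal_part E s hv hφ
  -- Multiplying by E₄^(3s) clears the denominators of the powers of 1/j.
  refine ⟨Q ^ (3 * s) * U, ?_⟩
  rw [mul_left_comm, ← hU, mul_sub, Finset.mul_sum]
  have hQe (n : ℕ) : Q ^ (3 * n) * (e ^ 3) ^ n = 1 := by
    rw [← pow_mul, ← mul_pow, he, one_pow]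
  congr 1
  · rw [mul_pow (E ^ 24)]
    linear_combination -(E ^ 24) ^ s * E * hQe s
  · refine Finset.sum_congr rfl fun k hk ↦ ?_
    have hks : k ≤ s := Finset.mem_range_succ_iff.mp hk
    rw [← hB k, coeff_complexify, coeff_coeffSeries, ← HeckePartition.A, hΔ]
    have h3 : Q ^ (3 * s) = Q ^ (3 * k) * Q ^ (3 * (s - k)) := by
      rw [← pow_add]; congr 1; lia
    rw [h3, ← mul_assoc PowerSeries.X, mul_pow _ (e ^ 3)]
    linear_combination -PowerSeries.C (((HeckePartition.A s).coeff k : ℤ) : ℂ) * Q ^ (3 * k) *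
      (PowerSeries.X * E ^ 24) ^ (s - k) * hQe (s - k)
end
end HeckeEta

namespace HeckeEta
open Complex hiding eta
open ModularForm

noncomputable section

open UpperHalfPlane (atImInfty IsBoundedAtImInfty ofComplex)
open UpperHalfPlane hiding I
open scoped Derivative Manifold Topology MatrixGroups
open Filter

/-! ### Coefficients -/

lemma p_intCast_div (m : ℤ) {k : ℤ} (hk : HeckePartition.p (((m : ℚ) + 1) / 24) = k) (h0 : k ≠ 0) :
    ∃ n : ℕ, m = 24 * n - 1 := by
  rw [HeckePartition.p] at hk
  split_ifs at hk with h
  · obtain ⟨hden, hpos⟩ := h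
    have h1 : ((((m : ℚ) + 1) / 24).num : ℚ) = ((m : ℚ) + 1) / 24 := by
      conv_rhs => rw [← Rat.num_div_den (((m : ℚ) + 1) / 24), hden]
      simp
    have h2 : m + 1 = 24 * (((m : ℚ) + 1) / 24).num := by
      have : (m : ℚ) + 1 = 24 * ((((m : ℚ) + 1) / 24).num : ℚ) := by rw [h1]; ring
      exact_mod_cast this
    have h3 : 0 ≤ (((m : ℚ) + 1) / 24).num := Rat.num_nonneg.mpr hpos
    exact ⟨(((m : ℚ) + 1) / 24).num.toNat, by lia⟩
  · exact absurd hk.symm h0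

/-- The coefficient of `e(mz/24)` in `1 / η`. -/
def partCoeff (m : ℤ) : ℂ := HeckePartition.p (((m : ℚ) + 1) / 24)

lemma exists_of_partCoeff_ne_zero {m : ℤ} (h : partCoeff m ≠ 0) : ∃ n : ℕ, m = 24 * n - 1 :=
  p_intCast_div m rfl fun h0 ↦ h (by rw [partCoeff, h0, Int.cast_zero])

lemma partCoeff_natCast (n : ℕ) : partCoeff (24 * n - 1) = Fintype.card (Nat.Partition n) := by
  have h : (((24 * n - 1 : ℤ) : ℚ) + 1) / 24 = n := by push_cast; ring
  rw [partCoeff, h, HeckePartition.p, if_pos ⟨Rat.den_natCast n, Nat.cast_nonneg n⟩,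
    Rat.num_natCast, Int.toNat_natCast, Int.cast_natCast]

lemma partCoeff_neg_one : partCoeff (-1) = 1 := by simpa using partCoeff_natCast 0

lemma partCoeff_of_lt {m : ℤ} (h : m < -1) : partCoeff m = 0 := by
  by_contra h0
  obtain ⟨n, hn⟩ := exists_of_partCoeff_ne_zero h0
  lia

lemma hasExp_etaInv : HasExp partCoeff etaInv := by
  have h := hasQExp_inv_eulerProd.hasExp (G := etaInv) (-1) fun τ ↦ by
    rw [etaInv, eta_eq_qe_mul_eulerProd, mul_inv]
    congr 1
    rw [eq_comm]
    exact eq_inv_of_mul_eq_one_left (by rw [← qe_add_left, neg_add_cancel, qe_zero_left])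
  convert h using 1
  ext m
  by_cases hm : ∃ n : ℕ, 24 * (n : ℤ) + -1 = m
  · obtain ⟨n, rfl⟩ := hm
    rw [shiftCoeff_apply, coeff_complexify, PowerSeries.coeff_mk, ← sub_eq_add_neg,
      partCoeff_natCast, Int.cast_natCast]
  · rw [shiftCoeff, Function.extend_apply' _ _ _ hm, Pi.zero_apply]
    by_contra h0
    obtain ⟨n, hn⟩ := exists_of_partCoeff_ne_zero h0
    exact hm ⟨n, by lia⟩

lemma sq_eq_twentyFour_mul {ℓ : ℕ} (h2 : ¬ 2 ∣ ℓ) (h3 : ¬ 3 ∣ ℓ) : ℓ ^ 2 = 24 * HeckePartition.s ℓ + 1 := by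
  have h8 : ℓ ^ 2 % 8 = 1 := by
    rw [Nat.pow_mod]
    have : ℓ % 8 = 1 ∨ ℓ % 8 = 3 ∨ ℓ % 8 = 5 ∨ ℓ % 8 = 7 := by lia
    rcases this with h | h | h | h <;> rw [h]
  have h3' : ℓ ^ 2 % 3 = 1 := by
    rw [Nat.pow_mod]
    have : ℓ % 3 = 1 ∨ ℓ % 3 = 2 := by lia
    rcases this with h | h <;> rw [h]
  rw [HeckePartition.s]
  lia

variable {ℓ : ℕ} [Fact ℓ.Prime]

/-- The coefficient of `e(mz/24)` in `heckeInv ℓ`. -/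
def heckeCoeff (ℓ : ℕ) [Fact ℓ.Prime] (m : ℤ) : ℂ :=
  ℓ ^ 3 * partCoeff ((ℓ ^ 2 : ℕ) * m)
    + ℓ * HeckePartition.chi12 ℓ * legendreSym ℓ (-m) * partCoeff m
    + if ((ℓ ^ 2 : ℕ) : ℤ) ∣ m then partCoeff (m / (ℓ ^ 2 : ℕ)) else 0

lemma hasExp_heckeInv (h2 : ¬ 2 ∣ ℓ) : HasExp (heckeCoeff ℓ) (heckeInv ℓ) := by
  have hℓ : ℓ ≠ 2 := by rintro rfl; simp at h2
  have h := (((hasExp_etaInv.sum_shift (N := ℓ ^ 2)).const_mul ℓ).add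
    ((hasExp_etaInv.twist hℓ).const_mul (HeckePartition.chi12 ℓ * quadGauss ℓ))).add
    (hasExp_etaInv.comp_mul (N := ℓ ^ 2))
  have e : heckeCoeff ℓ = fun m ↦ ℓ * (((ℓ ^ 2 : ℕ) : ℂ) * partCoeff ((ℓ ^ 2 : ℕ) * m))
      + HeckePartition.chi12 ℓ * quadGauss ℓ * (quadGauss ℓ * (quadChar ℓ m * partCoeff m))
      + if ((ℓ ^ 2 : ℕ) : ℤ) ∣ m then partCoeff (m / (ℓ ^ 2 : ℕ)) else 0 := by
    ext m
    have hg := quadGauss_sq hℓ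
    have hc : (legendreSym ℓ (-m) : ℂ) = quadChar ℓ (-1) * quadChar ℓ m := by
      rw [← quadChar_intCast, ← map_mul]; push_cast; rw [neg_one_mul]
    rw [heckeCoeff, hc]
    push_cast
    linear_combination -(HeckePartition.chi12 ℓ : ℂ) * quadChar ℓ m * partCoeff m * hg
  rw [e]
  exact h

lemma s_pos (h2 : ¬ 2 ∣ ℓ) (h3 : ¬ 3 ∣ ℓ) : 0 < HeckePartition.s ℓ := by
  have hs := sq_eq_twentyFour_mul h2 h3
  have hp : 1 < ℓ ^ 2 := Nat.one_lt_pow two_ne_zero (Nat.Prime.one_lt Fact.out)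
  lia

/-- Since ℓ² ≡ 1 mod 24, all three terms live on exponents ≡ −1 mod 24. The lowest possible one is
−ℓ², from 1/η(ℓ²z). -/
lemma exists_of_heckeCoeff_ne_zero (h2 : ¬ 2 ∣ ℓ) (h3 : ¬ 3 ∣ ℓ) {m : ℤ} (h : heckeCoeff ℓ m ≠ 0) :
    ∃ n : ℕ, m = 24 * n + -((ℓ ^ 2 : ℕ) : ℤ) := by
  have hs := sq_eq_twentyFour_mul h2 h3
  have hs0 := s_pos h2 h3
  rw [heckeCoeff] at h
  generalize HeckePartition.s ℓ = s at hs hs0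
  rw [hs] at h ⊢
  by_cases h1 : partCoeff ((24 * s + 1 : ℕ) * m) = 0
  · by_cases h4 : partCoeff m = 0
    · rw [h1, h4, mul_zero, mul_zero, zero_add, zero_add] at h
      split_ifs at h with hd
      · obtain ⟨k, rfl⟩ := hd
        rw [Int.mul_ediv_cancel_left _ (by lia)] at h
        obtain ⟨n, rfl⟩ := exists_of_partCoeff_ne_zero h
        exact ⟨n * (24 * s + 1), by push_cast; ring⟩
      · exact absurd rfl h
    · obtain ⟨n, rfl⟩ := exists_of_partCoeff_ne_zero h4
      exact ⟨n + s, by push_cast; ring⟩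
  · obtain ⟨n, hn⟩ := exists_of_partCoeff_ne_zero h1
    have hm : 0 ≤ m := by
      by_contra hm
      have : ((24 * s + 1 : ℕ) : ℤ) * m ≤ ((24 * s + 1 : ℕ) : ℤ) * (-1) :=
        mul_le_mul_of_nonneg_left (by lia) (Int.natCast_nonneg _)
      lia
    push_cast at hn
    refine ⟨(n - s * m + s : ℤ).toNat, ?_⟩
    have h0 : m = 24 * (n - s * m) - 1 := by linarith
    have : 0 ≤ (n - s * m : ℤ) := by lia
    rw [Int.toNat_of_nonneg (by lia)]
    push_cast
    linarith

/-- Up to exponent −1 only two terms survive: the leading coefficient of 1/η(ℓ²z) and that of the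
twist, with symbol (1/ℓ) = 1. The latter is the constant ℓχ₁₂(ℓ) added to A_s in C_ℓ. -/
lemma heckeCoeff_of_le (h2 : ¬ 2 ∣ ℓ) (h3 : ¬ 3 ∣ ℓ) {n : ℕ} (hn : n ≤ HeckePartition.s ℓ) :
    heckeCoeff ℓ (24 * n + -((ℓ ^ 2 : ℕ) : ℤ)) = (if n = 0 then 1 else 0)
      + if n = HeckePartition.s ℓ then (ℓ * HeckePartition.chi12 ℓ : ℂ) else 0 := by
  have hs := sq_eq_twentyFour_mul h2 h3
  have hs0 := s_pos h2 h3
  rw [heckeCoeff]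
  generalize HeckePartition.s ℓ = s at *
  have h1 : partCoeff ((ℓ ^ 2 : ℕ) * (24 * n + -((ℓ ^ 2 : ℕ) : ℤ))) = 0 := by
    refine partCoeff_of_lt ?_
    have : ((ℓ ^ 2 : ℕ) : ℤ) * (24 * n + -((ℓ ^ 2 : ℕ) : ℤ)) ≤ ((ℓ ^ 2 : ℕ) : ℤ) * (-1) :=
      mul_le_mul_of_nonneg_left (by lia) (Int.natCast_nonneg _)
    lia
  have h4 : (ℓ * HeckePartition.chi12 ℓ * legendreSym ℓ (-(24 * n + -((ℓ ^ 2 : ℕ) : ℤ))) *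
      partCoeff (24 * n + -((ℓ ^ 2 : ℕ) : ℤ)) : ℂ)
      = if n = s then (ℓ * HeckePartition.chi12 ℓ : ℂ) else 0 := by
    split_ifs with h
    · have : (24 * n + -((ℓ ^ 2 : ℕ) : ℤ)) = -1 := by lia
      rw [this, partCoeff_neg_one, neg_neg, legendreSym.at_one]
      simp
    · rw [partCoeff_of_lt (by lia), mul_zero]
  have h5 : (if ((ℓ ^ 2 : ℕ) : ℤ) ∣ 24 * n + -((ℓ ^ 2 : ℕ) : ℤ)
      then partCoeff ((24 * n + -((ℓ ^ 2 : ℕ) : ℤ)) / (ℓ ^ 2 : ℕ)) else 0)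
      = if n = 0 then 1 else 0 := by
    by_cases h : n = 0
    · subst h
      have : (24 * ((0 : ℕ) : ℤ) + -((ℓ ^ 2 : ℕ) : ℤ)) = ((ℓ ^ 2 : ℕ) : ℤ) * (-1) := by
        push_cast; ring
      rw [this, if_pos (dvd_mul_right _ _), Int.mul_ediv_cancel_left _ (by lia), partCoeff_neg_one,
        if_pos rfl]
    · rw [if_neg h, if_neg]
      intro hd
      have := Int.le_of_dvd (by lia) ((Int.dvd_neg).mpr hd)
      lia
  rw [h1, h4, h5]
  ring

lemma X_pow_dvd_mk_heckeCoeff (h2 : ¬ 2 ∣ ℓ) (h3 : ¬ 3 ∣ ℓ) :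
    PowerSeries.X ^ (HeckePartition.s ℓ + 1) ∣
      PowerSeries.mk (fun n : ℕ ↦ heckeCoeff ℓ (24 * n + -((ℓ ^ 2 : ℕ) : ℤ)))
        - (1 + PowerSeries.C (ℓ * HeckePartition.chi12 ℓ : ℂ) *
          PowerSeries.X ^ HeckePartition.s ℓ) := by
  rw [PowerSeries.X_pow_dvd_iff]
  intro n hn
  rw [map_sub, map_add, PowerSeries.coeff_mk, heckeCoeff_of_le h2 h3 (Nat.lt_succ_iff.mp hn),
    PowerSeries.coeff_one, PowerSeries.coeff_C_mul, PowerSeries.coeff_X_pow]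
  split_ifs <;> ring

/-- The expansion of the Hecke image of `1 / η`. -/
lemma hasQExp_heckeInv (h2 : ¬ 2 ∣ ℓ) (h3 : ¬ 3 ∣ ℓ) :
    HasQExp (PowerSeries.mk fun n : ℕ ↦ heckeCoeff ℓ (24 * n + -((ℓ ^ 2 : ℕ) : ℤ)))
      (fun τ ↦ qe (ℓ ^ 2 : ℕ) τ * heckeInv ℓ τ) := by
  have h := (hasExp_heckeInv h2).hasQExp (-((ℓ ^ 2 : ℕ) : ℤ))
    fun m hm ↦ exists_of_heckeCoeff_ne_zero h2 h3 hm
  simpa only [neg_neg] using h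

/-! ### The Hecke image in terms of `j` -/

/-- The polynomial `C_ℓ(j)` multiplied by `Δˢ`. -/
def heckePoly (ℓ : ℕ) (τ : ℍ) : ℂ :=
  ∑ k ∈ Finset.range (HeckePartition.s ℓ + 1), (HeckePartition.c k ℓ : ℂ) *
    (E₄ τ ^ (3 * k) * discriminant τ ^ (HeckePartition.s ℓ - k))

lemma hasQExp_heckePoly {ℓ : ℕ} : HasQExp (∑ k ∈ Finset.range (HeckePartition.s ℓ + 1),
    PowerSeries.C (HeckePartition.c k ℓ : ℂ) * (complexify HeckePartition.qE4 ^ (3 * k) *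
      complexify HeckePartition.qDelta ^ (HeckePartition.s ℓ - k))) (heckePoly ℓ) :=
  HasQExp.sum fun _ _ ↦ ((hasQExp_E₄.pow _).mul (hasQExp_discriminant.pow _)).C_mul _

lemma c_eq {ℓ : ℕ} (k : ℕ) : HeckePartition.c k ℓ
    = (if k = 0 then (ℓ : ℤ) * HeckePartition.chi12 ℓ else 0)
      + (HeckePartition.A (HeckePartition.s ℓ)).coeff k := by
  rw [HeckePartition.c, HeckePartition.C, Polynomial.coeff_add, Polynomial.coeff_C]

lemma sum_c_eq {ℓ : ℕ} : ∑ k ∈ Finset.range (HeckePartition.s ℓ + 1),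
    PowerSeries.C (HeckePartition.c k ℓ : ℂ) * (complexify HeckePartition.qE4 ^ (3 * k) *
      complexify HeckePartition.qDelta ^ (HeckePartition.s ℓ - k))
    = PowerSeries.C (ℓ * HeckePartition.chi12 ℓ : ℂ) * complexify HeckePartition.qDelta ^
      HeckePartition.s ℓ + ∑ k ∈ Finset.range (HeckePartition.s ℓ + 1),
      PowerSeries.C (((HeckePartition.A (HeckePartition.s ℓ)).coeff k : ℤ) : ℂ) *
        (complexify HeckePartition.qE4 ^ (3 * k) *
          complexify HeckePartition.qDelta ^ (HeckePartition.s ℓ - k)) := by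
  have h : PowerSeries.C (ℓ * HeckePartition.chi12 ℓ : ℂ) * complexify HeckePartition.qDelta ^
      HeckePartition.s ℓ = ∑ k ∈ Finset.range (HeckePartition.s ℓ + 1),
      (if k = 0 then PowerSeries.C (ℓ * HeckePartition.chi12 ℓ : ℂ) else 0) *
        (complexify HeckePartition.qE4 ^ (3 * k) *
          complexify HeckePartition.qDelta ^ (HeckePartition.s ℓ - k)) := by
    simp [ite_mul, Finset.sum_ite_eq']
  rw [h, ← Finset.sum_add_distrib]
  refine Finset.sum_congr rfl fun k _ ↦ ?_
  rw [← add_mul, c_eq]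
  congr 1
  split_ifs
  · rw [← map_add]; congr 1; push_cast; ring
  · rw [zero_add, zero_add]

lemma X_pow_dvd_heckePoly (h2 : ¬ 2 ∣ ℓ) (h3 : ¬ 3 ∣ ℓ) :
    PowerSeries.X ^ (HeckePartition.s ℓ + 1) ∣
      (complexify HeckePartition.qEuler ^ 24) ^ HeckePartition.s ℓ *
        complexify HeckePartition.qEuler *
        PowerSeries.mk (fun n : ℕ ↦ heckeCoeff ℓ (24 * n + -((ℓ ^ 2 : ℕ) : ℤ)))
      - ∑ k ∈ Finset.range (HeckePartition.s ℓ + 1),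
        PowerSeries.C (HeckePartition.c k ℓ : ℂ) * (complexify HeckePartition.qE4 ^ (3 * k) *
          complexify HeckePartition.qDelta ^ (HeckePartition.s ℓ - k)) := by
  obtain ⟨U, hU⟩ := X_pow_dvd_mk_heckeCoeff h2 h3
  obtain ⟨V, hV⟩ := X_pow_dvd_sub_A (HeckePartition.s ℓ)
  -- The extra term already carries q^s, so modulo q^(s+1) the remaining Euler product may be
  -- replaced by 1.
  obtain ⟨W, hW⟩ := PowerSeries.X_dvd_iff.mpr
    (show (complexify HeckePartition.qEuler - 1).constantCoeff = 0 by
      rw [map_sub, constantCoeff_qEuler, map_one, sub_self])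
  rw [sum_c_eq, sub_eq_iff_eq_add.mp hU]
  rw [sub_eq_iff_eq_add] at hV
  have hD : complexify HeckePartition.qDelta ^ HeckePartition.s ℓ
      = PowerSeries.X ^ HeckePartition.s ℓ *
        (complexify HeckePartition.qEuler ^ 24) ^ HeckePartition.s ℓ := by
    rw [complexify_qDelta, mul_pow]
  generalize ∑ k ∈ Finset.range (HeckePartition.s ℓ + 1),
      PowerSeries.C (((HeckePartition.A (HeckePartition.s ℓ)).coeff k : ℤ) : ℂ) *
        (complexify HeckePartition.qE4 ^ (3 * k) *
          complexify HeckePartition.qDelta ^ (HeckePartition.s ℓ - k)) = T at *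
  rw [hD]
  generalize complexify HeckePartition.qEuler = E at *
  generalize PowerSeries.C (ℓ * HeckePartition.chi12 ℓ : ℂ) = c at *
  refine ⟨(E ^ 24) ^ HeckePartition.s ℓ * E * U + V + c * (E ^ 24) ^ HeckePartition.s ℓ * W, ?_⟩
  rw [pow_succ] at hV ⊢
  linear_combination hV + c * PowerSeries.X ^ HeckePartition.s ℓ *
    (E ^ 24) ^ HeckePartition.s ℓ * hW
end
end HeckeEta

namespace HeckeEta
open Complex hiding eta
open ModularForm

noncomputable section

open UpperHalfPlane (atImInfty IsBoundedAtImInfty ofComplex)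
open UpperHalfPlane hiding I
open scoped Derivative Manifold Topology MatrixGroups
open Filter

variable {ℓ : ℕ} [Fact ℓ.Prime]

/-! ### Identification of the Hecke image with C_ℓ(j)/η -/

lemma coe_S_smul (τ : ℍ) : ((.mk _ τ.im_inv_neg_coe_pos : ℍ) : ℂ) = -1 / τ := by
  change (-(τ : ℂ))⁻¹ = -1 / τ
  rw [inv_neg, neg_div, one_div]

lemma E₄_S_smul (τ : ℍ) : E₄ (.mk _ τ.im_inv_neg_coe_pos) = (τ : ℂ) ^ 4 * E₄ τ := by
  have h := congrFun (E₄_slash ModularGroup.S) τ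
  rw [SlashInvariantForm.slash_S_apply] at h
  have := τ.ne_zero
  rw [← h, zpow_neg, mul_comm, mul_assoc, ← zpow_natCast]
  push_cast
  rw [inv_mul_cancel₀ (zpow_ne_zero _ this), mul_one]

lemma discriminant_S_smul (τ : ℍ) :
    discriminant (.mk _ τ.im_inv_neg_coe_pos) = (τ : ℂ) ^ 12 * discriminant τ := by
  have h := congrFun discriminant_S_invariant τ
  rw [SlashInvariantForm.slash_S_apply] at h
  have := τ.ne_zero
  rw [← h, zpow_neg, mul_comm, mul_assoc, ← zpow_natCast]
  push_cast
  rw [inv_mul_cancel₀ (zpow_ne_zero _ this), mul_one]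

lemma heckePoly_S_smul {ℓ : ℕ} (τ : ℍ) : heckePoly ℓ (.mk _ τ.im_inv_neg_coe_pos)
    = ((τ : ℂ) ^ 12) ^ HeckePartition.s ℓ * heckePoly ℓ τ := by
  rw [heckePoly, heckePoly, Finset.mul_sum]
  refine Finset.sum_congr rfl fun k hk ↦ ?_
  have hks : k ≤ HeckePartition.s ℓ := Finset.mem_range_succ_iff.mp hk
  have h : ((τ : ℂ) ^ 12) ^ HeckePartition.s ℓ
      = ((τ : ℂ) ^ 4) ^ (3 * k) * ((τ : ℂ) ^ 12) ^ (HeckePartition.s ℓ - k) := by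
    rw [← pow_mul, ← pow_mul, ← pow_mul, ← pow_add]
    congr 1
    lia
  rw [E₄_S_smul, discriminant_S_smul, mul_pow, mul_pow, h]
  ring

lemma eta_mul_heckeInv_S_smul (h2 : ¬ 2 ∣ ℓ) (h3 : ¬ 3 ∣ ℓ) (τ : ℍ) :
    eta (-1 / τ) * heckeInv ℓ (-1 / τ) = eta τ * heckeInv ℓ τ := by
  have hv := mul_ne_zero (zpow_ne_zero (-3) zeta24_ne_zero) (sqrt_ne_zero τ.ne_zero)
  rw [eta_neg_one_div τ.im_pos, heckeInv_neg_one_div h2 h3 τ.im_pos, mul_mul_mul_comm,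
    mul_inv_cancel₀ hv, one_mul]

/-- The Hecke image of `1 / η` is `C_ℓ(j) / η`. -/
theorem discriminant_pow_mul_heckeInv (h2 : ¬ 2 ∣ ℓ) (h3 : ¬ 3 ∣ ℓ) (τ : ℍ) :
    discriminant τ ^ HeckePartition.s ℓ * (eta τ * heckeInv ℓ τ) = heckePoly ℓ τ := by
  obtain ⟨U, hU⟩ := X_pow_dvd_heckePoly h2 h3
  have hs := sq_eq_twentyFour_mul h2 h3
  have h1 := (((hasQExp_eulerProd.pow 24).pow (HeckePartition.s ℓ)).mul hasQExp_eulerProd).mul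
    (hasQExp_heckeInv h2 h3)
  have h2' := h1.sub (hasQExp_heckePoly (ℓ := ℓ))
  rw [hU, pow_succ, mul_assoc] at h2'
  have hE0 : (((complexify HeckePartition.qEuler) ^ 24) ^
      HeckePartition.s ℓ).constantCoeff ≠ 0 := by
    rw [map_pow, map_pow, constantCoeff_qEuler, one_pow, one_pow]
    exact one_ne_zero
  have h4 := h2'.of_X_pow_mul.mul (((hasQExp_eulerProd.pow 24).pow (HeckePartition.s ℓ)).inv
    (PowerSeries.mul_inv_cancel _ hE0)
    fun τ ↦ pow_ne_zero _ (pow_ne_zero _ (eulerProd_ne_zero τ)))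
  -- Dividing by q^s and by the Euler product to the power 24s is division by Δ^s. One power of q is
  -- left over, so the constant term of this weight-0 function is 0.
  have h5 := h4.congr (G := fun τ : ℍ ↦ eta τ * heckeInv ℓ τ
      - heckePoly ℓ τ / discriminant τ ^ HeckePartition.s ℓ) fun τ ↦ by
    have hq := Complex.exp_ne_zero (2 * Real.pi * I * τ)
    have he := eulerProd_ne_zero τ
    have hqe : qe (ℓ ^ 2 : ℕ) τ = qe 1 τ * cexp (2 * Real.pi * I * τ) ^ HeckePartition.s ℓ := by
      rw [← qe_natCast_mul, ← qe_add_left, hs]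
      congr 1
      push_cast
      ring
    rw [hqe, discriminant_eq_exp_mul, eta_eq_qe_mul_eulerProd, mul_pow]
    field_simp
  have h6 := h5.eq_const (by
    ext τ
    have hz := pow_ne_zero (HeckePartition.s ℓ) (pow_ne_zero 12 τ.ne_zero)
    rw [SlashInvariantForm.slash_S_apply, neg_zero, zpow_zero, mul_one, heckePoly_S_smul,
      discriminant_S_smul, coe_S_smul, eta_mul_heckeInv_S_smul h2 h3, mul_pow,
      mul_div_mul_left _ _ hz]) τ
  have h7 : (PowerSeries.X * U * ((complexify HeckePartition.qEuler ^ 24) ^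
      HeckePartition.s ℓ)⁻¹).coeff 0 = 0 := by
    rw [PowerSeries.coeff_zero_eq_constantCoeff_apply, map_mul, map_mul,
      PowerSeries.constantCoeff_X, zero_mul, zero_mul]
  rw [h7, sub_eq_zero, eq_div_iff (pow_ne_zero _ (discriminant_ne_zero τ))] at h6
  rw [mul_comm, h6]

/-! ### Differentiation -/

/-- The truncated exponent n − 1 is harmless at n = 0 because of the factor n. -/
lemma natCast_mul_pow_pred_mul (n : ℕ) (x : ℂ) : (n : ℂ) * x ^ (n - 1) * x = n * x ^ n := by
  cases n with
  | zero => simp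
  | succ n => rw [Nat.add_sub_cancel, pow_succ]; ring

lemma hasDerivAt_E₄_pow_mul_discriminant_pow (τ : ℍ) {k s : ℕ} (hk : k ≤ s) :
    HasDerivAt (fun z : ℂ ↦ E₄ (ofComplex z) ^ (3 * k) * discriminant (ofComplex z) ^ (s - k))
      (2 * Real.pi * I * (discriminant τ ^ (s - k) *
        (s * EisensteinSeries.E2 τ * E₄ τ ^ (3 * k) - k * E₄ τ ^ (3 * k - 1) * E₆ τ))) τ := by
  have h := ((hasDerivAt_E₄ τ).pow (3 * k)).mul ((hasDerivAt_discriminant τ).pow (s - k))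
  refine h.congr_deriv ?_
  have h1 := natCast_mul_pow_pred_mul (3 * k) (E₄ τ)
  have h2 := natCast_mul_pow_pred_mul (s - k) (discriminant τ)
  simp only [Pi.pow_apply, Function.comp_apply, ofComplex_apply]
  rw [Nat.cast_sub hk] at h2 ⊢
  push_cast at h1 ⊢
  generalize E₄ τ ^ (3 * k - 1) = x at *
  generalize E₄ τ ^ (3 * k) = x' at *
  generalize discriminant τ ^ (s - k - 1) = y at *
  generalize discriminant τ ^ (s - k) = y' at *
  linear_combination 2 * Real.pi * I * EisensteinSeries.E2 τ * (y' / 3 * h1 + x' * h2)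

lemma hasDerivAt_heckePoly {ℓ : ℕ} (τ : ℍ) : HasDerivAt (fun z : ℂ ↦ heckePoly ℓ (ofComplex z))
    (2 * Real.pi * I * (HeckePartition.s ℓ * EisensteinSeries.E2 τ * heckePoly ℓ τ
      - ∑ k ∈ Finset.range (HeckePartition.s ℓ + 1), (HeckePartition.c k ℓ : ℂ) *
        (k * E₄ τ ^ (3 * k - 1) * E₆ τ * discriminant τ ^ (HeckePartition.s ℓ - k)))) τ := by
  have h := HasDerivAt.fun_sum (u := Finset.range (HeckePartition.s ℓ + 1)) fun k hk ↦
    (hasDerivAt_E₄_pow_mul_discriminant_pow τ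
      (Finset.mem_range_succ_iff.mp hk)).const_mul (HeckePartition.c k ℓ : ℂ)
  refine HasDerivAt.congr_deriv (f := fun z ↦ heckePoly ℓ (ofComplex z))
    (by simpa only [heckePoly, mul_assoc] using h) ?_
  rw [heckePoly, Finset.mul_sum, ← Finset.sum_sub_distrib, Finset.mul_sum]
  exact Finset.sum_congr rfl fun k _ ↦ by ring

/-- The differentiated form of the identity between the Hecke image and `C_ℓ(j) / η`. -/
theorem deriv_heckeInv (h2 : ¬ 2 ∣ ℓ) (h3 : ¬ 3 ∣ ℓ) (τ : ℍ) :
    24 * ((2 * Real.pi * I)⁻¹ * deriv (heckeInv ℓ) τ) * eta τ *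
      discriminant τ ^ HeckePartition.s ℓ
    = - ∑ k ∈ Finset.range (HeckePartition.s ℓ + 1), (HeckePartition.c k ℓ : ℂ) *
        discriminant τ ^ (HeckePartition.s ℓ - k) *
          (24 * (k : ℂ) * E₄ τ ^ (3 * k - 1) * E₆ τ
            + E₄ τ ^ (3 * k) * EisensteinSeries.E2 τ) := by
  have hH := ((hasExp_heckeInv h2).differentiableAt τ.im_pos).hasDerivAt
  have h := ((hasDerivAt_discriminant τ).pow (HeckePartition.s ℓ)).mul ((hasDerivAt_eta τ).mul hH)
  have e : (fun z : ℂ ↦ heckePoly ℓ (ofComplex z)) =ᶠ[𝓝 (τ : ℂ)]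
      (discriminant ∘ ofComplex) ^ HeckePartition.s ℓ * (eta * heckeInv ℓ) := by
    filter_upwards [isOpen_upperHalfPlaneSet.mem_nhds τ.im_pos] with z hz
    have := discriminant_pow_mul_heckeInv h2 h3 (ofComplex z)
    rw [← this]
    simp [ofComplex_apply_of_im_pos hz]
  have hu := (h.congr_of_eventuallyEq e).unique (hasDerivAt_heckePoly τ)
  have hd := natCast_mul_pow_pred_mul (HeckePartition.s ℓ) (discriminant τ)
  have hP := discriminant_pow_mul_heckeInv h2 h3 τ
  have hsum : ∑ k ∈ Finset.range (HeckePartition.s ℓ + 1), (HeckePartition.c k ℓ : ℂ) *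
        discriminant τ ^ (HeckePartition.s ℓ - k) *
          (24 * (k : ℂ) * E₄ τ ^ (3 * k - 1) * E₆ τ + E₄ τ ^ (3 * k) * EisensteinSeries.E2 τ)
      = 24 * ∑ k ∈ Finset.range (HeckePartition.s ℓ + 1), (HeckePartition.c k ℓ : ℂ) *
        (k * E₄ τ ^ (3 * k - 1) * E₆ τ * discriminant τ ^ (HeckePartition.s ℓ - k))
        + EisensteinSeries.E2 τ * heckePoly ℓ τ := by
    rw [heckePoly, Finset.mul_sum, Finset.mul_sum, ← Finset.sum_add_distrib]
    exact Finset.sum_congr rfl fun k _ ↦ by ring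
  rw [hsum]
  simp only [Pi.pow_apply, Pi.mul_apply, Function.comp_apply, ofComplex_apply] at hu
  have hpi := Complex.two_pi_I_ne_zero
  generalize ∑ k ∈ Finset.range (HeckePartition.s ℓ + 1), (HeckePartition.c k ℓ : ℂ) *
        (k * E₄ τ ^ (3 * k - 1) * E₆ τ * discriminant τ ^ (HeckePartition.s ℓ - k)) = S at *
  generalize deriv (heckeInv ℓ) τ = H' at *
  generalize heckeInv ℓ τ = H at *
  generalize heckePoly ℓ τ = P at *
  generalize discriminant τ ^ (HeckePartition.s ℓ - 1) = d at *
  generalize discriminant τ ^ HeckePartition.s ℓ = d' at *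
  -- Differentiating Δ^s · η · H = P, the terms in sE₂P on the two sides cancel; the derivative of η
  -- leaves −E₂P/24.
  have hmain : d' * (eta τ * H') = 2 * Real.pi * I * (-S - EisensteinSeries.E2 τ * P / 24) := by
    linear_combination hu - 2 * Real.pi * I * EisensteinSeries.E2 τ * eta τ * H * hd
      - 2 * Real.pi * I * EisensteinSeries.E2 τ * (HeckePartition.s ℓ + 1 / 24) * hP
  have : (2 * Real.pi * I)⁻¹ * (d' * (eta τ * H')) = -S - EisensteinSeries.E2 τ * P / 24 := by
    rw [hmain, inv_mul_cancel_left₀ hpi]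
  linear_combination 24 * this

lemma deriv_etaInv (τ : ℍ) : (2 * Real.pi * I)⁻¹ * deriv etaInv τ
    = -(EisensteinSeries.E2 τ / (24 * eta τ)) := by
  have h : HasDerivAt etaInv _ τ := (hasDerivAt_eta τ).inv (eta_ne_zero τ.im_pos)
  have hpi := Complex.two_pi_I_ne_zero
  have he := eta_ne_zero τ.im_pos
  have hpi' : (Real.pi : ℂ) ≠ 0 := Complex.ofReal_ne_zero.mpr Real.pi_ne_zero
  have hI := I_ne_zero
  rw [h.deriv]
  field_simp
  ring

/-! ### The series `Ξ` -/

lemma d_intCast_div (m : ℤ) :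
    ((HeckePartition.d (((m : ℚ) + 1) / 24) : ℚ) : ℂ) = m * partCoeff m := by
  rw [HeckePartition.d, partCoeff]
  push_cast
  ring

lemma p_div_eq_zero {m N : ℤ} (hN : N ≠ 0) (h : ¬ N ∣ m) :
    HeckePartition.p (((m : ℚ) / N + 1) / 24) = 0 := by
  rw [HeckePartition.p, if_neg]
  rintro ⟨hden, -⟩
  refine h ⟨24 * (((m : ℚ) / N + 1) / 24).num - 1, ?_⟩
  have h1 : ((((m : ℚ) / N + 1) / 24).num : ℚ) = ((m : ℚ) / N + 1) / 24 := by
    conv_rhs => rw [← Rat.num_div_den (((m : ℚ) / N + 1) / 24), hden]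
    simp
  have hN' : (N : ℚ) ≠ 0 := Int.cast_ne_zero.mpr hN
  have : (m : ℚ) = N * (24 * ((((m : ℚ) / N + 1) / 24).num : ℚ) - 1) := by
    rw [h1]; field_simp; ring
  exact_mod_cast this

/-- Put M = 24n − 1. The arguments of d correspond to the exponents ℓ²M, M and M/ℓ², so the factors
24x − 1 are M times ℓ², 1 and ℓ^(−2). These turn the weights 1 and ℓ in Ξ_ℓ, after multiplication by
ℓ, into the weights ℓ³ and 1 of `heckeCoeff`. -/
lemma natCast_mul_xiCoeff (h2 : ¬ 2 ∣ ℓ) (h3 : ¬ 3 ∣ ℓ) (n : ℤ) :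
    (ℓ : ℂ) * (HeckePartition.xiCoeff ℓ n : ℚ)
      = (24 * n - 1 : ℤ) * heckeCoeff ℓ (24 * n - 1)
        - ℓ * HeckePartition.chi12 ℓ * (1 + ℓ) * ((24 * n - 1 : ℤ) * partCoeff (24 * n - 1)) := by
  have hs := sq_eq_twentyFour_mul h2 h3
  have hsQ : (ℓ : ℚ) ^ 2 = 24 * HeckePartition.s ℓ + 1 := by exact_mod_cast hs
  have hℓ : (ℓ : ℚ) ≠ 0 := Nat.cast_ne_zero.mpr (NeZero.ne ℓ)
  have hℓC : (ℓ : ℂ) ≠ 0 := Nat.cast_ne_zero.mpr (NeZero.ne ℓ)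
  have hN : ((ℓ ^ 2 : ℕ) : ℤ) ≠ 0 := Int.natCast_ne_zero.mpr (NeZero.ne _)
  set M : ℤ := 24 * n - 1 with hM
  have e1 : (ℓ : ℚ) ^ 2 * n - HeckePartition.s ℓ
      = ((((ℓ ^ 2 : ℕ) * M : ℤ) : ℚ) + 1) / 24 := by
    rw [hM]; push_cast; linear_combination hsQ / 24
  have e2 : (n : ℚ) = ((M : ℚ) + 1) / 24 := by rw [hM]; push_cast; ring
  have e3 : ((n : ℚ) + HeckePartition.s ℓ) / (ℓ : ℚ) ^ 2
      = ((M : ℚ) / ((ℓ ^ 2 : ℕ) : ℤ) + 1) / 24 := by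
    rw [hM]; push_cast; field_simp; linear_combination -hsQ
  have h1 := d_intCast_div ((ℓ ^ 2 : ℕ) * M)
  have h4 := d_intCast_div M
  rw [← e1] at h1
  rw [← e2] at h4
  have h5 : (ℓ : ℂ) * ((HeckePartition.d (((n : ℚ) + HeckePartition.s ℓ) / (ℓ : ℚ) ^ 2) : ℚ) : ℂ)
      * ℓ = M * if ((ℓ ^ 2 : ℕ) : ℤ) ∣ M then partCoeff (M / (ℓ ^ 2 : ℕ)) else 0 := by
    rw [e3]
    split_ifs with hd
    · obtain ⟨k, hk⟩ := hd
      have hk' : (M : ℚ) / ((ℓ ^ 2 : ℕ) : ℤ) = k := by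
        rw [hk]; push_cast; field_simp
      rw [hk', d_intCast_div, hk, Int.mul_ediv_cancel_left _ hN]
      push_cast
      ring
    · rw [HeckePartition.d, p_div_eq_zero hN hd]
      push_cast
      ring
  have hleg : legendreSym ℓ (1 - 24 * n) = legendreSym ℓ (-M) := by rw [hM, neg_sub]
  rw [HeckePartition.xiCoeff, heckeCoeff, hleg]
  push_cast at h1 h4 h5 ⊢
  linear_combination ℓ * h1 + ℓ * HeckePartition.chi12 ℓ *
    ((legendreSym ℓ (-M) : ℂ) - 1 - ℓ) * h4 + h5

/-- The series `Ξ` is the derivative of the Hecke image minus a multiple of the derivative of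
`1 / η`. -/
lemma hasSum_xiTerm (h2 : ¬ 2 ∣ ℓ) (h3 : ¬ 3 ∣ ℓ) (τ : ℍ) :
    HasSum (fun m ↦ (ℓ : ℂ) * HeckePartition.xiTerm ℓ τ m)
      (24 * ((2 * Real.pi * I)⁻¹ * deriv (heckeInv ℓ) τ)
        + HeckePartition.chi12 ℓ * ℓ * (1 + ℓ) * EisensteinSeries.E2 τ / eta τ) := by
  have hs := sq_eq_twentyFour_mul h2 h3
  have h := (((hasExp_heckeInv h2).deriv.const_mul 24).add
    (hasExp_etaInv.deriv.const_mul (-(24 * (ℓ * HeckePartition.chi12 ℓ * (1 + ℓ)))))) τ τ.im_pos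
  have hval : 24 * ((2 * Real.pi * I)⁻¹ * deriv (heckeInv ℓ) τ)
        + HeckePartition.chi12 ℓ * ℓ * (1 + ℓ) * EisensteinSeries.E2 τ / eta τ
      = 24 * ((2 * Real.pi * I)⁻¹ * deriv (heckeInv ℓ) τ)
        + -(24 * (ℓ * HeckePartition.chi12 ℓ * (1 + ℓ))) *
          ((2 * Real.pi * I)⁻¹ * deriv etaInv τ) := by
    rw [deriv_etaInv]
    have he := eta_ne_zero τ.im_pos
    field_simp
  rw [hval]
  -- The index m of Ξ_ℓ corresponds to the exponent 24m − ℓ² = 24(m − s) − 1; all other coefficients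
  -- of the two expansions vanish.
  rw [← (shift_injective (-((ℓ ^ 2 : ℕ) : ℤ))).hasSum_iff] at h
  · refine hasSum_of_eq h fun m ↦ ?_
    have hM : 24 * (m : ℤ) + -((ℓ ^ 2 : ℕ) : ℤ) = 24 * ((m : ℤ) - HeckePartition.s ℓ) - 1 := by
      rw [hs]; push_cast; ring
    have hx := natCast_mul_xiCoeff h2 h3 ((m : ℤ) - HeckePartition.s ℓ)
    have hq : cexp (2 * Real.pi * I * (((m : ℂ) - HeckePartition.s ℓ) - 1 / 24) * τ)
        = qe (24 * ((m : ℤ) - HeckePartition.s ℓ) - 1) τ := by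
      rw [qe]; congr 1; push_cast; ring
    rw [Function.comp_apply, hM, HeckePartition.xiTerm, hq, ← mul_assoc, hx]
    ring
  · intro m hm
    have h1 : heckeCoeff ℓ m = 0 := by
      by_contra h0
      obtain ⟨n, hn⟩ := exists_of_heckeCoeff_ne_zero h2 h3 h0
      exact hm ⟨n, hn.symm⟩
    have h4 : partCoeff m = 0 := by
      by_contra h0
      obtain ⟨n, hn⟩ := exists_of_partCoeff_ne_zero h0
      exact hm ⟨n + HeckePartition.s ℓ, by rw [hs]; push_cast; lia⟩
    simp only [h1, h4]
    ring
end
end HeckeEta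

/-! ### The theorem -/

theorem theorem2p3 (ℓ : ℕ) [Fact ℓ.Prime] (hℓ : 5 ≤ ℓ) (z : UpperHalfPlane) :
    Summable (HeckePartition.xiTerm ℓ z) ∧
    (ℓ : ℂ) * HeckePartition.Xi ℓ z * ModularForm.eta z
        * ModularForm.discriminant z ^ HeckePartition.s ℓ
      = - ∑ n ∈ Finset.range (HeckePartition.s ℓ + 1),
            (HeckePartition.c n ℓ : ℂ) * ModularForm.discriminant z ^ (HeckePartition.s ℓ - n)
              * (24 * (n : ℂ) * ModularForm.E₄ z ^ (3 * n - 1) * ModularForm.E₆ z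
                  + ModularForm.E₄ z ^ (3 * n) * EisensteinSeries.E2 z)
        + (HeckePartition.chi12 ℓ : ℂ) * ℓ * (1 + ℓ) * EisensteinSeries.E2 z
            * ModularForm.discriminant z ^ HeckePartition.s ℓ := by
  have hp : ℓ.Prime := Fact.out
  have h2 : ¬ 2 ∣ ℓ := fun h ↦ by
    have := (Nat.prime_dvd_prime_iff_eq Nat.prime_two hp).mp h
    omega
  have h3 : ¬ 3 ∣ ℓ := fun h ↦ by
    have := (Nat.prime_dvd_prime_iff_eq Nat.prime_three hp).mp h
    omega
  have hℓ0 : (ℓ : ℂ) ≠ 0 := Nat.cast_ne_zero.mpr hp.ne_zero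
  have h := HeckeEta.hasSum_xiTerm h2 h3 z
  refine ⟨(summable_mul_left_iff hℓ0).mp h.summable, ?_⟩
  have hXi : (ℓ : ℂ) * HeckePartition.Xi ℓ z = _ := tsum_mul_left.symm.trans h.tsum_eq
  have he := ModularForm.eta_ne_zero z.im_pos
  rw [hXi, add_mul, add_mul, HeckeEta.deriv_heckeInv h2 h3 z, div_mul_cancel₀ _ he]
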